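/- Throughout, $\log$ is the logarithm to base $2$. For $n\ge 3$ let $\Pi_n$ be the set of permutations (arrival orders) of $n$ items, with $\pi(t)$ the item arriving at time $t$, and for a probability distribution $\mathcal D$ on $\Pi_n$ let $\mathcal H(\mathcal D)=-\sum_{\pi}\mathcal D(\pi)\log\mathcal D(\pi)$ be its Shannon entropy. The items have pairwise distinct real values $v(1),\dots,v(n)$ fixed by an adversary. The wait-and-pick $1$-secretary algorithm with time threshold $m$ observes the first $m$ arriving values and then picks the first arriving item whose value is larger than all values observed before it (or the last item if there is none). A family $(\mathcal D_n)_{n\ge 3}$ of distributions on $\Pi_n$ is *computable in time $O(n)$* if, on a unit-cost RAM with words of $O(\log n)$ bits, a fixed program on input $n$ constructs in $O(n)$ steps a representation of $\mathcal D_n$ as the uniform distribution on a multiset $\{\pi_0,\dots,\pi_{N-1}\}$ of $N\ge 1$ permutations: it outputs $N$, and from the memory contents that it leaves and any given index $r<N$ a fixed second program writes out $\pi_r(1),\dots,\pi_r(n)$ in $O(n)$ steps, the $O(n)$ being uniform in $r$. **Theorem.** Let $C>0$ be any fixed constant and let $C_1=\dfrac{C}{\log(e/(e-1))}$. There exist distributions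 $\mathcal D_n$ on $\Pi_n$ $(n\ge 3)$ that are computable in time $O(n)$ and have entropy $\mathcal H(\mathcal D_n)=O(\log\log n)$, such that for every choice of pairwise distinct values $v(1),\dots,v(n)$ the wait-and-pick $1$-secretary algorithm with time threshold $\lfloor n/e\rfloor$, executed on a permutation drawn from $\mathcal D_n$, picks the item of largest value with probability at least $$\frac1e-\frac{(C_1\log\log n)^2}{\log^{C/2}n}-o\!\left(\frac{(\log\log n)^2}{\log^{C/2}n}\right).$$ The program, the constants in the $O(\cdot)$ and the $o(\cdot)$ term may depend on $C$ but not on the values $v$. -/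

import Mathlib

namespace Secretary

/-! ### The wait-and-pick algorithm for the 1-secretary problem

Items are indexed by `Fin n`, and `v i` is the value of item `i`. An arrival order is a permutation
`π`, where `π t` is the item that arrives at the (zero-based) time `t`; the algorithm sees the
sequence of values `x = v ∘ π`. -/

/-- The times `t` after the observation period `{0, …, m - 1}` at which the current value is larger
than all the previously observed ones. -/
noncomputable def acceptTimes {n : ℕ} (m : ℕ) (x : Fin n → ℝ) : Finset (Fin n) :=
  Finset.univ.filter fun t => m ≤ (t : ℕ) ∧ ∀ s, s < t → x s < x t

/-- The time at which the wait-and-pick algorithm with time threshold `m` accepts: the first time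
after the observation period at which the value is larger than all the previously observed ones,
and the last time if there is none. -/
noncomputable def waitAndPick {n : ℕ} (hn : 0 < n) (m : ℕ) (x : Fin n → ℝ) : Fin n :=
  if h : (acceptTimes m x).Nonempty then (acceptTimes m x).min' h else ⟨n - 1, by omega⟩

/-- With values `v` and arrival order `π`, wait-and-pick with threshold `m` picks a best item. -/
def PicksBest {n : ℕ} (hn : 0 < n) (m : ℕ) (v : Fin n → ℝ) (π : Equiv.Perm (Fin n)) : Prop :=
  ∀ i, v i ≤ v (π (waitAndPick hn m (v ∘ π)))

open Classical in
/-- The probability, over `π ∼ D`, that wait-and-pick with threshold `m` picks a best item. -/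
noncomputable def successProb {n : ℕ} (hn : 0 < n) (m : ℕ) (D : PMF (Equiv.Perm (Fin n)))
    (v : Fin n → ℝ) : ℝ :=
  ∑ π : Equiv.Perm (Fin n), if PicksBest hn m v π then (D π).toReal else 0

/-- Shannon entropy (base 2; the convention `0 * log 0 = 0` is automatic). -/
noncomputable def entropy {n : ℕ} (D : PMF (Equiv.Perm (Fin n))) : ℝ :=
  -∑ π : Equiv.Perm (Fin n), (D π).toReal * Real.logb 2 (D π).toReal

/-! ### A word RAM

Structured programs over registers and an indirectly addressed memory. Every instruction and
every test of a condition costs one step. Everything that is computed has to be smaller than a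
bound `B`; with `B = n ^ a` this is the RAM with words of `O(log n)` bits. -/

/-- The arithmetic instructions (subtraction is truncated; `div` and `mod` are those of `ℕ`). -/
inductive ArithOp
  | add | sub | mul | div | mod

/-- The value of an arithmetic instruction. -/
def ArithOp.eval : ArithOp → ℕ → ℕ → ℕ
  | .add, a, b => a + b
  | .sub, a, b => a - b
  | .mul, a, b => a * b
  | .div, a, b => a / b
  | .mod, a, b => a % b

/-- Programs. Registers are named by natural numbers. -/
inductive Prog
  /-- `reg x := c` -/
  | const (x c : ℕ)
  /-- `reg x := reg y op reg z` -/
  | arith (op : ArithOp) (x y z : ℕ)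
  /-- `reg x := mem (reg y)` -/
  | load (x y : ℕ)
  /-- `mem (reg x) := reg y` -/
  | store (x y : ℕ)
  /-- `p; q` -/
  | seq (p q : Prog)
  /-- `if reg x < reg y then p else q` -/
  | ifLt (x y : ℕ) (p q : Prog)
  /-- `while reg x < reg y do p` -/
  | whileLt (x y : ℕ) (p : Prog)

/-- Machine states: contents of the registers and of the memory. -/
structure State where
  reg : ℕ → ℕ
  mem : ℕ → ℕ

/-- Assign `c` to register `x`. -/
def State.setReg (s : State) (x c : ℕ) : State := ⟨Function.update s.reg x c, s.mem⟩

/-- Assign `c` to the memory cell with address `x`. -/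
def State.setMem (s : State) (x c : ℕ) : State := ⟨s.reg, Function.update s.mem x c⟩

/-- The initial state on input `n`: register `0` holds `n`, everything else is `0`. -/
def State.input (n : ℕ) : State := ⟨Function.update (fun _ => 0) 0 n, fun _ => 0⟩

/-- `Exec B p s s' t`: the program `p`, started in state `s`, halts in state `s'` after exactly `t`
steps, and everything it computed on the way is smaller than `B`. -/
inductive Exec (B : ℕ) : Prog → State → State → ℕ → Prop
  | const (s : State) (x c : ℕ) (h : c < B) : Exec B (.const x c) s (s.setReg x c) 1
  | arith (s : State) (op : ArithOp) (x y z : ℕ) (h : op.eval (s.reg y) (s.reg z) < B) :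
      Exec B (.arith op x y z) s (s.setReg x (op.eval (s.reg y) (s.reg z))) 1
  | load (s : State) (x y : ℕ) (h : s.reg y < B) :
      Exec B (.load x y) s (s.setReg x (s.mem (s.reg y))) 1
  | store (s : State) (x y : ℕ) (h : s.reg x < B) (h' : s.reg y < B) :
      Exec B (.store x y) s (s.setMem (s.reg x) (s.reg y)) 1
  | seq {p q : Prog} {s s₁ s₂ : State} {t₁ t₂ : ℕ} (h₁ : Exec B p s s₁ t₁)
      (h₂ : Exec B q s₁ s₂ t₂) : Exec B (.seq p q) s s₂ (t₁ + t₂)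
  | ifTrue {x y : ℕ} {p q : Prog} {s s' : State} {t : ℕ} (h : s.reg x < s.reg y)
      (h₁ : Exec B p s s' t) : Exec B (.ifLt x y p q) s s' (t + 1)
  | ifFalse {x y : ℕ} {p q : Prog} {s s' : State} {t : ℕ} (h : ¬ s.reg x < s.reg y)
      (h₁ : Exec B q s s' t) : Exec B (.ifLt x y p q) s s' (t + 1)
  | whileDone {x y : ℕ} {p : Prog} {s : State} (h : ¬ s.reg x < s.reg y) :
      Exec B (.whileLt x y p) s s 1
  | whileStep {x y : ℕ} {p : Prog} {s s₁ s₂ : State} {t₁ t₂ : ℕ} (h : s.reg x < s.reg y)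
      (h₁ : Exec B p s s₁ t₁) (h₂ : Exec B (.whileLt x y p) s₁ s₂ t₂) :
      Exec B (.whileLt x y p) s s₂ (t₁ + t₂ + 1)

/-- The family `D` of permutation distributions can be computed in time `O(n)` on a word RAM.

A fixed program `prep`, run on input `n`, constructs in at most `c * n` steps a representation of
`D n` as the uniform distribution on a multiset of `N` permutations `π 0, …, π (N - 1)`:
it leaves `N` in register `0`, and a fixed program `draw`, continuing with any index `r < N` in
register `1`, writes the values `π r 0, …, π r (n - 1)` to the memory cells `0, …, n - 1` in at
most `c * n` steps. The words have `O(log n)` bits. (`3 ≤ n` says that the time threshold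
`⌊n/e⌋` is one of `1, …, n - 1`.) -/
def ComputableInLinearTime (D : ∀ n : ℕ, PMF (Equiv.Perm (Fin n))) : Prop :=
  ∃ (prep draw : Prog) (a c : ℕ), ∀ n : ℕ, 3 ≤ n →
    ∃ (s : State) (t N : ℕ) (π : Fin N → Equiv.Perm (Fin n)),
      Exec (n ^ a) prep (State.input n) s t ∧ t ≤ c * n ∧ s.reg 0 = N ∧ 0 < N ∧
      (∀ r : Fin N, ∃ (s' : State) (t' : ℕ),
        Exec (n ^ a) draw (s.setReg 1 r) s' t' ∧ t' ≤ c * n ∧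
        ∀ i : Fin n, s'.mem i = (π r i : ℕ)) ∧
      ∀ σ : Equiv.Perm (Fin n),
        D n σ = ((Finset.univ.filter fun r => π r = σ).card : ENNReal) / (N : ENNReal)

end Secretary

/-!
The arrival order sorts the items by slots in `ZMod p`, which are computed from a seed of
`O(log log n)` bits. For primes `q` and `p`, both powers of `log n` up to constant factors and with
`p` much larger than `q`, the seed consists of `x : ZMod q` and `z y w : ZMod p`. Item `i` falls into
the bucket `h` that is the value at `x` of the polynomial over `ZMod q` with the base `q` digits of
`i` as coefficients (`itemHash`), and bucket `h` has the slot `y * z ^ h + w` (`slot`). There are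
`q * p ^ 3` seeds, so the entropy is at most the logarithm of this number, which is `O(log log n)`.

*Success.* Suppose that about `n / e` items have slots below `p / e`. Then wait-and-pick succeeds if
for some `r` the best item has a slot above `p / e`, the next `r` items have larger slots than the
best one, and the item after these has a slot below `p / e` (`picksBest_of_rank`). These events
`Caught` are disjoint for different `r` (`sum_caught_le`), and for independent uniform slots their
probabilities are `(1 / e) * ∫ (1 - t) ^ r dt` over `1 / e < t < 1`; they add up to
`(1 / e) * ∫ 1 / t dt = 1 / e` (`le_sum_sum_caught`).

*Independence.* Fix `x` so that the best items have distinct buckets, as it happens for all but a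
few `x` (`card_itemHash_eq_le`). By the shift `w` the slot of the best item is uniform, and the
other slots differ from it by `y * (z ^ h - z ^ h₀)`. A linear combination of these differences is
`y` times a nonzero polynomial of degree below `q` in `z`, so it is uniform except for at most `q`
of the `p` choices of `z` (`card_zeros_le`). Hence products of functions of the differences have the
right mean up to `q / p` times the product of the `ℓ¹` norms of their Fourier transforms
(`abs_sum_prod_sub_le`). This is useful only if the norms are small, whereas `k = O(log log n)`
factors occur, and the indicator function of an interval has a large norm. It is therefore bounded
from below by a sum of layers (`sum_layer_le`), each of norm at most one, whose means decrease
geometrically. In the expansion of a product of `r` such sums only the terms with a bounded sum of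
the layer indices are kept: there are few of them (`card_sum_le`), and the others contribute little
to the mean (`pow_sum_sub_le`). This gives `le_sum_indicator_shift` and `le_sum_caught`.

*Loads.* The slots of two items are independent but for few `x` and `z`, so by Chebyshev's
inequality the number of items in an initial segment of the slots is close to its mean
(`sum_load_sub_sq_le`). Together this is `le_sum_picksBest`: the failure probability exceeds
`1 - 1 / e` by at most a constant times `(log n) ^ (-A)`, where `A` can be any natural number, at the
cost of larger primes. With `A > C / 2` this is of smaller order than the allowed error.

*Programs.* The first program finds the primes by trial division (`runs_prepProg`). The second one
tabulates the slots of the buckets, computes the buckets of the items by the recursion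
`h i = h (i / q) * x + i % q`, and sorts by counting (`runs_drawProg`). The programs are verified by
a rule for loops (`Runs.whileLt`) and the weakest preconditions of the loop bodies (`Runs.of_wp`).
-/

/-! ### Fourier expansions on `ZMod p` -/

namespace Secretary

open Finset

/-- The function `f` on `ZMod p` has mean `μ`, and its Fourier coefficients have absolute values
with sum at most `A`. -/
def HasFourier {p : ℕ} [NeZero p] (f : ZMod p → ℝ) (μ A : ℝ) : Prop :=
  ∃ g : ZMod p → ℂ, (∀ a, (f a : ℂ) = ∑ c, g c * ZMod.stdAddChar (c * a)) ∧
    g 0 = (μ : ℂ) ∧ ∑ c, ‖g c‖ ≤ A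

section Fourier

variable {p : ℕ}

/-- The triangular bump of half-width `w` around `c`, normalized to have height `1`: the
autocorrelation of an interval of length `w`. -/
noncomputable def bump (p w c : ℕ) (a : ZMod p) : ℝ :=
  (w : ℝ)⁻¹ * #{x ∈ range w ×ˢ range w | ((c + x.1 : ℕ) : ZMod p) = a + (x.2 : ℕ)}

lemma bump_nonneg (w c : ℕ) (a : ZMod p) : 0 ≤ bump p w c a := by
  unfold bump; positivity

variable [NeZero p]

lemma HasFourier.translate {f : ZMod p → ℝ} {μ A : ℝ} (h : HasFourier f μ A) (b : ZMod p) :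
    HasFourier (fun a => f (b + a)) μ A := by
  obtain ⟨g, h1, h2, h3⟩ := h
  refine ⟨fun c => g c * ZMod.stdAddChar (c * b), fun a => ?_, ?_, ?_⟩
  · rw [h1]
    refine Finset.sum_congr rfl fun c _ => ?_
    rw [mul_add, AddChar.map_add_eq_mul, mul_assoc]
  · simp [h2]
  · simpa [AddChar.norm_apply] using h3

lemma HasFourier.add {f f' : ZMod p → ℝ} {μ A μ' A' : ℝ} (h : HasFourier f μ A)
    (h' : HasFourier f' μ' A') : HasFourier (fun a => f a + f' a) (μ + μ') (A + A') := by
  obtain ⟨g, h1, h2, h3⟩ := h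
  obtain ⟨g', h1', h2', h3'⟩ := h'
  refine ⟨fun c => g c + g' c, fun a => ?_, ?_, ?_⟩
  · push_cast
    rw [h1, h1', ← Finset.sum_add_distrib]
    simp_rw [add_mul]
  · simp [h2, h2']
  · calc ∑ c, ‖g c + g' c‖ ≤ ∑ c, (‖g c‖ + ‖g' c‖) := Finset.sum_le_sum fun c _ => norm_add_le _ _
      _ ≤ _ := by rw [Finset.sum_add_distrib]; linarith

lemma HasFourier.const_mul {f : ZMod p → ℝ} {μ A : ℝ} (h : HasFourier f μ A) {r : ℝ}
    (hr : 0 ≤ r) : HasFourier (fun a => r * f a) (r * μ) (r * A) := by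
  obtain ⟨g, h1, h2, h3⟩ := h
  refine ⟨fun c => r * g c, fun a => ?_, ?_, ?_⟩
  · push_cast
    rw [h1, Finset.mul_sum]
    simp_rw [mul_assoc]
  · simp [h2]
  · simp only [norm_mul, Complex.norm_real, Real.norm_eq_abs, abs_of_nonneg hr]
    rw [← Finset.mul_sum]
    exact mul_le_mul_of_nonneg_left h3 hr

lemma HasFourier.zero : HasFourier (fun _ : ZMod p => 0) 0 0 :=
  ⟨0, by simp, by simp, by simp⟩

lemma HasFourier.sum {κ : Type*} (s : Finset κ) {f : κ → ZMod p → ℝ} {μ A : κ → ℝ}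
    (h : ∀ i ∈ s, HasFourier (f i) (μ i) (A i)) :
    HasFourier (fun a => ∑ i ∈ s, f i a) (∑ i ∈ s, μ i) (∑ i ∈ s, A i) := by
  classical
  induction s using Finset.induction_on with
  | empty => simpa using HasFourier.zero
  | insert i s hi ih =>
    simp only [Finset.sum_insert hi]
    exact (h i (Finset.mem_insert_self _ _)).add
      (ih fun j hj => h j (Finset.mem_insert_of_mem hj))

lemma map_sum_addChar {ι R : Type*} [AddCommMonoid R] (ψ : AddChar R ℂ) (s : Finset ι)
    (f : ι → R) : ψ (∑ i ∈ s, f i) = ∏ i ∈ s, ψ (f i) := by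
  classical
  induction s using Finset.induction_on with
  | empty => simp
  | insert i s hi ih => rw [sum_insert hi, prod_insert hi, AddChar.map_add_eq_mul, ih]

lemma sum_stdAddChar_mul (b : ZMod p) :
    ∑ x : ZMod p, (ZMod.stdAddChar (x * b) : ℂ) = if b = 0 then (p : ℂ) else 0 := by
  rw [AddChar.sum_mulShift b (ZMod.isPrimitive_stdAddChar p)]
  simp [ZMod.card]

/-- If no nontrivial linear combination of the `V i` has more than `B` zeros, then the random
variables `y * V i z`, with `y` and `z` uniform in `ZMod p`, behave on functions with small
Fourier coefficients as if they were independent and uniform. -/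
theorem abs_sum_prod_sub_le {ι : Type*} [Fintype ι] [DecidableEq ι] {f : ι → ZMod p → ℝ}
    {μ A : ι → ℝ} (hf : ∀ i, HasFourier (f i) (μ i) (A i)) (V : ι → ZMod p → ZMod p) (B : ℕ)
    (hV : ∀ c : ι → ZMod p, c ≠ 0 → #{z | ∑ i, c i * V i z = 0} ≤ B) :
    |∑ z, ∑ y, ∏ i, f i (y * V i z) - p ^ 2 * ∏ i, μ i| ≤ p * B * ∏ i, A i := by
  choose g hg hg0 hgA using hf
  have hexp : ((∑ z, ∑ y, ∏ i, f i (y * V i z) : ℝ) : ℂ)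
      = ∑ c : ι → ZMod p, (∏ i, g i (c i)) * (p * #{z | ∑ i, c i * V i z = 0}) := by
    have h1 : ∀ z y, ((∏ i, f i (y * V i z) : ℝ) : ℂ)
        = ∑ c : ι → ZMod p, (∏ i, g i (c i)) * ZMod.stdAddChar (y * ∑ i, c i * V i z) := by
      intro z y
      push_cast
      simp_rw [hg]
      rw [Finset.prod_univ_sum, Fintype.piFinset_univ]
      refine Finset.sum_congr rfl fun c _ => ?_
      rw [Finset.prod_mul_distrib, Finset.mul_sum, map_sum_addChar]
      congr 1
      refine Finset.prod_congr rfl fun i _ => ?_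
      congr 1
      ring
    rw [Complex.ofReal_sum]
    simp_rw [Complex.ofReal_sum, h1]
    have h2 : ∀ z, ∑ y, ∑ c : ι → ZMod p,
        (∏ i, g i (c i)) * (ZMod.stdAddChar (y * ∑ i, c i * V i z) : ℂ)
        = ∑ c : ι → ZMod p, (∏ i, g i (c i)) * (if ∑ i, c i * V i z = 0 then (p : ℂ) else 0) := by
      intro z
      rw [Finset.sum_comm]
      refine Finset.sum_congr rfl fun c _ => ?_
      rw [← Finset.mul_sum, sum_stdAddChar_mul]
    simp_rw [h2]
    rw [Finset.sum_comm]
    refine Finset.sum_congr rfl fun c _ => ?_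
    rw [← Finset.mul_sum, ← Finset.sum_filter, Finset.sum_const, nsmul_eq_mul]
    ring
  have hmain : ((∏ i, μ i : ℝ) : ℂ) * p ^ 2
      = ∑ c : ι → ZMod p, (∏ i, g i (c i)) * (if c = 0 then (p : ℂ) ^ 2 else 0) := by
    simp only [mul_ite, mul_zero, Finset.sum_ite_eq', Finset.mem_univ, if_true, Pi.zero_apply]
    push_cast
    simp_rw [hg0]
  have hdiff : ((∑ z, ∑ y, ∏ i, f i (y * V i z) - p ^ 2 * ∏ i, μ i : ℝ) : ℂ)
      = ∑ c : ι → ZMod p, (∏ i, g i (c i)) *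
        (p * #{z | ∑ i, c i * V i z = 0} - (if c = 0 then (p : ℂ) ^ 2 else 0)) := by
    simp_rw [mul_sub]
    rw [Finset.sum_sub_distrib, ← hexp, ← hmain]
    push_cast
    ring
  rw [← Real.norm_eq_abs, ← Complex.norm_real, hdiff]
  calc _ ≤ ∑ c : ι → ZMod p, (∏ i, ‖g i (c i)‖) * (p * B) := by
        refine (norm_sum_le _ _).trans (Finset.sum_le_sum fun c _ => ?_)
        rw [norm_mul, norm_prod]
        refine mul_le_mul_of_nonneg_left ?_ (by positivity)
        -- the term `c = 0` is the product of the means and cancels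
        by_cases hc : c = 0
        · subst hc
          simp [ZMod.card, sq]
          positivity
        · rw [if_neg hc, sub_zero, norm_mul, Complex.norm_natCast, Complex.norm_natCast]
          have : (#{z | ∑ i, c i * V i z = 0} : ℝ) ≤ B := by exact_mod_cast hV c hc
          gcongr
    _ = p * B * ∏ i, ∑ c, ‖g i c‖ := by
        rw [← Finset.sum_mul, Finset.prod_univ_sum, Fintype.piFinset_univ]
        ring
    _ ≤ p * B * ∏ i, A i := by
        refine mul_le_mul_of_nonneg_left (Finset.prod_le_prod (fun i _ => ?_) fun i _ => hgA i)
          (by positivity)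
        exact Finset.sum_nonneg fun c _ => norm_nonneg _

/-- The Fourier coefficients of a triangular bump around `0` are nonnegative, hence their sum is
the value at `0`. -/
lemma hasFourier_bump {w : ℕ} (hw : w ≤ p) (c : ℕ) : HasFourier (bump p w c) (w / p) 1 := by
  rcases Nat.eq_zero_or_pos w with rfl | hw0
  · refine ⟨0, fun a => ?_, ?_, ?_⟩ <;> simp [bump]
  have hp0 : (p : ℝ) ≠ 0 := by exact_mod_cast NeZero.ne p
  have hw0' : (w : ℝ) ≠ 0 := by positivity
  set e : ZMod p → ℂ := fun d => ∑ s ∈ range w, ZMod.stdAddChar (d * (s : ZMod p)) with he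
  set k : ZMod p → ℝ := fun d => (w : ℝ)⁻¹ * (p : ℝ)⁻¹ * ‖e d‖ ^ 2 with hk
  have hsq : ∀ d, ((‖e d‖ ^ 2 : ℝ) : ℂ) = ∑ s ∈ range w, ∑ t ∈ range w,
      ZMod.stdAddChar (d * (((t : ℕ) : ZMod p) - ((s : ℕ) : ZMod p))) := by
    intro d
    push_cast
    rw [← Complex.conj_mul', he]
    simp only [map_sum]
    rw [Finset.sum_mul_sum]
    refine Finset.sum_congr rfl fun s _ => Finset.sum_congr rfl fun t _ => ?_
    rw [mul_sub, sub_eq_add_neg, AddChar.map_add_eq_mul, AddChar.map_neg_eq_conj, mul_comm]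
  have hcount : ∀ a : ZMod p, ((#{x ∈ range w ×ˢ range w | ((x.1 : ℕ) : ZMod p) = a + (x.2 : ℕ)} : ℝ) : ℂ)
      = ∑ d, ((‖e d‖ ^ 2 * (p : ℝ)⁻¹ : ℝ) : ℂ) * ZMod.stdAddChar (d * a) := by
    intro a
    have hp0' : (p : ℂ) ≠ 0 := by exact_mod_cast NeZero.ne p
    have h1 : ∀ d, ((‖e d‖ ^ 2 * (p : ℝ)⁻¹ : ℝ) : ℂ) * ZMod.stdAddChar (d * a)
        = ∑ s ∈ range w, ∑ t ∈ range w, (p : ℂ)⁻¹ * ZMod.stdAddChar (d * (a + (t : ZMod p) - (s : ZMod p))) := by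
      intro d
      rw [Complex.ofReal_mul, hsq]
      simp_rw [Finset.sum_mul]
      refine Finset.sum_congr rfl fun s _ => Finset.sum_congr rfl fun t _ => ?_
      have : d * (a + t - s) = d * ((t : ZMod p) - s) + d * a := by ring
      rw [this, AddChar.map_add_eq_mul]
      push_cast
      ring
    simp_rw [h1]
    rw [Finset.sum_comm]
    rw [Finset.card_filter, Finset.sum_product]
    push_cast
    refine Finset.sum_congr rfl fun s _ => ?_
    rw [Finset.sum_comm]
    refine Finset.sum_congr rfl fun t _ => ?_
    rw [← Finset.mul_sum, sum_stdAddChar_mul]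
    by_cases h : (s : ZMod p) = a + t
    · rw [if_pos h, if_pos (by rw [h]; ring), inv_mul_cancel₀ hp0', Complex.ofReal_one]
    · rw [if_neg h, if_neg (fun h' => h (by linear_combination -h')), mul_zero, Complex.ofReal_zero]
  have hbase : HasFourier (fun a : ZMod p => (w : ℝ)⁻¹ *
      #{x ∈ range w ×ˢ range w | ((x.1 : ℕ) : ZMod p) = a + (x.2 : ℕ)}) (w / p) 1 := by
    have hform : ∀ a : ZMod p, (((w : ℝ)⁻¹ *
        #{x ∈ range w ×ˢ range w | ((x.1 : ℕ) : ZMod p) = a + (x.2 : ℕ)} : ℝ) : ℂ)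
        = ∑ d, (k d : ℂ) * ZMod.stdAddChar (d * a) := by
      intro a
      rw [Complex.ofReal_mul, hcount, Finset.mul_sum]
      refine Finset.sum_congr rfl fun d _ => ?_
      simp only [hk]
      push_cast
      ring
    refine ⟨fun d => k d, hform, ?_, ?_⟩
    · simp only [hk, he]
      simp only [zero_mul, AddChar.map_zero_eq_one, sum_const, card_range, nsmul_eq_mul, mul_one,
        Complex.norm_natCast]
      rw [← Complex.ofReal_inj.mpr (show (w : ℝ)⁻¹ * (p : ℝ)⁻¹ * (w : ℝ) ^ 2 = w / p by field_simp)]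
    · have hk0 : ∀ d, 0 ≤ k d := fun d => by simp only [hk]; positivity
      have h0 := hform 0
      simp only [mul_zero, AddChar.map_zero_eq_one, mul_one, zero_add] at h0
      have h0' : (w : ℝ)⁻¹ * #{x ∈ range w ×ˢ range w | ((x.1 : ℕ) : ZMod p) = (x.2 : ℕ)}
          = ∑ d, k d := by exact_mod_cast h0
      simp only [Complex.norm_real, Real.norm_eq_abs, abs_of_nonneg (hk0 _)]
      rw [← h0']
      have hcard : #{x ∈ range w ×ˢ range w | ((x.1 : ℕ) : ZMod p) = (x.2 : ℕ)} ≤ w := by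
        calc _ ≤ #(range w) := by
              refine Finset.card_le_card_of_injOn Prod.fst ?_ ?_
              · intro x hx
                simp only [coe_filter, mem_product, mem_range, Set.mem_ofPred_eq] at hx
                simpa using hx.1.1
              · rintro ⟨a, b⟩ hx ⟨a', b'⟩ hx' hab
                simp only [coe_filter, mem_product, mem_range, Set.mem_ofPred_eq] at hx hx' hab
                subst hab
                have : ((b : ℕ) : ZMod p) = (b' : ℕ) := hx.2.symm.trans hx'.2
                rw [ZMod.natCast_eq_natCast_iff', Nat.mod_eq_of_lt (by omega),
                  Nat.mod_eq_of_lt (by omega)] at this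
                rw [this]
          _ = w := card_range w
      rw [inv_mul_le_iff₀ (by positivity), mul_one]
      exact_mod_cast hcard
  have := hbase.translate (-(c : ZMod p))
  convert this using 2 with a
  unfold bump
  congr 3
  refine Finset.filter_congr fun x _ => ?_
  push_cast
  constructor
  · intro h; linear_combination h
  · intro h; linear_combination h

/-- Inside the window `[0, p)` a bump is the tent function. -/
lemma bump_le {w c : ℕ} (h1 : w ≤ c) (h2 : c + w ≤ p) (a : ZMod p) :
    (w : ℝ) * bump p w c a ≤ max 0 (w - |(a.val : ℝ) - c|) := by
  rcases Nat.eq_zero_or_pos w with rfl | hw0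
  · simp
  have hw0' : (w : ℝ) ≠ 0 := by positivity
  unfold bump
  rw [← mul_assoc, mul_inv_cancel₀ hw0', one_mul]
  have hav := ZMod.val_lt a
  have key : ∀ x ∈ range w ×ˢ range w, ((c + x.1 : ℕ) : ZMod p) = a + (x.2 : ℕ) →
      c + x.1 = a.val + x.2 := by
    rintro ⟨s, t⟩ hx h
    simp only [mem_product, mem_range] at hx h ⊢
    have h' : ((c + s - t : ℕ) : ZMod p) = ((a.val : ℕ) : ZMod p) := by
      rw [Nat.cast_sub (by omega), h, ZMod.natCast_zmod_val]
      ring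
    rw [ZMod.natCast_eq_natCast_iff', Nat.mod_eq_of_lt (by omega),
      Nat.mod_eq_of_lt (by omega)] at h'
    omega
  have hsub1 : #{x ∈ range w ×ˢ range w | ((c + x.1 : ℕ) : ZMod p) = a + (x.2 : ℕ)}
      ≤ w - (a.val - c) := by
    calc _ ≤ #(range (w - (a.val - c))) := by
          refine Finset.card_le_card_of_injOn Prod.snd ?_ ?_
          · intro x hx
            have hx' := Finset.mem_filter.mp hx
            have := key x hx'.1 hx'.2
            simp only [mem_product, mem_range] at hx'
            simp only [coe_range, Set.mem_Iio]
            omega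
          · rintro x hx y hy hxy
            have hx' := Finset.mem_filter.mp hx
            have hy' := Finset.mem_filter.mp hy
            have := key x hx'.1 hx'.2
            have := key y hy'.1 hy'.2
            exact Prod.ext (by omega) hxy
      _ = _ := card_range _
  have hsub2 : #{x ∈ range w ×ˢ range w | ((c + x.1 : ℕ) : ZMod p) = a + (x.2 : ℕ)}
      ≤ w - (c - a.val) := by
    calc _ ≤ #(range (w - (c - a.val))) := by
          refine Finset.card_le_card_of_injOn Prod.fst ?_ ?_
          · intro x hx
            have hx' := Finset.mem_filter.mp hx
            have := key x hx'.1 hx'.2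
            simp only [mem_product, mem_range] at hx'
            simp only [coe_range, Set.mem_Iio]
            omega
          · rintro x hx y hy hxy
            have hx' := Finset.mem_filter.mp hx
            have hy' := Finset.mem_filter.mp hy
            have := key x hx'.1 hx'.2
            have := key y hy'.1 hy'.2
            exact Prod.ext hxy (by omega)
      _ = _ := card_range _
  set N := #{x ∈ range w ×ˢ range w | ((c + x.1 : ℕ) : ZMod p) = a + (x.2 : ℕ)}
  rcases Nat.eq_zero_or_pos N with h0 | h0
  · rw [h0]; simp
  · refine le_max_of_le_right ?_
    have e1 : N + a.val ≤ w + c := by omega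
    have e2 : N + c ≤ w + a.val := by omega
    have e1' : (N : ℝ) + a.val ≤ w + c := by exact_mod_cast e1
    have e2' : (N : ℝ) + c ≤ w + a.val := by exact_mod_cast e2
    rcases abs_cases ((a.val : ℝ) - c) with ⟨h, _⟩ | ⟨h, _⟩ <;> rw [h] <;> linarith

end Fourier

end Secretary

/-! ### Approximating intervals by bumps -/

namespace Secretary

open Finset

section Levels

/-- The `l`-th layer of the multiscale approximation of the indicator function of the interval
`(u, u + 2 ^ (M + 1) * δ)` from below: two bumps of height one half and of half-width
`2 ^ (M - l) * δ` that touch the ends of the interval from inside. (For `l = 0` they coincide.) -/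
noncomputable def layer (p M δ u l : ℕ) (a : ZMod p) : ℝ :=
  2⁻¹ * bump p (2 ^ (M - l) * δ) (u + 2 ^ (M - l) * δ) a +
    2⁻¹ * bump p (2 ^ (M - l) * δ) (u + 2 ^ (M + 1) * δ - 2 ^ (M - l) * δ) a

variable {p M δ u l : ℕ}

lemma layer_nonneg (a : ZMod p) : 0 ≤ layer p M δ u l a := by
  unfold layer
  have h1 := bump_nonneg (2 ^ (M - l) * δ) (u + 2 ^ (M - l) * δ) a
  have h2 := bump_nonneg (2 ^ (M - l) * δ) (u + 2 ^ (M + 1) * δ - 2 ^ (M - l) * δ) a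
  positivity

/-- The mean of the `l`-th layer. -/
noncomputable def layerMean (p M δ l : ℕ) : ℝ := ((2 ^ (M - l) * δ : ℕ) : ℝ) / p

lemma two_mul_layer_width_le : 2 * (2 ^ (M - l) * δ) ≤ 2 ^ (M + 1) * δ := by
  have : 2 ^ (M - l) ≤ 2 ^ M := Nat.pow_le_pow_right (by norm_num) (by omega)
  rw [pow_succ]
  nlinarith

lemma hasFourier_layer [NeZero p] (h : u + 2 ^ (M + 1) * δ ≤ p) :
    HasFourier (layer p M δ u l) (layerMean p M δ l) 1 := by
  have hw : 2 ^ (M - l) * δ ≤ p := by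
    have := two_mul_layer_width_le (M := M) (l := l) (δ := δ)
    omega
  have := ((hasFourier_bump hw (u + 2 ^ (M - l) * δ)).const_mul (r := 2⁻¹) (by norm_num)).add
    ((hasFourier_bump hw (u + 2 ^ (M + 1) * δ - 2 ^ (M - l) * δ)).const_mul (r := 2⁻¹)
      (by norm_num))
  unfold layerMean
  convert this using 1
  · rfl
  · ring
  · ring

/-- Adding two half tents of half-width `d` to a trapezoid with slopes of width `2 * d` gives at
most the trapezoid on the same base with slopes of width `d`. Here `s` and `r` are the distances
to the two ends of the base. -/
lemma trapezoid_refine {d s r : ℝ} (hd : 0 < d) (hsr : 4 * d ≤ s + r) :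
    max 0 (min (2 * d) (min s r)) + (max 0 (d - |s - d|) + max 0 (d - |r - d|))
      ≤ 2 * max 0 (min d (min s r)) := by
  rcases le_total s r with h | h
  · rw [min_eq_left h]
    have hr : max 0 (d - |r - d|) = 0 := by
      rw [abs_of_nonneg (by linarith)]; exact max_eq_left (by linarith)
    rw [hr]
    rcases le_total s 0 with h0 | h0
    · rw [min_eq_right (by linarith : s ≤ 2 * d), min_eq_right (by linarith : s ≤ d),
        max_eq_left h0, abs_of_nonpos (by linarith), max_eq_left (by linarith)]
      simp
    · rcases le_total s d with h1 | h1
      · rw [min_eq_right (by linarith : s ≤ 2 * d), min_eq_right h1, max_eq_right h0,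
          abs_of_nonpos (by linarith), max_eq_right (by linarith)]
        linarith
      · rw [min_eq_left h1, abs_of_nonneg (by linarith), max_eq_right hd.le]
        rcases le_total s (2 * d) with h2 | h2
        · rw [min_eq_right h2, max_eq_right h0, max_eq_right (by linarith)]
          linarith
        · rw [min_eq_left h2, max_eq_right (by linarith), max_eq_left (by linarith)]
          linarith
  · rw [min_eq_right h]
    have hr : max 0 (d - |s - d|) = 0 := by
      rw [abs_of_nonneg (by linarith)]; exact max_eq_left (by linarith)
    rw [hr]
    rcases le_total r 0 with h0 | h0
    · rw [min_eq_right (by linarith : r ≤ 2 * d), min_eq_right (by linarith : r ≤ d),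
        max_eq_left h0, abs_of_nonpos (by linarith), max_eq_left (by linarith)]
      simp
    · rcases le_total r d with h1 | h1
      · rw [min_eq_right (by linarith : r ≤ 2 * d), min_eq_right h1, max_eq_right h0,
          abs_of_nonpos (by linarith), max_eq_right (by linarith)]
        linarith
      · rw [min_eq_left h1, abs_of_nonneg (by linarith), max_eq_right hd.le]
        rcases le_total r (2 * d) with h2 | h2
        · rw [min_eq_right h2, max_eq_right h0, max_eq_right (by linarith)]
          linarith
        · rw [min_eq_left h2, max_eq_right (by linarith), max_eq_left (by linarith)]
          linarith

/-- The first layers add up to at most a trapezoid. -/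
lemma sum_layer_le_trapezoid (hδ : 0 < δ) (h : u + 2 ^ (M + 1) * δ ≤ p) (a : ZMod p)
    [NeZero p] (m : ℕ) (hm : m ≤ M) :
    2 ^ (M - m) * δ * ∑ l ∈ range (m + 1), layer p M δ u l a ≤
      max 0 (min (2 ^ (M - m) * δ : ℝ)
        (min ((a.val : ℝ) - u) (u + 2 ^ (M + 1) * δ - a.val))) := by
  have hlayer : ∀ l, (2 ^ (M - l) * δ : ℝ) * layer p M δ u l a ≤
      2⁻¹ * (max 0 (2 ^ (M - l) * δ - |((a.val : ℝ) - u) - 2 ^ (M - l) * δ|) +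
        max 0 (2 ^ (M - l) * δ - |(u + 2 ^ (M + 1) * δ - a.val) - (2 ^ (M - l) * δ : ℝ)|)) := by
    intro l
    have hw := two_mul_layer_width_le (M := M) (l := l) (δ := δ)
    have b1 := bump_le (w := 2 ^ (M - l) * δ) (c := u + 2 ^ (M - l) * δ) (by omega) (by omega) a
    have b2 := bump_le (w := 2 ^ (M - l) * δ)
      (c := u + 2 ^ (M + 1) * δ - 2 ^ (M - l) * δ) (by omega) (by omega) a
    rw [Nat.cast_sub (by omega)] at b2
    push_cast at b1 b2
    have e1 : |(a.val : ℝ) - (u + 2 ^ (M - l) * δ)| = |((a.val : ℝ) - u) - 2 ^ (M - l) * δ| := by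
      congr 1; ring
    have e2 : |(a.val : ℝ) - (u + 2 ^ (M + 1) * δ - 2 ^ (M - l) * δ)|
        = |(u + 2 ^ (M + 1) * δ - a.val) - (2 ^ (M - l) * δ : ℝ)| := by
      rw [abs_sub_comm]; congr 1; ring
    rw [e1] at b1
    rw [e2] at b2
    unfold layer
    linarith
  have hδ' : (0 : ℝ) < δ := by exact_mod_cast hδ
  induction m with
  | zero =>
    rw [zero_add, Finset.sum_range_one]
    refine (hlayer 0).trans ?_
    simp only [Nat.sub_zero]
    set d : ℝ := 2 ^ M * δ with hd
    have hd0 : 0 < d := by positivity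
    have : (2 : ℝ) ^ (M + 1) * δ = 2 * d := by rw [hd, pow_succ]; ring
    rw [this]
    set s : ℝ := (a.val : ℝ) - u
    have hr : (u : ℝ) + 2 * d - a.val = 2 * d - s := by simp only [s]; ring
    rw [hr]
    rcases le_total s d with h1 | h1
    · rw [abs_of_nonpos (by linarith), abs_of_nonneg (by linarith),
        min_eq_left (by linarith : s ≤ 2 * d - s), min_eq_right h1]
      have : d - (2 * d - s - d) = s := by ring
      rw [this]
      have : d - -(s - d) = s := by ring
      rw [this]
      linarith
    · rw [abs_of_nonneg (by linarith), abs_of_nonpos (by linarith),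
        min_eq_right (by linarith : 2 * d - s ≤ s), min_eq_right (by linarith)]
      have : d - (s - d) = 2 * d - s := by ring
      rw [this]
      have : d - -(2 * d - s - d) = 2 * d - s := by ring
      rw [this]
      linarith
  | succ m ih =>
    have ih := ih (by omega)
    have hl := hlayer (m + 1)
    rw [Finset.sum_range_succ, mul_add]
    have hw : M - m = (M - (m + 1)) + 1 := by omega
    rw [hw] at ih
    have h2 : (2 : ℝ) ^ (M - (m + 1) + 1) * δ = 2 * (2 ^ (M - (m + 1)) * δ) := by
      rw [pow_succ]; ring
    rw [h2] at ih
    have hbig : 4 * (2 ^ (M - (m + 1)) * δ) ≤ (2 : ℝ) ^ (M + 1) * δ := by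
      have h3 : (2 : ℝ) ^ (M + 1) = 2 ^ (M - (m + 1)) * 2 ^ (m + 2) := by
        rw [← pow_add]; congr 1; omega
      have h4 : (4 : ℝ) ≤ 2 ^ (m + 2) := by
        rw [pow_add]
        have : (1 : ℝ) ≤ 2 ^ m := one_le_pow₀ (by norm_num)
        linarith
      have h5 : (0 : ℝ) < 2 ^ (M - (m + 1)) := by positivity
      rw [h3]
      have : (0 : ℝ) ≤ 2 ^ (M - (m + 1)) * δ := by positivity
      nlinarith
    have htr := trapezoid_refine (d := 2 ^ (M - (m + 1)) * δ) (s := (a.val : ℝ) - u)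
      (r := u + 2 ^ (M + 1) * δ - a.val) (by positivity) (by linarith)
    linarith

/-- The layers add up to a function below the indicator function of the interval. -/
lemma sum_layer_le [NeZero p] (h : u + 2 ^ (M + 1) * δ ≤ p) (a : ZMod p) :
    ∑ l ∈ range (M + 1), layer p M δ u l a ≤
      if u < a.val ∧ a.val < u + 2 ^ (M + 1) * δ then 1 else 0 := by
  rcases Nat.eq_zero_or_pos δ with rfl | hδ
  · rw [Finset.sum_eq_zero fun l _ => by simp [layer, bump]]
    split_ifs <;> norm_num
  have := sum_layer_le_trapezoid hδ h a M le_rfl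
  rw [Nat.sub_self, pow_zero, one_mul] at this
  have hδ' : (0 : ℝ) < δ := by exact_mod_cast hδ
  split_ifs with hc
  · have h1 : max 0 (min (δ : ℝ) (min ((a.val : ℝ) - u) (u + 2 ^ (M + 1) * δ - a.val))) ≤ δ :=
      max_le hδ'.le (min_le_left _ _)
    have h2 := this.trans h1
    nlinarith
  · have h1 : max 0 (min (δ : ℝ) (min ((a.val : ℝ) - u) (u + 2 ^ (M + 1) * δ - a.val))) = 0 := by
      refine max_eq_left ((min_le_right _ _).trans ?_)
      by_cases h3 : u < a.val
      · refine (min_le_right _ _).trans ?_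
        have h4 : u + 2 ^ (M + 1) * δ ≤ a.val := by
          by_contra h5
          exact hc ⟨h3, by omega⟩
        have : ((u + 2 ^ (M + 1) * δ : ℕ) : ℝ) ≤ a.val := by exact_mod_cast h4
        push_cast at this
        linarith
      · refine (min_le_left _ _).trans ?_
        have : (a.val : ℝ) ≤ u := by exact_mod_cast not_lt.mp h3
        linarith
    rw [h1] at this
    nlinarith

lemma layerMean_nonneg : 0 ≤ layerMean p M δ l := by unfold layerMean; positivity

lemma layerMean_le (h : 2 ^ (M + 1) * δ ≤ p) (hl : l ≤ M) :
    layerMean p M δ l ≤ 2⁻¹ ^ (l + 1) := by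
  unfold layerMean
  rcases Nat.eq_zero_or_pos p with rfl | hp
  · simp
  rw [div_le_iff₀ (by exact_mod_cast hp)]
  have h' : ((2 ^ (M + 1) * δ : ℕ) : ℝ) ≤ p := by exact_mod_cast h
  have h3 : (2 : ℝ) ^ (M + 1) = 2 ^ (M - l) * 2 ^ (l + 1) := by
    rw [← pow_add]; congr 1; omega
  push_cast at h' ⊢
  rw [h3] at h'
  calc (2 : ℝ) ^ (M - l) * δ = 2⁻¹ ^ (l + 1) * (2 ^ (M - l) * 2 ^ (l + 1) * δ) := by
        rw [inv_pow]; field_simp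
    _ ≤ _ := by gcongr

lemma sum_layerMean : ∑ l ∈ range (M + 1), layerMean p M δ l = (2 ^ (M + 1) - 1) * δ / p := by
  have h : ∑ l ∈ range (M + 1), (2 : ℝ) ^ (M - l) = 2 ^ (M + 1) - 1 := by
    have := Finset.sum_range_reflect (fun i => (2 : ℝ) ^ i) (M + 1)
    simp only [Nat.add_sub_cancel] at this
    rw [this, geom_sum_eq (by norm_num)]
    norm_num
  unfold layerMean
  rw [← Finset.sum_div, ← h, Finset.sum_mul]
  push_cast
  rfl

end Levels

/-! ### Expanding products of sums of layers -/

/-- Only few tuples have a small sum. -/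
lemma card_sum_le (r M R : ℕ) :
    (#{f : Fin r → Fin (M + 1) | ∑ s, (f s : ℕ) ≤ R} : ℝ) ≤ 2 ^ (R + r) := by
  calc (#{f : Fin r → Fin (M + 1) | ∑ s, (f s : ℕ) ≤ R} : ℝ)
      = ∑ f : Fin r → Fin (M + 1), if ∑ s, (f s : ℕ) ≤ R then (1 : ℝ) else 0 := by
        rw [Finset.card_filter]; push_cast; rfl
    _ ≤ ∑ f : Fin r → Fin (M + 1), 2 ^ R * ∏ s, (2⁻¹ : ℝ) ^ (f s : ℕ) := by
        refine Finset.sum_le_sum fun f _ => ?_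
        split_ifs with h
        · rw [Finset.prod_pow_eq_pow_sum, inv_pow, ← div_eq_mul_inv, le_div_iff₀ (by positivity),
            one_mul]
          exact pow_le_pow_right₀ (by norm_num) h
        · positivity
    _ = 2 ^ R * (∑ l : Fin (M + 1), (2⁻¹ : ℝ) ^ (l : ℕ)) ^ r := by
        rw [← Finset.mul_sum, ← Fintype.piFinset_univ,
          ← Finset.prod_univ_sum (fun _ => univ) (fun (_ : Fin r) (l : Fin (M + 1)) =>
            (2⁻¹ : ℝ) ^ (l : ℕ))]
        simp
    _ ≤ 2 ^ R * 2 ^ r := by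
        have h : ∑ l : Fin (M + 1), (2⁻¹ : ℝ) ^ (l : ℕ) ≤ 2 := by
          rw [Fin.sum_univ_eq_sum_range (fun l => (2⁻¹ : ℝ) ^ l), geom_sum_eq (by norm_num)]
          have : (0 : ℝ) < 2⁻¹ ^ (M + 1) := by positivity
          rw [div_le_iff_of_neg (by norm_num)]
          linarith
        gcongr
    _ = 2 ^ (R + r) := by rw [pow_add]

/-- Tuples with a large sum contribute little to the power of a sum of geometrically decreasing
terms. -/
lemma pow_sum_sub_le {M : ℕ} {m : ℕ → ℝ} (h0 : ∀ l, 0 ≤ m l)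
    (hm : ∀ l ≤ M, m l ≤ 2⁻¹ ^ (l + 1)) (r R : ℕ) :
    (∑ l ∈ range (M + 1), m l) ^ r - (2 / 3) ^ R * 2 ^ r ≤
      ∑ f : Fin r → Fin (M + 1) with ∑ s, (f s : ℕ) ≤ R, ∏ s, m (f s) := by
  have hexp : (∑ l ∈ range (M + 1), m l) ^ r = ∑ f : Fin r → Fin (M + 1), ∏ s, m (f s) := by
    rw [← Fintype.piFinset_univ, ← Finset.prod_univ_sum (fun _ => univ)
      (fun (_ : Fin r) (l : Fin (M + 1)) => m l), Finset.prod_const, Finset.card_univ,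
      Fintype.card_fin, Fin.sum_univ_eq_sum_range m]
  rw [hexp, ← Finset.sum_filter_add_sum_filter_not univ
    (fun f : Fin r → Fin (M + 1) => ∑ s, (f s : ℕ) ≤ R)]
  suffices h : ∑ f : Fin r → Fin (M + 1) with ¬ ∑ s, (f s : ℕ) ≤ R, ∏ s, m (f s)
      ≤ (2 / 3) ^ R * 2 ^ r by linarith
  calc _ ≤ ∑ f : Fin r → Fin (M + 1) with ¬ ∑ s, (f s : ℕ) ≤ R,
        (2 / 3) ^ R * ∏ s, ((3 / 2) ^ (f s : ℕ) * (2⁻¹ : ℝ) ^ ((f s : ℕ) + 1)) := by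
        refine Finset.sum_le_sum fun f hf => ?_
        have hf' : R ≤ ∑ s, (f s : ℕ) := by
          have := (Finset.mem_filter.mp hf).2
          omega
        rw [Finset.prod_mul_distrib, Finset.prod_pow_eq_pow_sum, ← mul_assoc]
        -- an exponential weight, with which the geometric series still converges
        have h1 : (1 : ℝ) ≤ (2 / 3) ^ R * (3 / 2) ^ ∑ s, (f s : ℕ) := by
          calc (1 : ℝ) = (2 / 3) ^ R * (3 / 2) ^ R := by rw [← mul_pow]; norm_num
            _ ≤ _ := by gcongr; norm_num
        have h2 : ∏ s, m (f s) ≤ ∏ s, (2⁻¹ : ℝ) ^ ((f s : ℕ) + 1) :=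
          Finset.prod_le_prod (fun s _ => h0 _) fun s _ => hm _ (by have := (f s).2; omega)
        have h3 : (0 : ℝ) ≤ ∏ s, (2⁻¹ : ℝ) ^ ((f s : ℕ) + 1) := by positivity
        nlinarith
    _ ≤ ∑ f : Fin r → Fin (M + 1),
        (2 / 3) ^ R * ∏ s, ((3 / 2) ^ (f s : ℕ) * (2⁻¹ : ℝ) ^ ((f s : ℕ) + 1)) :=
        Finset.sum_le_sum_of_subset_of_nonneg (Finset.filter_subset _ _)
          fun f _ _ => by positivity
    _ = (2 / 3) ^ R * (∑ l : Fin (M + 1), (3 / 2) ^ (l : ℕ) * (2⁻¹ : ℝ) ^ ((l : ℕ) + 1)) ^ r := by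
        rw [← Finset.mul_sum, ← Fintype.piFinset_univ,
          ← Finset.prod_univ_sum (fun _ => univ) (fun (_ : Fin r) (l : Fin (M + 1)) =>
            (3 / 2) ^ (l : ℕ) * (2⁻¹ : ℝ) ^ ((l : ℕ) + 1))]
        simp
    _ ≤ (2 / 3) ^ R * 2 ^ r := by
        have h : ∑ l : Fin (M + 1), (3 / 2) ^ (l : ℕ) * (2⁻¹ : ℝ) ^ ((l : ℕ) + 1) ≤ 2 := by
          rw [Fin.sum_univ_eq_sum_range (fun l => (3 / 2) ^ l * (2⁻¹ : ℝ) ^ (l + 1))]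
          have : ∀ l : ℕ, (3 / 2) ^ l * (2⁻¹ : ℝ) ^ (l + 1) = 2⁻¹ * (3 / 4) ^ l := by
            intro l
            rw [pow_succ, ← mul_assoc, ← mul_pow, mul_comm]
            norm_num
          simp_rw [this]
          rw [← Finset.mul_sum, geom_sum_eq (by norm_num)]
          have : (0 : ℝ) < (3 / 4) ^ (M + 1) := by positivity
          rw [← mul_div_assoc, div_le_iff_of_neg (by norm_num)]
          linarith
        gcongr

end Secretary

/-! ### The relative order of a few items -/

namespace Secretary

open Finset

/-- The mean of the sum of all layers, for the largest admissible interval of length at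
most `len`. -/
noncomputable def intervalMean (p M len : ℕ) : ℝ :=
  (2 ^ (M + 1) - 1) * ((len / 2 ^ (M + 1) : ℕ) : ℝ) / p

lemma intervalMean_nonneg (p M len : ℕ) : 0 ≤ intervalMean p M len := by
  unfold intervalMean
  have : (1 : ℝ) ≤ 2 ^ (M + 1) := one_le_pow₀ (by norm_num)
  have : (0 : ℝ) ≤ 2 ^ (M + 1) - 1 := by linarith
  positivity

lemma sum_layerMean_eq (p M len : ℕ) :
    ∑ l ∈ range (M + 1), layerMean p M (len / 2 ^ (M + 1)) l = intervalMean p M len :=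
  sum_layerMean

/-- Lower bound for the number of pairs `(z, y)` for which the shifts of `u` by the first `r` of
the numbers `y * V i z` are larger than `u` and the shift by the last one is smaller than `c`. The
indicator functions are replaced by sums of `M + 1` layers; in the expansion of the first `r`
factors the terms with layer indices of sum at most `R` are kept. -/
theorem le_sum_indicator_shift {p : ℕ} [NeZero p] {r : ℕ} (V : Fin (r + 1) → ZMod p → ZMod p)
    (B : ℕ) (hV : ∀ c : Fin (r + 1) → ZMod p, c ≠ 0 → #{z | ∑ i, c i * V i z = 0} ≤ B)
    (M R : ℕ) {u c : ℕ} (hu : u < p) (hc : c ≤ p) :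
    (p : ℝ) ^ 2 * (intervalMean p M c *
        (intervalMean p M (p - u) ^ r - (2 / 3) ^ R * 2 ^ r)) - p * B * ((M + 1) * 2 ^ (R + r)) ≤
      ∑ z : ZMod p, ∑ y : ZMod p, if (∀ s : Fin r, u < ((u : ZMod p) + y * V s.castSucc z).val) ∧
        ((u : ZMod p) + y * V (Fin.last r) z).val < c then (1 : ℝ) else 0 := by
  classical
  set δ := (p - u) / 2 ^ (M + 1) with hδ
  set δ' := c / 2 ^ (M + 1) with hδ'
  have hδu : u + 2 ^ (M + 1) * δ ≤ p := by
    have : 2 ^ (M + 1) * δ ≤ p - u := Nat.mul_div_le (p - u) (2 ^ (M + 1))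
    omega
  have hδc : 0 + 2 ^ (M + 1) * δ' ≤ p := by
    have : 2 ^ (M + 1) * δ' ≤ c := Nat.mul_div_le c (2 ^ (M + 1))
    omega
  set θ : ZMod p → ℝ := fun a => ∑ l ∈ range (M + 1), layer p M δ' 0 l a with hθ
  have hθ0 : ∀ a, 0 ≤ θ a := fun a => Finset.sum_nonneg fun l _ => layer_nonneg a
  have hθF : HasFourier θ (intervalMean p M c) (M + 1) := by
    have := HasFourier.sum (range (M + 1)) (f := fun l => layer p M δ' 0 l)
      fun l _ => hasFourier_layer hδc
    rw [sum_layerMean_eq] at this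
    simpa using this
  set T : Finset (Fin r → Fin (M + 1)) := {f | ∑ s, (f s : ℕ) ≤ R} with hT
  have hpoint : ∀ z y, ∑ f ∈ T, (∏ s, layer p M δ u (f s) (u + y * V s.castSucc z)) *
      θ (u + y * V (Fin.last r) z) ≤
      if (∀ s : Fin r, u < ((u : ZMod p) + y * V s.castSucc z).val) ∧
        ((u : ZMod p) + y * V (Fin.last r) z).val < c then (1 : ℝ) else 0 := by
    intro z y
    have h1 : ∑ f ∈ T, ∏ s, layer p M δ u (f s) (u + y * V s.castSucc z) ≤
        ∏ s : Fin r, ∑ l ∈ range (M + 1), layer p M δ u l (u + y * V s.castSucc z) := by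
      calc _ ≤ ∑ f : Fin r → Fin (M + 1), ∏ s, layer p M δ u (f s) (u + y * V s.castSucc z) :=
            Finset.sum_le_sum_of_subset_of_nonneg (Finset.subset_univ _)
              fun f _ _ => Finset.prod_nonneg fun s _ => layer_nonneg _
        _ = _ := by
            rw [← Fintype.piFinset_univ, ← Finset.prod_univ_sum (fun _ => univ)
              (fun (s : Fin r) (l : Fin (M + 1)) => layer p M δ u l (u + y * V s.castSucc z))]
            refine Finset.prod_congr rfl fun s _ => ?_
            rw [Fin.sum_univ_eq_sum_range (fun l => layer p M δ u l (u + y * V s.castSucc z))]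
    have h2 : ∏ s : Fin r, ∑ l ∈ range (M + 1), layer p M δ u l (u + y * V s.castSucc z) ≤
        ∏ s : Fin r, if u < ((u : ZMod p) + y * V s.castSucc z).val then (1 : ℝ) else 0 := by
      refine Finset.prod_le_prod
        (fun s _ => Finset.sum_nonneg fun l _ => layer_nonneg _) fun s _ => ?_
      refine (sum_layer_le hδu _).trans ?_
      split_ifs with ha hb hb
      · exact le_rfl
      · exact absurd ha.1 hb
      · exact zero_le_one
      · exact le_rfl
    have h3 : θ (u + y * V (Fin.last r) z) ≤
        if ((u : ZMod p) + y * V (Fin.last r) z).val < c then (1 : ℝ) else 0 := by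
      refine (sum_layer_le hδc _).trans ?_
      split_ifs with ha hb hb
      · exact le_rfl
      · refine absurd (lt_of_lt_of_le ha.2 ?_) hb
        have : 2 ^ (M + 1) * δ' ≤ c := Nat.mul_div_le c (2 ^ (M + 1))
        omega
      · exact zero_le_one
      · exact le_rfl
    rw [← Finset.sum_mul]
    refine (mul_le_mul (h1.trans h2) h3 (hθ0 _) (Finset.prod_nonneg fun s _ => by
      split_ifs <;> norm_num)).trans ?_
    rw [Finset.prod_ite_zero]
    simp only [Finset.mem_univ, true_implies, Finset.prod_const_one]
    split_ifs <;> simp_all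
  have hfool : ∀ f : Fin r → Fin (M + 1),
      (p : ℝ) ^ 2 * ((∏ s, layerMean p M δ (f s)) * intervalMean p M c) - p * B * (M + 1) ≤
      ∑ z, ∑ y, (∏ s, layer p M δ u (f s) (u + y * V s.castSucc z)) *
        θ (u + y * V (Fin.last r) z) := by
    intro f
    have := abs_sum_prod_sub_le (ι := Fin (r + 1))
      (f := Fin.snoc (α := fun _ => ZMod p → ℝ)
        (fun s a => layer p M δ u (f s) (u + a)) (fun a => θ (u + a)))
      (μ := Fin.snoc (α := fun _ => ℝ) (fun s => layerMean p M δ (f s)) (intervalMean p M c))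
      (A := Fin.snoc (α := fun _ => ℝ) (fun s => 1) (M + 1)) (fun i => by
        refine Fin.lastCases ?_ (fun s => ?_) i
        · simpa using hθF.translate (u : ZMod p)
        · simpa using (hasFourier_layer hδu).translate (u : ZMod p)) V B hV
    simp only [Fin.prod_univ_castSucc, Fin.snoc_castSucc, Fin.snoc_last, Finset.prod_const_one,
      one_mul] at this
    have := (abs_le.mp this).1
    linarith
  calc _ ≤ ∑ f ∈ T, ((p : ℝ) ^ 2 * ((∏ s, layerMean p M δ (f s)) * intervalMean p M c)
        - p * B * (M + 1)) := by
        rw [Finset.sum_sub_distrib, ← Finset.mul_sum, ← Finset.sum_mul, Finset.sum_const,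
          nsmul_eq_mul]
        have h1 := pow_sum_sub_le (M := M) (m := layerMean p M δ) (fun l => layerMean_nonneg)
          (fun l hl => layerMean_le (by omega) hl) r R
        rw [sum_layerMean_eq] at h1
        have h2 := card_sum_le r M R
        have h3 := intervalMean_nonneg p M c
        have h4 : (#T : ℝ) * (p * B * (M + 1)) ≤ 2 ^ (R + r) * (p * B * (M + 1)) := by gcongr
        have h5 := mul_le_mul_of_nonneg_right h1 h3
        have h6 := mul_le_mul_of_nonneg_left h5 (sq_nonneg (p : ℝ))
        linarith
    _ ≤ ∑ f ∈ T, ∑ z, ∑ y, (∏ s, layer p M δ u (f s) (u + y * V s.castSucc z)) *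
        θ (u + y * V (Fin.last r) z) := Finset.sum_le_sum fun f _ => hfool f
    _ = ∑ z, ∑ y, ∑ f ∈ T, (∏ s, layer p M δ u (f s) (u + y * V s.castSucc z)) *
        θ (u + y * V (Fin.last r) z) := by
        rw [Finset.sum_comm]
        exact Finset.sum_congr rfl fun z _ => Finset.sum_comm
    _ ≤ _ := Finset.sum_le_sum fun z _ => Finset.sum_le_sum fun y _ => hpoint z y

/-- A nontrivial linear combination of differences of powers is a nonzero polynomial of small
degree. -/
lemma card_zeros_le {p q : ℕ} [Fact p.Prime] {ι : Type*} [Fintype ι] {e : ι → ℕ} {e₀ : ℕ}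
    (he : Function.Injective e) (he₀ : ∀ i, e i ≠ e₀) (hq : ∀ i, e i < q) (hq₀ : e₀ < q)
    (c : ι → ZMod p) (hc : c ≠ 0) :
    #{z : ZMod p | ∑ i, c i * (z ^ e i - z ^ e₀) = 0} ≤ q := by
  classical
  obtain ⟨i, hi⟩ := Function.ne_iff.mp hc
  set P : Polynomial (ZMod p) :=
    ∑ i, Polynomial.C (c i) * (Polynomial.X ^ e i - Polynomial.X ^ e₀) with hP
  have hcoeff : P.coeff (e i) = c i := by
    rw [hP, Polynomial.finsetSum_coeff, Finset.sum_eq_single i]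
    · rw [Polynomial.coeff_C_mul, Polynomial.coeff_sub, Polynomial.coeff_X_pow,
        Polynomial.coeff_X_pow, if_pos rfl, if_neg (he₀ i)]
      simp
    · intro j _ hj
      rw [Polynomial.coeff_C_mul, Polynomial.coeff_sub, Polynomial.coeff_X_pow,
        Polynomial.coeff_X_pow, if_neg (fun h => hj (he h.symm)), if_neg (he₀ i)]
      simp
    · simp
  have hP0 : P ≠ 0 := by
    intro h
    rw [h, Polynomial.coeff_zero] at hcoeff
    exact hi hcoeff.symm
  have hdeg : P.natDegree ≤ q := by
    refine Polynomial.natDegree_sum_le_of_forall_le _ _ fun j _ => ?_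
    refine (Polynomial.natDegree_C_mul_le _ _).trans ?_
    refine (Polynomial.natDegree_sub_le _ _).trans ?_
    rw [Polynomial.natDegree_X_pow, Polynomial.natDegree_X_pow]
    exact max_le (hq j).le hq₀.le
  calc _ ≤ #P.roots.toFinset := by
        refine Finset.card_le_card fun z hz => ?_
        rw [Multiset.mem_toFinset, Polynomial.mem_roots hP0, Polynomial.IsRoot.def, hP,
          Polynomial.eval_finsetSum]
        simpa using hz
    _ ≤ P.roots.card := Multiset.toFinset_card_le _
    _ ≤ q := (Polynomial.card_roots' P).trans hdeg

/-- The position of a bucket `j`: the buckets are mapped to `ZMod p` by `j ↦ y * z ^ j + w`. -/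
def slot {p : ℕ} (z y w : ZMod p) (j : ℕ) : ℕ := (y * z ^ j + w).val

lemma sum_zmod_val {p : ℕ} [NeZero p] (F : ℕ → ℝ) :
    ∑ a : ZMod p, F a.val = ∑ a ∈ range p, F a := by
  refine Finset.sum_bij (fun a _ => a.val) (fun a _ => by simpa using ZMod.val_lt a)
    (fun a _ b _ h => ZMod.val_injective p h) (fun b hb => ?_) (fun _ _ => rfl)
  exact ⟨(b : ZMod p), Finset.mem_univ _, ZMod.val_cast_of_lt (by simpa using hb)⟩

/-- With `e 0, e 1, …` the buckets of the items in order of decreasing value, `Caught c₁ c₂ e r`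
says that the best item comes at `c₂` or later and before the next `r` items, and that the
following item comes before `c₁`. -/
def Caught {p : ℕ} (c₁ c₂ : ℕ) (e : ℕ → ℕ) (z y w : ZMod p) (r : ℕ) : Prop :=
  c₂ ≤ slot z y w (e 0) ∧ (∀ s < r, slot z y w (e 0) < slot z y w (e (s + 1))) ∧
    slot z y w (e (r + 1)) < c₁

open Classical in
/-- Lower bound for the number of `z, y, w` with `Caught`, if the best `r + 2` items have distinct
buckets. The sum is over the slot `u` of the best item, which replaces the variable `w`. -/
theorem le_sum_caught {p q : ℕ} [Fact p.Prime] {e : ℕ → ℕ} {r : ℕ}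
    (he : Set.InjOn e (Set.Iic (r + 1))) (hq : ∀ i, e i < q) (M R : ℕ) {c₁ : ℕ} (c₂ : ℕ)
    (hc₁ : c₁ ≤ p) :
    ∑ u ∈ Ico c₂ p, ((p : ℝ) ^ 2 * (intervalMean p M c₁ *
        (intervalMean p M (p - u) ^ r - (2 / 3) ^ R * 2 ^ r)) - p * q * ((M + 1) * 2 ^ (R + r))) ≤
      ∑ z : ZMod p, ∑ y : ZMod p, ∑ w : ZMod p,
        if Caught c₁ c₂ e z y w r then (1 : ℝ) else 0 := by
  set V : Fin (r + 1) → ZMod p → ZMod p := fun i z => z ^ e (i + 1) - z ^ e 0 with hVdef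
  have hV : ∀ c : Fin (r + 1) → ZMod p, c ≠ 0 → #{z | ∑ i, c i * V i z = 0} ≤ q := by
    refine card_zeros_le (e := fun i : Fin (r + 1) => e (i + 1)) ?_ ?_ (fun i => hq _) (hq 0)
    · intro i j hij
      have := he (by simp [Set.mem_Iic]; omega) (by simp [Set.mem_Iic]; omega) hij
      exact Fin.ext (by omega)
    · intro i hi
      have := he (by simp [Set.mem_Iic]; omega) (by simp [Set.mem_Iic]) hi
      omega
  have hshift : ∀ z y, ∑ w : ZMod p, (if Caught c₁ c₂ e z y w r then (1 : ℝ) else 0) =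
      ∑ u ∈ Ico c₂ p, if (∀ s : Fin r, u < ((u : ZMod p) + y * V s.castSucc z).val) ∧
        ((u : ZMod p) + y * V (Fin.last r) z).val < c₁ then (1 : ℝ) else 0 := by
    intro z y
    set F : ℕ → ℝ := fun u => if c₂ ≤ u then
      (if (∀ s : Fin r, u < ((u : ZMod p) + y * V s.castSucc z).val) ∧
        ((u : ZMod p) + y * V (Fin.last r) z).val < c₁ then (1 : ℝ) else 0) else 0 with hF
    have h1 : ∀ w : ZMod p, (if Caught c₁ c₂ e z y w r then (1 : ℝ) else 0) =
        F (Equiv.addLeft (y * z ^ e 0) w).val := by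
      intro w
      have h2 : ∀ j, (((y * z ^ e 0 + w).val : ℕ) : ZMod p) + y * (z ^ j - z ^ e 0)
          = y * z ^ j + w := by
        intro j
        rw [ZMod.natCast_zmod_val]
        ring
      simp only [hF, Equiv.coe_addLeft, hVdef, h2, Fin.val_castSucc, Fin.val_last]
      rw [← ite_and]
      refine if_congr ?_ rfl rfl
      unfold Caught slot
      refine and_congr_right fun _ => and_congr_left fun _ => ?_
      exact ⟨fun h s => h s s.2, fun h s hs => h ⟨s, hs⟩⟩
    simp_rw [h1]
    rw [Equiv.sum_comp (Equiv.addLeft (y * z ^ e 0)) (fun a : ZMod p => F a.val),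
      sum_zmod_val F, hF, ← Finset.sum_filter]
    refine Finset.sum_congr ?_ fun _ _ => rfl
    ext u
    simp only [Finset.mem_filter, Finset.mem_range, Finset.mem_Ico]
    tauto
  simp_rw [hshift]
  calc _ ≤ ∑ u ∈ Ico c₂ p, ∑ z : ZMod p, ∑ y : ZMod p,
        if (∀ s : Fin r, u < ((u : ZMod p) + y * V s.castSucc z).val) ∧
        ((u : ZMod p) + y * V (Fin.last r) z).val < c₁ then (1 : ℝ) else 0 :=
        Finset.sum_le_sum fun u hu =>
          le_sum_indicator_shift V q hV M R (Finset.mem_Ico.mp hu).2 hc₁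
    _ = _ := by
        rw [Finset.sum_comm]
        exact Finset.sum_congr rfl fun z _ => Finset.sum_comm

end Secretary

/-! ### Hashing the items -/

namespace Secretary

open Finset

/-- The bucket of item `i`: the polynomial over `ZMod q` whose coefficients are the base `q` digits
of `i`, evaluated at `x`. -/
def itemHash {q : ℕ} (x : ZMod q) (i : ℕ) : ℕ := (Nat.ofDigits x (Nat.digits q i)).val

lemma ofDigits_digits_rec {q : ℕ} (hq : 2 ≤ q) {R : Type*} [CommSemiring R] (x : R) (i : ℕ) :
    Nat.ofDigits x (Nat.digits q i) =
      ((i % q : ℕ) : R) + x * Nat.ofDigits x (Nat.digits q (i / q)) := by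
  rcases Nat.eq_zero_or_pos i with rfl | hi
  · simp [Nat.ofDigits]
  · rw [Nat.digits_def' (by omega) hi]
    rfl

lemma natDegree_ofDigits_le {q : ℕ} [Fact q.Prime] (N : ℕ) {i : ℕ} (hi : i < 2 ^ N) :
    (Nat.ofDigits (Polynomial.X : Polynomial (ZMod q)) (Nat.digits q i)).natDegree ≤ N := by
  have hq := (Fact.out : q.Prime).two_le
  induction N generalizing i with
  | zero =>
    obtain rfl : i = 0 := by simpa using hi
    simp [Nat.ofDigits]
  | succ N ih =>
    rw [ofDigits_digits_rec hq]
    have h1 : i / q < 2 ^ N := by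
      calc i / q ≤ i / 2 := Nat.div_le_div_left hq (by norm_num)
        _ < 2 ^ N := by rw [pow_succ] at hi; omega
    refine (Polynomial.natDegree_add_le _ _).trans (max_le ?_ ?_)
    · rw [Polynomial.natDegree_natCast]; omega
    · refine (Polynomial.natDegree_mul_le).trans ?_
      rw [Polynomial.natDegree_X]
      have := ih h1
      omega

/-- The polynomial determines the item. The number `N` only serves for the induction. -/
lemma ofDigits_digits_injective {q : ℕ} [Fact q.Prime] (N : ℕ) : ∀ i j : ℕ, i + j ≤ N →
    Nat.ofDigits (Polynomial.X : Polynomial (ZMod q)) (Nat.digits q i) =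
      Nat.ofDigits (Polynomial.X : Polynomial (ZMod q)) (Nat.digits q j) → i = j := by
  have hq := (Fact.out : q.Prime).two_le
  induction N with
  | zero => intro i j h _; omega
  | succ N ih =>
    intro i j hij h
    rw [ofDigits_digits_rec hq, ofDigits_digits_rec hq _ j] at h
    have h0 := congrArg (fun P => Polynomial.coeff P 0) h
    simp only [Polynomial.coeff_add, Polynomial.mul_coeff_zero, Polynomial.coeff_X_zero, zero_mul,
      add_zero, Polynomial.coeff_natCast_ite, if_true] at h0
    rw [ZMod.natCast_eq_natCast_iff', Nat.mod_mod, Nat.mod_mod] at h0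
    rw [h0, add_right_inj] at h
    have h1 := mul_left_cancel₀ Polynomial.X_ne_zero h
    have h2 : i / q = j / q := by
      by_cases h00 : i + j = 0
      · obtain ⟨rfl, rfl⟩ : i = 0 ∧ j = 0 := by omega
        rfl
      · refine ih _ _ ?_ h1
        have a1 : i / q ≤ i / 2 := Nat.div_le_div_left hq (by norm_num)
        have a2 : j / q ≤ j / 2 := Nat.div_le_div_left hq (by norm_num)
        omega
    rw [← Nat.div_add_mod i q, ← Nat.div_add_mod j q, h0, h2]

/-- Two items collide for few `x`: the difference of their polynomials has few roots. -/
lemma card_itemHash_eq_le {q : ℕ} [Fact q.Prime] {N i j : ℕ} (hi : i < 2 ^ N) (hj : j < 2 ^ N)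
    (hij : i ≠ j) : #{x : ZMod q | itemHash x i = itemHash x j} ≤ N := by
  classical
  set P := Nat.ofDigits (Polynomial.X : Polynomial (ZMod q)) (Nat.digits q i) -
    Nat.ofDigits (Polynomial.X : Polynomial (ZMod q)) (Nat.digits q j) with hP
  have hP0 : P ≠ 0 := by
    intro h
    exact hij (ofDigits_digits_injective (i + j) i j le_rfl (sub_eq_zero.mp h))
  have hdeg : P.natDegree ≤ N := (Polynomial.natDegree_sub_le _ _).trans
    (max_le (natDegree_ofDigits_le N hi) (natDegree_ofDigits_le N hj))
  have heval : ∀ (x : ZMod q) (L : List ℕ), (Nat.ofDigits (Polynomial.X : Polynomial (ZMod q)) L).eval x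
      = Nat.ofDigits x L := by
    intro x L
    induction L with
    | nil => simp [Nat.ofDigits]
    | cons d L ih =>
      change Polynomial.eval x ((d : Polynomial (ZMod q)) + Polynomial.X * _) = (d : ZMod q) + x * _
      simp [ih]
  calc _ ≤ #P.roots.toFinset := by
        refine Finset.card_le_card fun x hx => ?_
        rw [Multiset.mem_toFinset, Polynomial.mem_roots hP0, Polynomial.IsRoot.def, hP,
          Polynomial.eval_sub, heval, heval, sub_eq_zero]
        exact ZMod.val_injective q (Finset.mem_filter.mp hx).2
    _ ≤ P.roots.card := Multiset.toFinset_card_le _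
    _ ≤ N := (Polynomial.card_roots' P).trans hdeg

lemma itemHash_lt {q : ℕ} [NeZero q] (x : ZMod q) (i : ℕ) : itemHash x i < q := ZMod.val_lt _

/-! ### The number of items in an initial segment of the slots -/

lemma sum_ite_val_lt {p : ℕ} [NeZero p] {c : ℕ} (hc : c ≤ p) :
    ∑ a : ZMod p, (if a.val < c then (1 : ℝ) else 0) = c := by
  rw [sum_zmod_val (fun a => if a < c then (1 : ℝ) else 0), ← Finset.sum_filter]
  have : (range p).filter (fun a => a < c) = range c := by
    ext a; simp only [Finset.mem_filter, Finset.mem_range]; omega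
  rw [this]
  simp

lemma sum_slot_lt {p : ℕ} [NeZero p] {c : ℕ} (hc : c ≤ p) (z y : ZMod p) (j : ℕ) :
    ∑ w : ZMod p, (if slot z y w j < c then (1 : ℝ) else 0) = c := by
  rw [← sum_ite_val_lt hc]
  exact Equiv.sum_comp (Equiv.addLeft (y * z ^ j))
    (fun a : ZMod p => if a.val < c then (1 : ℝ) else 0)

/-- The slots of two buckets are exactly independent, unless `z` is one of a few elements. -/
lemma sum_slot_lt_and_slot_lt {p : ℕ} [Fact p.Prime] {c : ℕ} (hc : c ≤ p) {z : ZMod p} {i j : ℕ}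
    (hij : z ^ i ≠ z ^ j) :
    ∑ y : ZMod p, ∑ w : ZMod p,
      (if slot z y w i < c then (1 : ℝ) else 0) * (if slot z y w j < c then (1 : ℝ) else 0)
        = (c : ℝ) ^ 2 := by
  set χ : ZMod p → ℝ := fun a => if a.val < c then (1 : ℝ) else 0 with hχ
  have hd : z ^ j - z ^ i ≠ 0 := sub_ne_zero.mpr (Ne.symm hij)
  have h1 : ∀ y, ∑ w : ZMod p, (if slot z y w i < c then (1 : ℝ) else 0) *
      (if slot z y w j < c then (1 : ℝ) else 0)
      = ∑ u : ZMod p, χ u * χ (u + y * (z ^ j - z ^ i)) := by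
    intro y
    rw [← Equiv.sum_comp (Equiv.addLeft (y * z ^ i))
      (fun u => χ u * χ (u + y * (z ^ j - z ^ i)))]
    refine Finset.sum_congr rfl fun w _ => ?_
    have : y * z ^ i + w + y * (z ^ j - z ^ i) = y * z ^ j + w := by ring
    simp only [Equiv.coe_addLeft, this, hχ, slot]
    rfl
  have h2 : ∀ u, ∑ y, χ (u + y * (z ^ j - z ^ i)) = c := by
    intro u
    rw [← sum_ite_val_lt hc]
    exact Equiv.sum_comp ((Equiv.mulRight₀ _ hd).trans (Equiv.addLeft u)) χ
  simp_rw [h1]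
  rw [Finset.sum_comm]
  simp_rw [← Finset.mul_sum, h2]
  rw [← Finset.sum_mul, sum_ite_val_lt hc]
  ring

/-- The number of items in the first `c` slots. -/
def load (n : ℕ) {p q : ℕ} (c : ℕ) (x : ZMod q) (z y w : ZMod p) : ℕ :=
  #{i : Fin n | slot z y w (itemHash x i) < c}

/-- The second moment of the number of items in the first `c` slots, around its mean. -/
theorem sum_load_sub_sq_le {n p q N : ℕ} [Fact p.Prime] [Fact q.Prime] (hn : n ≤ 2 ^ N) {c : ℕ}
    (hc : c ≤ p) :
    ∑ x : ZMod q, ∑ z : ZMod p, ∑ y : ZMod p, ∑ w : ZMod p,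
      ((load n c x z y w : ℝ) - n * c / p) ^ 2 ≤
      q * p ^ 3 * (n + n ^ 2 * (N / q + q / p)) := by
  have hp0 : (0 : ℝ) < p := by exact_mod_cast (Fact.out : p.Prime).pos
  have hq0 : (0 : ℝ) < q := by exact_mod_cast (Fact.out : q.Prime).pos
  have hcp : (c : ℝ) ≤ p := by exact_mod_cast hc
  set I : ℕ → ZMod q → ZMod p → ZMod p → ZMod p → ℝ := fun i x z y w =>
    if slot z y w (itemHash x i) < c then (1 : ℝ) else 0 with hI
  have hI0 : ∀ i x z y w, 0 ≤ I i x z y w := fun i x z y w => by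
    simp only [hI]; split_ifs <;> norm_num
  have hI1 : ∀ i x z y w, I i x z y w ≤ 1 := fun i x z y w => by
    simp only [hI]; split_ifs <;> norm_num
  have hload : ∀ x z y w, (load n c x z y w : ℝ) = ∑ i : Fin n, I i x z y w := by
    intro x z y w
    unfold load
    rw [Finset.card_filter]
    push_cast
    rfl
  -- the mean
  have hmean : ∑ x : ZMod q, ∑ z : ZMod p, ∑ y : ZMod p, ∑ w : ZMod p,
      (load n c x z y w : ℝ) = q * p ^ 2 * (n * c) := by
    have : ∀ (x : ZMod q) z y, ∑ w : ZMod p, (load n c x z y w : ℝ) = n * c := by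
      intro x z y
      simp_rw [hload]
      rw [Finset.sum_comm]
      simp [hI, sum_slot_lt hc]
    simp_rw [this]
    simp [ZMod.card]
    ring
  -- the mixed moments
  have hpair : ∀ i j : Fin n, i ≠ j → ∑ x : ZMod q, ∑ z : ZMod p, ∑ y : ZMod p, ∑ w : ZMod p,
      I i x z y w * I j x z y w ≤ N * p ^ 3 + q * (q * p ^ 2 + p * c ^ 2) := by
    intro i j hij
    have htriv : ∀ x z, ∑ y : ZMod p, ∑ w : ZMod p, I i x z y w * I j x z y w ≤ (p : ℝ) ^ 2 := by
      intro x z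
      calc _ ≤ ∑ y : ZMod p, ∑ w : ZMod p, (1 : ℝ) :=
            Finset.sum_le_sum fun y _ => Finset.sum_le_sum fun w _ =>
              mul_le_one₀ (hI1 _ _ _ _ _) (hI0 _ _ _ _ _) (hI1 _ _ _ _ _)
        _ = (p : ℝ) ^ 2 := by simp [ZMod.card, sq]
    have hx : ∀ x : ZMod q, ∑ z : ZMod p, ∑ y : ZMod p, ∑ w : ZMod p, I i x z y w * I j x z y w ≤
        (if itemHash x i = itemHash x j then (p : ℝ) ^ 3 else 0) + (q * p ^ 2 + p * c ^ 2) := by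
      intro x
      split_ifs with h
      · calc _ ≤ ∑ z : ZMod p, (p : ℝ) ^ 2 := Finset.sum_le_sum fun z _ => htriv x z
          _ = (p : ℝ) ^ 3 := by simp [ZMod.card]; ring
          _ ≤ _ := le_add_of_nonneg_right (by positivity)
      · have hz : ∀ z : ZMod p, ∑ y : ZMod p, ∑ w : ZMod p, I i x z y w * I j x z y w ≤
            (if 1 * (z ^ itemHash x i - z ^ itemHash x j) = 0 then (p : ℝ) ^ 2 else 0) + c ^ 2 := by
          intro z
          split_ifs with h'
          · exact (htriv x z).trans (le_add_of_nonneg_right (by positivity))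
          · rw [zero_add, sum_slot_lt_and_slot_lt hc]
            intro h''
            exact h' (by rw [h'']; ring)
        have hcard := card_zeros_le (p := p) (q := q) (ι := Unit) (e := fun _ => itemHash x i)
          (e₀ := itemHash x j) (fun _ _ _ => rfl) (fun _ => h) (fun _ => itemHash_lt x i)
          (itemHash_lt x j) (fun _ => 1) (fun h => one_ne_zero (congrFun h ()))
        simp only [Finset.univ_unique, Finset.sum_singleton] at hcard
        have hcard' : (#{z : ZMod p | 1 * (z ^ itemHash x i - z ^ itemHash x j) = 0} : ℝ) ≤ q := by
          exact_mod_cast hcard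
        calc _ ≤ _ := Finset.sum_le_sum fun z _ => hz z
          _ = #{z : ZMod p | 1 * (z ^ itemHash x i - z ^ itemHash x j) = 0} * (p : ℝ) ^ 2
              + p * c ^ 2 := by
              rw [Finset.sum_add_distrib, ← Finset.sum_filter]
              simp [ZMod.card]
          _ ≤ _ := by
              rw [zero_add]
              gcongr
    have hcard := card_itemHash_eq_le (q := q) (i.2.trans_le hn) (j.2.trans_le hn)
      (fun h => hij (Fin.ext h))
    have hcard' : (#{x : ZMod q | itemHash x i = itemHash x j} : ℝ) ≤ N := by
      exact_mod_cast hcard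
    calc _ ≤ _ := Finset.sum_le_sum fun x _ => hx x
      _ = #{x : ZMod q | itemHash x i = itemHash x j} * (p : ℝ) ^ 3 + q * (q * p ^ 2 + p * c ^ 2) := by
          rw [Finset.sum_add_distrib, ← Finset.sum_filter]
          simp [ZMod.card]
          ring
      _ ≤ _ := by gcongr
  have hdiag : ∀ i : Fin n, ∑ x : ZMod q, ∑ z : ZMod p, ∑ y : ZMod p, ∑ w : ZMod p,
      I i x z y w * I i x z y w ≤ q * p ^ 3 := by
    intro i
    calc _ ≤ ∑ x : ZMod q, ∑ z : ZMod p, ∑ y : ZMod p, ∑ w : ZMod p, (1 : ℝ) :=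
          Finset.sum_le_sum fun x _ => Finset.sum_le_sum fun z _ => Finset.sum_le_sum fun y _ =>
            Finset.sum_le_sum fun w _ =>
              mul_le_one₀ (hI1 _ _ _ _ _) (hI0 _ _ _ _ _) (hI1 _ _ _ _ _)
      _ = q * (p : ℝ) ^ 3 := by simp [ZMod.card]; left; ring
  have hsq : ∑ x : ZMod q, ∑ z : ZMod p, ∑ y : ZMod p, ∑ w : ZMod p,
      (load n c x z y w : ℝ) ^ 2 ≤
      n * (q * p ^ 3) + n ^ 2 * (N * p ^ 3 + q * (q * p ^ 2 + p * c ^ 2)) := by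
    have h1 : ∑ x : ZMod q, ∑ z : ZMod p, ∑ y : ZMod p, ∑ w : ZMod p,
        (load n c x z y w : ℝ) ^ 2 = ∑ i : Fin n, ∑ j : Fin n,
        ∑ x : ZMod q, ∑ z : ZMod p, ∑ y : ZMod p, ∑ w : ZMod p, I i x z y w * I j x z y w := by
      simp_rw [hload, sq, Finset.sum_mul_sum]
      simp_rw [Finset.sum_comm (s := (univ : Finset (ZMod p))) (t := (univ : Finset (Fin n)))]
      simp_rw [Finset.sum_comm (s := (univ : Finset (ZMod q))) (t := (univ : Finset (Fin n)))]
    rw [h1]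
    have hb : (0 : ℝ) ≤ N * p ^ 3 + q * (q * p ^ 2 + p * c ^ 2) := by positivity
    calc _ ≤ ∑ i : Fin n, ∑ j : Fin n, ((if i = j then (q * p ^ 3 : ℝ) else 0) +
          (N * p ^ 3 + q * (q * p ^ 2 + p * c ^ 2))) := by
          refine Finset.sum_le_sum fun i _ => Finset.sum_le_sum fun j _ => ?_
          split_ifs with h
          · subst h
            linarith [hdiag i]
          · rw [zero_add]
            exact hpair i j h
      _ = _ := by
          simp_rw [Finset.sum_add_distrib]
          simp
          ring
  have hexpand : ∑ x : ZMod q, ∑ z : ZMod p, ∑ y : ZMod p, ∑ w : ZMod p,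
      ((load n c x z y w : ℝ) - n * c / p) ^ 2 =
      ∑ x : ZMod q, ∑ z : ZMod p, ∑ y : ZMod p, ∑ w : ZMod p, (load n c x z y w : ℝ) ^ 2 -
      2 * (n * c / p) * ∑ x : ZMod q, ∑ z : ZMod p, ∑ y : ZMod p, ∑ w : ZMod p,
        (load n c x z y w : ℝ) + q * p ^ 3 * (n * c / p) ^ 2 := by
    have : (q * p ^ 3 * (n * c / p) ^ 2 : ℝ) = ∑ x : ZMod q, ∑ z : ZMod p, ∑ y : ZMod p,
        ∑ w : ZMod p, ((n * c / p) ^ 2 : ℝ) := by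
      simp [ZMod.card]
      ring
    rw [this]
    simp only [Finset.mul_sum, ← Finset.sum_sub_distrib, ← Finset.sum_add_distrib]
    refine Finset.sum_congr rfl fun x _ => Finset.sum_congr rfl fun z _ =>
      Finset.sum_congr rfl fun y _ => Finset.sum_congr rfl fun w _ => ?_
    ring
  rw [hexpand, hmean]
  have e1 : 2 * (n * c / p) * (q * p ^ 2 * (n * c)) = 2 * (n ^ 2 * q * p * c ^ 2 : ℝ) := by
    field_simp
  have e2 : (q * p ^ 3 * (n * c / p) ^ 2 : ℝ) = n ^ 2 * q * p * c ^ 2 := by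
    field_simp
  have e3 : (q * p ^ 3 * (n + n ^ 2 * (N / q + q / p)) : ℝ)
      = n * (q * p ^ 3) + n ^ 2 * (N * p ^ 3 + q * (q * p ^ 2)) := by
    field_simp
  rw [e1, e2, e3]
  nlinarith

end Secretary

/-! ### Sorting the items by slot -/

namespace Secretary

open Finset

section Order

variable {n : ℕ}

/-- The arrival time of item `i` if the items arrive in the order of their slots, ties being
broken by index. -/
def rank (X : Fin n → ℕ) (i : Fin n) : ℕ := #{j | X j < X i ∨ X j = X i ∧ j < i}

lemma rank_lt_rank {X : Fin n → ℕ} {i j : Fin n} (h : X i < X j ∨ X i = X j ∧ i < j) :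
    rank X i < rank X j := by
  refine Finset.card_lt_card ⟨fun a ha => ?_, fun hs => ?_⟩
  · simp only [Finset.mem_filter, Finset.mem_univ, true_and] at ha ⊢
    omega
  · have := hs (Finset.mem_filter.mpr ⟨Finset.mem_univ i, h⟩)
    simp at this

lemma rank_lt (X : Fin n → ℕ) (i : Fin n) : rank X i < n := by
  calc rank X i < #(univ : Finset (Fin n)) := by
        refine Finset.card_lt_card ⟨Finset.subset_univ _, fun hs => ?_⟩
        have := hs (Finset.mem_univ i)
        simp at this
    _ = n := by simp

lemma rank_injective (X : Fin n → ℕ) : Function.Injective fun i => (⟨rank X i, rank_lt X i⟩ : Fin n) := by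
  intro i j hij
  have hij : rank X i = rank X j := congrArg Fin.val hij
  by_contra hne
  rcases (by omega : (X i < X j ∨ X i = X j ∧ i < j) ∨ (X j < X i ∨ X j = X i ∧ j < i)) with h | h
  · exact absurd hij (rank_lt_rank h).ne
  · exact absurd hij (rank_lt_rank h).ne'

/-- The arrival order in which the items are sorted by slot. -/
noncomputable def sortPerm (X : Fin n → ℕ) : Equiv.Perm (Fin n) :=
  (Equiv.ofBijective _ (Finite.injective_iff_bijective.mp (rank_injective X))).symm

lemma sortPerm_rank (X : Fin n → ℕ) (i : Fin n) :
    sortPerm X ⟨rank X i, rank_lt X i⟩ = i :=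
  (Equiv.ofBijective _ (Finite.injective_iff_bijective.mp (rank_injective X))).symm_apply_apply i

lemma rank_sortPerm (X : Fin n → ℕ) (t : Fin n) : rank X (sortPerm X t) = t :=
  congrArg Fin.val ((Equiv.ofBijective _
    (Finite.injective_iff_bijective.mp (rank_injective X))).apply_symm_apply t)

lemma rank_lt_of_lt {X : Fin n → ℕ} {c m : ℕ} (hc : #{j | X j < c} ≤ m) {i : Fin n}
    (hi : X i < c) : rank X i < m := by
  refine lt_of_lt_of_le (Finset.card_lt_card ⟨fun a ha => ?_, fun hs => ?_⟩) hc
  · simp only [Finset.mem_filter, Finset.mem_univ, true_and] at ha ⊢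
    omega
  · have := hs (Finset.mem_filter.mpr ⟨Finset.mem_univ i, hi⟩)
    simp at this

lemma le_rank_of_le {X : Fin n → ℕ} {c m : ℕ} (hc : m ≤ #{j | X j < c}) {i : Fin n}
    (hi : c ≤ X i) : m ≤ rank X i := by
  refine hc.trans (Finset.card_le_card fun a ha => ?_)
  simp only [Finset.mem_filter, Finset.mem_univ, true_and] at ha ⊢
  omega

/-- The items in order of decreasing value (only the entries below `n` matter). -/
noncomputable def top (hn : 0 < n) (v : Fin n → ℝ) (s : ℕ) : Fin n :=
  if h : s < n then Tuple.sort (fun i => -v i) ⟨s, h⟩ else ⟨0, hn⟩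

lemma top_injOn (hn : 0 < n) (v : Fin n → ℝ) : Set.InjOn (top hn v) (Set.Iio n) := by
  intro s hs t ht h
  simp only [Set.mem_Iio] at hs ht
  simp only [top, hs, ht, dif_pos] at h
  simpa using (Tuple.sort (fun i => -v i)).injective h

lemma exists_eq_top (hn : 0 < n) (v : Fin n → ℝ) (i : Fin n) : ∃ s < n, i = top hn v s := by
  refine ⟨(Tuple.sort fun i => -v i).symm i, Fin.is_lt _, ?_⟩
  simp [top]

lemma top_le_top (hn : 0 < n) (v : Fin n → ℝ) {s t : ℕ} (hst : s ≤ t) (ht : t < n) :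
    v (top hn v t) ≤ v (top hn v s) := by
  have := Tuple.monotone_sort (fun i => -v i) (show (⟨s, by omega⟩ : Fin n) ≤ ⟨t, ht⟩ from hst)
  simp only [top, ht, show s < n by omega, dif_pos]
  simpa using this

/-- If the best item comes after the observation period, the `(r + 1)`-st best of the others comes
in the observation period, and those in between come after the best item, then wait-and-pick
succeeds. -/
theorem picksBest_of_rank (hn : 0 < n) {m : ℕ} {v : Fin n → ℝ} (hv : Function.Injective v)
    {X : Fin n → ℕ} {r : ℕ} (h0 : m ≤ rank X (top hn v 0))
    (h1 : ∀ s < r, rank X (top hn v 0) < rank X (top hn v (s + 1)))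
    (h2 : rank X (top hn v (r + 1)) < m) : PicksBest hn m v (sortPerm X) := by
  classical
  set π := sortPerm X with hπ
  set t₀ : Fin n := ⟨rank X (top hn v 0), rank_lt _ _⟩ with ht₀
  have hbest : ∀ i, v i ≤ v (top hn v 0) := by
    intro i
    obtain ⟨s, hs, rfl⟩ := exists_eq_top hn v i
    exact top_le_top hn v (Nat.zero_le s) hs
  have hπt₀ : π t₀ = top hn v 0 := sortPerm_rank X _
  have hmem : t₀ ∈ acceptTimes m (v ∘ π) := by
    refine Finset.mem_filter.mpr ⟨Finset.mem_univ _, h0, fun s hs => ?_⟩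
    refine lt_of_le_of_ne ?_ fun h => hs.ne (π.injective (hv h))
    simp only [Function.comp_apply, hπt₀]
    exact hbest _
  have hmin : ∀ t ∈ acceptTimes m (v ∘ π), t₀ ≤ t := by
    intro t ht
    by_contra hlt
    rw [not_le] at hlt
    obtain ⟨hmt, hacc⟩ := (Finset.mem_filter.mp ht).2
    have h3 := hacc ⟨rank X (top hn v (r + 1)), rank_lt _ _⟩ (by
      rw [Fin.lt_def]; exact h2.trans_le hmt)
    simp only [Function.comp_apply, hπ, sortPerm_rank] at h3
    obtain ⟨s, hs, hs'⟩ := exists_eq_top hn v (sortPerm X t)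
    have hrank : rank X (top hn v s) = t := by rw [← hs', rank_sortPerm]
    have hsr : s < r + 1 := by
      by_contra hge
      rw [hs'] at h3
      exact absurd (top_le_top hn v (not_lt.mp hge) hs) (not_le.mpr h3)
    rcases Nat.eq_zero_or_pos s with rfl | hs0
    · rw [Fin.lt_def] at hlt
      simp only [ht₀] at hlt
      omega
    · have := h1 (s - 1) (by omega)
      rw [Nat.sub_add_cancel hs0, hrank] at this
      rw [Fin.lt_def] at hlt
      simp only [ht₀] at hlt
      omega
  have hwp : waitAndPick hn m (v ∘ π) = t₀ := by
    have hne : (acceptTimes m (v ∘ π)).Nonempty := ⟨_, hmem⟩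
    unfold waitAndPick
    rw [dif_pos hne]
    exact le_antisymm (Finset.min'_le _ _ hmem) (hmin _ (Finset.min'_mem _ _))
  intro i
  rw [hwp, hπt₀]
  exact hbest i

end Order

/-- The arrival order for the seeds `x, z, y, w`. -/
noncomputable def seedPerm (n : ℕ) {p q : ℕ} (x : ZMod q) (z y w : ZMod p) : Equiv.Perm (Fin n) :=
  sortPerm fun i => slot z y w (itemHash x i)

open Classical in
/-- The events `Caught` are disjoint, and each of them leads to success if the initial segments of
the slots hold the right number of items. -/
theorem sum_caught_le {n p q m c₁ c₂ : ℕ} (hn : 0 < n) {v : Fin n → ℝ}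
    (hv : Function.Injective v) (hc : c₁ ≤ c₂) (k : ℕ) (x : ZMod q) (z y w : ZMod p) :
    ∑ r ∈ range k, (if Caught c₁ c₂ (fun s => itemHash x (top hn v s)) z y w r then (1 : ℝ) else 0)
      - (if m < load n c₁ x z y w then 1 else 0) - (if load n c₂ x z y w < m then 1 else 0) ≤
      if PicksBest hn m v (seedPerm n x z y w) then 1 else 0 := by
  set X : Fin n → ℕ := fun i => slot z y w (itemHash x i) with hX
  rw [← Finset.sum_filter, Finset.sum_const, nsmul_eq_mul, mul_one]
  set S := (range k).filter fun r =>
    Caught c₁ c₂ (fun s => itemHash x (top hn v s)) z y w r with hS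
  have hone : #S ≤ 1 := by
    have key : ∀ r r' : ℕ, r < r' → Caught c₁ c₂ (fun s => itemHash x (top hn v s)) z y w r →
        Caught c₁ c₂ (fun s => itemHash x (top hn v s)) z y w r' → False := by
      intro r r' hlt h h'
      have a1 := h.2.2
      have a2 := h'.2.1 r hlt
      have a3 := h'.1
      omega
    refine Finset.card_le_one.mpr fun r hr r' hr' => ?_
    have b1 := (Finset.mem_filter.mp hr).2
    have b2 := (Finset.mem_filter.mp hr').2
    rcases lt_trichotomy r r' with h | h | h
    · exact (key r r' h b1 b2).elim
    · exact h
    · exact (key r' r h b2 b1).elim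
  have hone' : (#S : ℝ) ≤ 1 := by exact_mod_cast hone
  by_cases hbad1 : m < load n c₁ x z y w
  · rw [if_pos hbad1]
    split_ifs <;> linarith
  by_cases hbad2 : load n c₂ x z y w < m
  · rw [if_pos hbad2]
    split_ifs <;> linarith
  rw [if_neg hbad1, if_neg hbad2]
  rcases Finset.eq_empty_or_nonempty S with hE | ⟨r, hr⟩
  · rw [hE]
    split_ifs <;> norm_num
  · rw [if_pos]
    · linarith
    · obtain ⟨-, h0, h1, h2⟩ := Finset.mem_filter.mp hr
      refine picksBest_of_rank hn hv (r := r) ?_ ?_ ?_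
      · exact le_rank_of_le (X := X) (not_lt.mp hbad2) h0
      · exact fun s hs => rank_lt_rank (X := X) (Or.inl (h1 s hs))
      · exact rank_lt_of_lt (X := X) (not_lt.mp hbad1) h2

end Secretary

/-! ### The success probability -/

namespace Secretary

open Finset

/-- The loss in `intervalMean` that is due to the finite number of layers and to rounding. -/
noncomputable def meanLoss (p M : ℕ) : ℝ := 2 ^ (M + 1) / p + (2 ^ (M + 1))⁻¹

lemma meanLoss_nonneg (p M : ℕ) : 0 ≤ meanLoss p M := by unfold meanLoss; positivity

lemma intervalMean_le (p M len : ℕ) : intervalMean p M len ≤ len / p := by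
  unfold intervalMean
  have h : ((2 ^ (M + 1) * (len / 2 ^ (M + 1)) : ℕ) : ℝ) ≤ len := by
    exact_mod_cast Nat.mul_div_le _ _
  push_cast at h
  have h0 : (0 : ℝ) ≤ ((len / 2 ^ (M + 1) : ℕ) : ℝ) := by positivity
  gcongr
  linarith

lemma le_intervalMean {p M len : ℕ} (hp : 0 < p) (hlen : len ≤ p) :
    len / p - meanLoss p M ≤ intervalMean p M len := by
  unfold intervalMean meanLoss
  have hp' : (0 : ℝ) < p := by exact_mod_cast hp
  have hE : (1 : ℝ) ≤ 2 ^ (M + 1) := one_le_pow₀ (by norm_num)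
  set E : ℝ := 2 ^ (M + 1) with hEdef
  have h1 : len < 2 ^ (M + 1) * (len / 2 ^ (M + 1)) + 2 ^ (M + 1) := by
    have := Nat.div_add_mod len (2 ^ (M + 1))
    have := Nat.mod_lt len (show 0 < 2 ^ (M + 1) by positivity)
    omega
  have h2 : (len : ℝ) ≤ E * ((len / 2 ^ (M + 1) : ℕ) : ℝ) + E := by
    have h3 : (len : ℝ) < ((2 ^ (M + 1) * (len / 2 ^ (M + 1)) + 2 ^ (M + 1) : ℕ) : ℝ) := by
      exact_mod_cast h1
    push_cast at h3
    exact h3.le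
  set d : ℝ := ((len / 2 ^ (M + 1) : ℕ) : ℝ) with hd
  have hlen' : (len : ℝ) ≤ p := by exact_mod_cast hlen
  have h4 : E * d ≤ p := by
    have h5 : ((2 ^ (M + 1) * (len / 2 ^ (M + 1)) : ℕ) : ℝ) ≤ len := by
      exact_mod_cast Nat.mul_div_le _ _
    push_cast at h5
    linarith
  have h6 : d ≤ p * E⁻¹ := by
    rw [← div_eq_mul_inv, le_div_iff₀ (by linarith)]
    linarith
  rw [← sub_nonneg]
  have : (E - 1) * d / p - (len / p - (E / p + E⁻¹)) = ((E * d + E - len) + (p * E⁻¹ - d)) / p := by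
    field_simp
    ring
  rw [this]
  apply div_nonneg _ hp'.le
  linarith

/-- A Riemann sum for the integral of `1 / t`. -/
lemma neg_log_le_sum {p c : ℕ} {η : ℝ} (hp : 0 < p) (hη : 0 ≤ η) (hc : 0 < c) (hcp : c ≤ p) :
    -Real.log (c / p + η) ≤ ∑ u ∈ Ico c p, 1 / (u + η * p) := by
  have hp' : (0 : ℝ) < p := by exact_mod_cast hp
  have hstep : ∀ u ∈ Ico c p, Real.log ((u + 1 : ℕ) + η * p) - Real.log (u + η * p) ≤
      1 / (u + η * p) := by
    intro u hu
    have hu0 : (0 : ℝ) < u := by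
      have := (Finset.mem_Ico.mp hu).1
      exact_mod_cast (show 0 < u by omega)
    have h1 : 0 < u + η * p := by positivity
    rw [← Real.log_div (by push_cast; positivity) h1.ne']
    refine (Real.log_le_sub_one_of_pos (by push_cast; positivity)).trans ?_
    push_cast
    rw [div_sub_one h1.ne']
    apply le_of_eq
    ring
  refine le_trans ?_ (Finset.sum_le_sum hstep)
  rw [Finset.sum_Ico_sub (fun u : ℕ => Real.log (u + η * p)) hcp]
  have hc' : (0 : ℝ) < c := by exact_mod_cast hc
  have h2 : (c : ℝ) + η * p = (c / p + η) * p := by field_simp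
  have h3 : Real.log p ≤ Real.log (p + η * p) :=
    Real.log_le_log hp' (by nlinarith)
  rw [h2, Real.log_mul (by positivity) hp'.ne']
  linarith

lemma third_le_inv_exp : (1 : ℝ) / 3 ≤ 1 / Real.exp 1 := by
  have := Real.exp_one_lt_three
  have := Real.exp_pos 1
  gcongr

lemma inv_exp_le_half : (1 : ℝ) / Real.exp 1 ≤ 1 / 2 := by
  have := Real.exp_one_gt_d9
  gcongr
  linarith

/-- For a fixed hash function without collisions among the best items, the probabilities of the
events `Caught` add up to nearly `1 / e`: a geometric sum over the events for each slot of the best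
item, followed by an approximation of the integral of `1 / t` from `1 / e` to `1`. -/
theorem le_sum_sum_caught {p q k M R c₁ c₂ : ℕ} {γ γ' : ℝ} (hp : 0 < p) (hc₁ : c₁ ≤ p)
    (hc₂ : c₂ ≤ p) (h₂ : (1 : ℝ) / 3 ≤ c₂ / p) (hγ0 : 0 ≤ γ)
    (hγ' : 1 / Real.exp 1 - γ' ≤ c₁ / p - meanLoss p M)
    (hγ : c₂ / p + meanLoss p M ≤ 1 / Real.exp 1 + γ) :
    (p : ℝ) ^ 3 * (1 / Real.exp 1 - γ' - (2 / 3) ^ k - 3 * γ - (2 / 3) ^ R * 2 ^ k -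
        q / p * (M + 1) * 2 ^ (R + k)) ≤
      ∑ r ∈ range k, ∑ u ∈ Ico c₂ p, ((p : ℝ) ^ 2 * (intervalMean p M c₁ *
        (intervalMean p M (p - u) ^ r - (2 / 3) ^ R * 2 ^ r)) -
          p * q * ((M + 1) * 2 ^ (R + r))) := by
  have hp' : (0 : ℝ) < p := by exact_mod_cast hp
  set β := intervalMean p M c₁ with hβ
  set η := meanLoss p M with hη
  have hη0 : 0 ≤ η := meanLoss_nonneg p M
  have hβ0 : 0 ≤ β := intervalMean_nonneg _ _ _
  have hβ1 : β ≤ 1 := (intervalMean_le _ _ _).trans (by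
    rw [div_le_one hp']; exact_mod_cast hc₁)
  have hβγ : 1 / Real.exp 1 - γ' ≤ β := hγ'.trans (le_intervalMean hp hc₁)
  have hc0 : 0 < c₂ := by
    rcases Nat.eq_zero_or_pos c₂ with rfl | h
    · norm_num at h₂
    · exact h
  have h23 : (0 : ℝ) ≤ 1 - (2 / 3) ^ k := by
    have : ((2 : ℝ) / 3) ^ k ≤ 1 := pow_le_one₀ (by norm_num) (by norm_num)
    linarith
  -- the geometric sums
  have hgeom : ∀ u ∈ Ico c₂ p, (1 - (2 / 3) ^ k) * (p * (1 / (u + η * p))) ≤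
      ∑ r ∈ range k, intervalMean p M (p - u) ^ r := by
    intro u hu
    obtain ⟨hu1, hu2⟩ := Finset.mem_Ico.mp hu
    set α := intervalMean p M (p - u) with hα
    have hα0 : 0 ≤ α := intervalMean_nonneg _ _ _
    have hu0 : (0 : ℝ) < u := by exact_mod_cast (show 0 < u by omega)
    have hcu : (c₂ : ℝ) / p ≤ u / p := by
      have : (c₂ : ℝ) ≤ u := by exact_mod_cast hu1
      gcongr
    have hcast : ((p - u : ℕ) : ℝ) / p = 1 - u / p := by
      rw [Nat.cast_sub hu2.le, sub_div, div_self hp'.ne']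
    have hα1 : α ≤ 2 / 3 := by
      have := intervalMean_le p M (p - u)
      rw [hcast] at this
      linarith
    have hα2 : 1 - α ≤ u / p + η := by
      have := le_intervalMean (M := M) hp (Nat.sub_le p u)
      rw [hcast] at this
      linarith
    have hαk : α ^ k ≤ (2 / 3) ^ k := by gcongr
    have h1α : 0 < 1 - α := by linarith
    have hsum : (1 - α) * ∑ r ∈ range k, α ^ r = 1 - α ^ k := mul_neg_geom_sum α k
    have hrw : (p : ℝ) * (1 / (u + η * p)) = (u / p + η)⁻¹ := by
      field_simp
    rw [hrw, ← div_eq_mul_inv, div_le_iff₀ (by positivity)]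
    have h0 : 0 ≤ ∑ r ∈ range k, α ^ r := Finset.sum_nonneg fun r _ => by positivity
    nlinarith
  -- the integral
  have hint : 1 - 3 * γ ≤ ∑ u ∈ Ico c₂ p, 1 / (u + η * p) := by
    refine le_trans ?_ (neg_log_le_sum hp hη0 hc0 hc₂)
    have he := Real.exp_pos 1
    have h1 : Real.log (c₂ / p + η) ≤ Real.log (1 / Real.exp 1 * (1 + Real.exp 1 * γ)) := by
      refine Real.log_le_log (by linarith) (hγ.trans (le_of_eq ?_))
      field_simp
    rw [Real.log_mul (by positivity) (by positivity), one_div, Real.log_inv, Real.log_exp] at h1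
    have h2 : Real.log (1 + Real.exp 1 * γ) ≤ Real.exp 1 * γ := by
      have := Real.log_le_sub_one_of_pos (show 0 < 1 + Real.exp 1 * γ by positivity)
      linarith
    have h3 : Real.exp 1 * γ ≤ 3 * γ := by
      have := Real.exp_one_lt_three
      gcongr
    linarith
  -- the main term
  have hmain : (p : ℝ) ^ 3 * (1 / Real.exp 1 - γ' - (2 / 3) ^ k - 3 * γ) ≤
      ∑ u ∈ Ico c₂ p, (p : ℝ) ^ 2 * (β * ∑ r ∈ range k, intervalMean p M (p - u) ^ r) := by
    calc _ ≤ (p : ℝ) ^ 3 * (β * ((1 - (2 / 3) ^ k) * ∑ u ∈ Ico c₂ p, 1 / (u + η * p))) := by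
          refine mul_le_mul_of_nonneg_left ?_ (by positivity)
          set a : ℝ := (2 / 3) ^ k
          have ha0 : 0 ≤ a := by positivity
          set S := ∑ u ∈ Ico c₂ p, 1 / (u + η * p)
          have h1 : (1 - a) * (1 - 3 * γ) ≤ (1 - a) * S := mul_le_mul_of_nonneg_left hint h23
          have h2 : β * ((1 - a) * (1 - 3 * γ)) ≤ β * ((1 - a) * S) :=
            mul_le_mul_of_nonneg_left h1 hβ0
          have h3 : 0 ≤ a * γ := by positivity
          have h4 : 1 - a - 3 * γ ≤ (1 - a) * (1 - 3 * γ) := by nlinarith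
          have h5 : β * (1 - a - 3 * γ) ≤ β * ((1 - a) * (1 - 3 * γ)) :=
            mul_le_mul_of_nonneg_left h4 hβ0
          have h6 : β * (a + 3 * γ) ≤ a + 3 * γ := mul_le_of_le_one_left (by positivity) hβ1
          linarith
      _ = ∑ u ∈ Ico c₂ p, (p : ℝ) ^ 2 * (β * ((1 - (2 / 3) ^ k) * (p * (1 / (u + η * p))))) := by
          simp_rw [← Finset.mul_sum]
          ring
      _ ≤ _ := by
          refine Finset.sum_le_sum fun u hu => ?_
          have := hgeom u hu
          gcongr
  -- the error terms
  have hpow : ∑ r ∈ range k, (2 : ℝ) ^ r ≤ 2 ^ k := by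
    rw [geom_sum_eq (by norm_num)]
    have : (2 : ℝ) - 1 = 1 := by norm_num
    rw [this, div_one]
    linarith
  have herr : ∑ u ∈ Ico c₂ p, ∑ r ∈ range k, ((p : ℝ) ^ 2 * (β * ((2 / 3) ^ R * 2 ^ r)) +
      p * q * ((M + 1) * 2 ^ (R + r))) ≤
      (p : ℝ) ^ 3 * ((2 / 3) ^ R * 2 ^ k + q / p * (M + 1) * 2 ^ (R + k)) := by
    have h1 : ∑ r ∈ range k, ((p : ℝ) ^ 2 * (β * ((2 / 3) ^ R * 2 ^ r)) +
        p * q * ((M + 1) * 2 ^ (R + r))) ≤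
        (p : ℝ) ^ 2 * ((2 / 3) ^ R * 2 ^ k) + p * q * ((M + 1) * 2 ^ (R + k)) := by
      have : ∑ r ∈ range k, ((p : ℝ) ^ 2 * (β * ((2 / 3) ^ R * 2 ^ r)) +
          p * q * ((M + 1) * 2 ^ (R + r))) =
          (p ^ 2 * (β * (2 / 3) ^ R) + p * q * ((M + 1) * 2 ^ R)) * ∑ r ∈ range k, (2 : ℝ) ^ r := by
        rw [Finset.mul_sum]
        refine Finset.sum_congr rfl fun r _ => ?_
        rw [pow_add]
        ring
      rw [this]
      calc _ ≤ (p ^ 2 * (1 * (2 / 3) ^ R) + p * q * ((M + 1) * 2 ^ R)) * (2 : ℝ) ^ k := by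
            gcongr
        _ = _ := by rw [pow_add]; ring
    calc _ ≤ ∑ u ∈ Ico c₂ p,
          ((p : ℝ) ^ 2 * ((2 / 3) ^ R * 2 ^ k) + p * q * ((M + 1) * 2 ^ (R + k))) :=
          Finset.sum_le_sum fun u _ => h1
      _ = ((p - c₂ : ℕ) : ℝ) *
          ((p : ℝ) ^ 2 * ((2 / 3) ^ R * 2 ^ k) + p * q * ((M + 1) * 2 ^ (R + k))) := by
          rw [Finset.sum_const, Nat.card_Ico, nsmul_eq_mul]
      _ ≤ (p : ℝ) * ((p : ℝ) ^ 2 * ((2 / 3) ^ R * 2 ^ k) + p * q * ((M + 1) * 2 ^ (R + k))) := by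
          have : ((p - c₂ : ℕ) : ℝ) ≤ p := by exact_mod_cast Nat.sub_le _ _
          gcongr
      _ = _ := by field_simp
  rw [Finset.sum_comm]
  have hsplit : ∑ u ∈ Ico c₂ p, ∑ r ∈ range k, ((p : ℝ) ^ 2 * (β *
        (intervalMean p M (p - u) ^ r - (2 / 3) ^ R * 2 ^ r)) - p * q * ((M + 1) * 2 ^ (R + r))) =
      ∑ u ∈ Ico c₂ p, (p : ℝ) ^ 2 * (β * ∑ r ∈ range k, intervalMean p M (p - u) ^ r) -
      ∑ u ∈ Ico c₂ p, ∑ r ∈ range k, ((p : ℝ) ^ 2 * (β * ((2 / 3) ^ R * 2 ^ r)) +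
      p * q * ((M + 1) * 2 ^ (R + r))) := by
    simp_rw [Finset.mul_sum, ← Finset.sum_sub_distrib]
    refine Finset.sum_congr rfl fun u _ => Finset.sum_congr rfl fun r _ => ?_
    ring
  rw [hsplit]
  linarith

open Classical in
/-- Collisions among the best `k + 1` items are rare. -/
lemma card_not_injOn_le {n q N k : ℕ} [Fact q.Prime] (hn0 : 0 < n) (hn : n ≤ 2 ^ N) (hk : k < n)
    (v : Fin n → ℝ) :
    #{x : ZMod q | ¬ Set.InjOn (fun s => itemHash x (top hn0 v s)) (Set.Iic k)} ≤
      (k + 1) ^ 2 * N := by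
  calc _ ≤ #(((range (k + 1) ×ˢ range (k + 1)).filter fun a => a.1 ≠ a.2).biUnion fun a =>
        {x : ZMod q | itemHash x (top hn0 v a.1) = itemHash x (top hn0 v a.2)}) := by
        refine Finset.card_le_card fun x hx => ?_
        have hx := (Finset.mem_filter.mp hx).2
        simp only [Set.InjOn, not_forall] at hx
        obtain ⟨s, hs, t, ht, hst, hne⟩ := hx
        simp only [Set.mem_Iic] at hs ht
        refine Finset.mem_biUnion.mpr ⟨(s, t), ?_, ?_⟩
        · simp only [Finset.mem_filter, Finset.mem_product, Finset.mem_range]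
          exact ⟨⟨by omega, by omega⟩, hne⟩
        · simpa using hst
    _ ≤ #((range (k + 1) ×ˢ range (k + 1)).filter fun a => a.1 ≠ a.2) * N := by
        refine Finset.card_biUnion_le_card_mul _ _ _ fun a ha => ?_
        simp only [Finset.mem_filter, Finset.mem_product, Finset.mem_range] at ha
        refine card_itemHash_eq_le ((Fin.is_lt _).trans_le hn) ((Fin.is_lt _).trans_le hn) ?_
        intro h
        exact ha.2 (top_injOn hn0 v (Set.mem_Iio.mpr (by omega)) (Set.mem_Iio.mpr (by omega))
          (Fin.ext h))
    _ ≤ #(range (k + 1) ×ˢ range (k + 1)) * N :=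
        Nat.mul_le_mul_right _ (Finset.card_filter_le _ _)
    _ = (k + 1) ^ 2 * N := by rw [Finset.card_product, Finset.card_range, sq]

/-- The number of seeds for which the load differs by at least `D` from its mean. -/
lemma sum_ite_load_le {n p q N : ℕ} [Fact p.Prime] [Fact q.Prime] (hn : n ≤ 2 ^ N) {c : ℕ}
    (hc : c ≤ p) {D : ℝ} (hD : 0 < D) (P : ℕ → Prop) [DecidablePred P]
    (hP : ∀ l : ℕ, P l → D ≤ |(l : ℝ) - n * c / p|) :
    ∑ x : ZMod q, ∑ z : ZMod p, ∑ y : ZMod p, ∑ w : ZMod p,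
      (if P (load n c x z y w) then (1 : ℝ) else 0) ≤
      q * p ^ 3 * (n + n ^ 2 * (N / q + q / p)) / D ^ 2 := by
  rw [le_div_iff₀ (by positivity)]
  refine le_trans ?_ (sum_load_sub_sq_le hn hc)
  simp_rw [Finset.sum_mul]
  refine Finset.sum_le_sum fun x _ => Finset.sum_le_sum fun z _ => Finset.sum_le_sum fun y _ =>
    Finset.sum_le_sum fun w _ => ?_
  split_ifs with h
  · rw [one_mul, ← sq_abs ((load n c x z y w : ℝ) - n * c / p)]
    have := hP _ h
    gcongr
  · rw [zero_mul]
    positivity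

open Classical in
set_option maxHeartbeats 1000000 in
/-- A lower bound for the number of successful seeds. The parameters are free: `δ` is the tolerance
for the loads, `k` the number of events `Caught` that are counted, and `M` and `R` bound the layers
and the sums of layer indices; there are at most `2 ^ N` items. -/
theorem le_sum_picksBest {n p q N k M R : ℕ} [Fact p.Prime] [Fact q.Prime] {δ : ℝ} (hn0 : 0 < n)
    (hn : n ≤ 2 ^ N) (hk : k < n) (hp : 8 ≤ p) (hδ0 : 0 < δ) (hδ : δ ≤ 1 / 8)
    {v : Fin n → ℝ} (hv : Function.Injective v) :
    (q * p ^ 3 : ℝ) * (1 / Real.exp 1 - (4 * δ + 4 / p + 4 * meanLoss p M + (2 / 3) ^ k +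
        (2 / 3) ^ R * 2 ^ k + q / p * (M + 1) * 2 ^ (R + k) + (k + 1) ^ 2 * N / q +
        2 * (1 / n + N / q + q / p) / δ ^ 2)) ≤
      ∑ x : ZMod q, ∑ z : ZMod p, ∑ y : ZMod p, ∑ w : ZMod p,
        if PicksBest hn0 ⌊(n : ℝ) / Real.exp 1⌋₊ v (seedPerm n x z y w) then (1 : ℝ) else 0 := by
  set m := ⌊(n : ℝ) / Real.exp 1⌋₊ with hm
  have hpN : 0 < p := by omega
  have hp0 : (0 : ℝ) < p := by exact_mod_cast hpN
  have hq0 : (0 : ℝ) < q := by exact_mod_cast (Fact.out : q.Prime).pos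
  have hn0' : (0 : ℝ) < n := by exact_mod_cast hn0
  have hp8 : (1 : ℝ) / p ≤ 1 / 8 := by
    have : (8 : ℝ) ≤ p := by exact_mod_cast hp
    gcongr
  have he3 := third_le_inv_exp
  have he2 := inv_exp_le_half
  set ε := 1 / Real.exp 1 with hε
  have hmle : (m : ℝ) ≤ n * ε := by
    have := Nat.floor_le (show 0 ≤ (n : ℝ) / Real.exp 1 by positivity)
    rw [hε, mul_one_div]
    exact this
  have hmge : n * ε - 1 ≤ (m : ℝ) := by
    have := (Nat.lt_floor_add_one ((n : ℝ) / Real.exp 1)).le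
    rw [hε, mul_one_div, sub_le_iff_le_add]
    exact this
  -- the mean loads of the first `c₁` and `c₂` slots are at most `n * (ε - δ)` and at least
  -- `n * (ε + δ)`, and the time threshold is `n * ε` rounded down
  set c₁ := ⌊(p : ℝ) * (ε - δ)⌋₊ with hc₁
  set c₂ := ⌈(p : ℝ) * (ε + δ)⌉₊ with hc₂
  have a1 : (c₁ : ℝ) ≤ p * (ε - δ) := Nat.floor_le (mul_nonneg hp0.le (by linarith))
  have a2 : (p : ℝ) * (ε - δ) - 1 ≤ c₁ := by
    have := (Nat.lt_floor_add_one ((p : ℝ) * (ε - δ))).le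
    linarith
  have a3 : (p : ℝ) * (ε + δ) ≤ c₂ := Nat.le_ceil _
  have a4 : (c₂ : ℝ) ≤ p * (ε + δ) + 1 :=
    (Nat.ceil_lt_add_one (mul_nonneg hp0.le (by linarith))).le
  have b1 : (c₁ : ℝ) / p ≤ ε - δ := by rw [div_le_iff₀ hp0]; linarith
  have b2 : ε - δ - 1 / p ≤ (c₁ : ℝ) / p := by
    rw [le_div_iff₀ hp0, sub_mul, one_div_mul_cancel hp0.ne']; linarith
  have b3 : ε + δ ≤ (c₂ : ℝ) / p := by rw [le_div_iff₀ hp0]; linarith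
  have b4 : (c₂ : ℝ) / p ≤ ε + δ + 1 / p := by
    rw [div_le_iff₀ hp0, add_mul _ (1 / (p : ℝ)), one_div_mul_cancel hp0.ne']; linarith
  have hc₂p : c₂ ≤ p := by
    have : (c₂ : ℝ) / p ≤ 1 := by linarith
    rw [div_le_one hp0] at this
    exact_mod_cast this
  have hc₁₂ : c₁ ≤ c₂ := by
    have : (c₁ : ℝ) / p ≤ c₂ / p := by linarith
    rw [div_le_div_iff_of_pos_right hp0] at this
    exact_mod_cast this
  have hc₁p : c₁ ≤ p := hc₁₂.trans hc₂p
  have hη0 := meanLoss_nonneg p M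
  set W : ℝ := (p : ℝ) ^ 3 * (ε - (δ + 1 / p + meanLoss p M) - (2 / 3) ^ k -
    3 * (δ + 1 / p + meanLoss p M) - (2 / 3) ^ R * 2 ^ k - q / p * (M + 1) * 2 ^ (R + k)) with hW
  have hWle : W ≤ p ^ 3 := by
    refine mul_le_of_le_one_right (by positivity) ?_
    have t1 : (0 : ℝ) ≤ (2 / 3) ^ k := by positivity
    have t2 : (0 : ℝ) ≤ (2 / 3) ^ R * 2 ^ k := by positivity
    have t3 : (0 : ℝ) ≤ q / p * (M + 1) * 2 ^ (R + k) := by positivity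
    have t4 : (0 : ℝ) < 1 / p := by positivity
    linarith
  set G : ZMod q → ℝ := fun x => ∑ z : ZMod p, ∑ y : ZMod p, ∑ w : ZMod p, ∑ r ∈ range k,
    (if Caught c₁ c₂ (fun s => itemHash x (top hn0 v s)) z y w r then (1 : ℝ) else 0) with hG
  have hGx : ∀ x, W - (if ¬ Set.InjOn (fun s => itemHash x (top hn0 v s)) (Set.Iic k) then
      (p : ℝ) ^ 3 else 0) ≤ G x := by
    intro x
    by_cases hx : Set.InjOn (fun s => itemHash x (top hn0 v s)) (Set.Iic k)
    · rw [if_neg (not_not.mpr hx), sub_zero]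
      have h1 := le_sum_sum_caught (p := p) (q := q) (k := k) (M := M) (R := R) (c₁ := c₁)
        (c₂ := c₂) (γ := δ + 1 / p + meanLoss p M) (γ' := δ + 1 / p + meanLoss p M)
        hpN hc₁p hc₂p (by linarith) (by positivity) (by linarith) (by linarith)
      refine h1.trans ?_
      have h2 : G x = ∑ r ∈ range k, ∑ z : ZMod p, ∑ y : ZMod p, ∑ w : ZMod p,
          (if Caught c₁ c₂ (fun s => itemHash x (top hn0 v s)) z y w r then (1 : ℝ) else 0) := by
        simp only [hG]
        simp_rw [Finset.sum_comm (s := (univ : Finset (ZMod p))) (t := range k)]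
      rw [h2]
      refine Finset.sum_le_sum fun r hr => ?_
      have hr := Finset.mem_range.mp hr
      exact le_sum_caught (hx.mono (Set.Iic_subset_Iic.mpr (by omega)))
        (fun i => itemHash_lt x _) M R c₂ hc₁p
    · rw [if_pos hx]
      have : 0 ≤ G x := Finset.sum_nonneg fun z _ => Finset.sum_nonneg fun y _ =>
        Finset.sum_nonneg fun w _ => Finset.sum_nonneg fun r _ => by split_ifs <;> norm_num
      linarith
  have hGsum : q * W - (k + 1) ^ 2 * N * p ^ 3 ≤ ∑ x, G x := by
    have hcard := card_not_injOn_le (q := q) hn0 hn hk v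
    have hcard' : (#{x : ZMod q | ¬ Set.InjOn (fun s => itemHash x (top hn0 v s)) (Set.Iic k)} : ℝ) ≤
        (k + 1) ^ 2 * N := by exact_mod_cast hcard
    calc _ ≤ q * W - #{x : ZMod q | ¬ Set.InjOn (fun s => itemHash x (top hn0 v s)) (Set.Iic k)}
          * (p : ℝ) ^ 3 := by gcongr
      _ = ∑ x : ZMod q, (W - (if ¬ Set.InjOn (fun s => itemHash x (top hn0 v s)) (Set.Iic k) then
          (p : ℝ) ^ 3 else 0)) := by
          rw [Finset.sum_sub_distrib, ← Finset.sum_filter]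
          simp [ZMod.card]
      _ ≤ _ := Finset.sum_le_sum fun x _ => hGx x
  have hD : 0 < n * δ := by positivity
  have hbad1 := sum_ite_load_le (p := p) (q := q) hn hc₁p hD (fun l => m < l) (by
    intro l hl
    have hl' : (m : ℝ) + 1 ≤ l := by exact_mod_cast hl
    have h1 : (n : ℝ) * c₁ / p ≤ n * (ε - δ) := by rw [mul_div_assoc]; gcongr
    refine le_trans ?_ (le_abs_self _)
    nlinarith)
  have hbad2 := sum_ite_load_le (p := p) (q := q) hn hc₂p hD (fun l => l < m) (by
    intro l hl
    have hl' : (l : ℝ) ≤ m := by exact_mod_cast hl.le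
    have h1 : (n : ℝ) * (ε + δ) ≤ n * c₂ / p := by rw [mul_div_assoc]; gcongr
    refine le_trans ?_ (neg_le_abs _)
    nlinarith)
  have hpoint := fun (x : ZMod q) (z y w : ZMod p) =>
    sum_caught_le (m := m) hn0 hv hc₁₂ k x z y w
  have htotal : ∑ x, G x -
      ∑ x : ZMod q, ∑ z : ZMod p, ∑ y : ZMod p, ∑ w : ZMod p,
        (if m < load n c₁ x z y w then (1 : ℝ) else 0) -
      ∑ x : ZMod q, ∑ z : ZMod p, ∑ y : ZMod p, ∑ w : ZMod p,
        (if load n c₂ x z y w < m then (1 : ℝ) else 0) ≤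
      ∑ x : ZMod q, ∑ z : ZMod p, ∑ y : ZMod p, ∑ w : ZMod p,
        if PicksBest hn0 m v (seedPerm n x z y w) then (1 : ℝ) else 0 := by
    simp only [hG, ← Finset.sum_sub_distrib]
    exact Finset.sum_le_sum fun x _ => Finset.sum_le_sum fun z _ => Finset.sum_le_sum fun y _ =>
      Finset.sum_le_sum fun w _ => hpoint x z y w
  have hfinal : (q * p ^ 3 : ℝ) * (ε - (4 * δ + 4 / p + 4 * meanLoss p M + (2 / 3) ^ k +
        (2 / 3) ^ R * 2 ^ k + q / p * (M + 1) * 2 ^ (R + k) + (k + 1) ^ 2 * N / q +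
        2 * (1 / n + N / q + q / p) / δ ^ 2)) =
      (q * W - (k + 1) ^ 2 * N * p ^ 3) -
        q * p ^ 3 * (n + n ^ 2 * (N / q + q / p)) / (n * δ) ^ 2 -
        q * p ^ 3 * (n + n ^ 2 * (N / q + q / p)) / (n * δ) ^ 2 := by
    have e1 : (q * p ^ 3 * (n + n ^ 2 * (N / q + q / p)) / (n * δ) ^ 2 : ℝ) =
        q * p ^ 3 * ((1 / n + N / q + q / p) / δ ^ 2) := by
      field_simp
      ring
    have e2 : ((k + 1) ^ 2 * N * p ^ 3 : ℝ) = q * p ^ 3 * ((k + 1) ^ 2 * N / q) := by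
      field_simp
    rw [hW, e1, e2]
    ring
  rw [hfinal]
  linarith

end Secretary

/-! ### Verification of programs -/

namespace Secretary

/-- Total correctness with a time bound: from `s`, the program `prog` halts within `t` steps in a
state that satisfies `Q`. -/
def Runs (B : ℕ) (prog : Prog) (s : State) (t : ℕ) (Q : State → Prop) : Prop :=
  ∃ (s' : State) (t' : ℕ), Exec B prog s s' t' ∧ t' ≤ t ∧ Q s'

lemma Runs.mono {B : ℕ} {prog : Prog} {s : State} {t t' : ℕ} {Q Q' : State → Prop}
    (h : Runs B prog s t Q) (ht : t ≤ t') (hQ : ∀ s', Q s' → Q' s') : Runs B prog s t' Q' := by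
  obtain ⟨s', u, h1, h2, h3⟩ := h
  exact ⟨s', u, h1, h2.trans ht, hQ _ h3⟩

lemma Runs.seq {B : ℕ} {p q : Prog} {s : State} {t t' : ℕ} {Q : State → Prop}
    (h : Runs B p s t fun s' => Runs B q s' t' Q) : Runs B (.seq p q) s (t + t') Q := by
  obtain ⟨s₁, u, h1, h2, s₂, u', h3, h4, h5⟩ := h
  exact ⟨s₂, u + u', .seq h1 h3, by omega, h5⟩

/-- The rule for loops, with an invariant `I` and a variant `μ`. -/
lemma Runs.whileLt {B x y t : ℕ} {p : Prog} (I : State → Prop) (μ : State → ℕ)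
    (hbody : ∀ s, I s → s.reg x < s.reg y → Runs B p s t fun s' => I s' ∧ μ s' < μ s)
    {s : State} (hs : I s) :
    Runs B (.whileLt x y p) s (μ s * (t + 1) + 1) fun s' => I s' ∧ ¬ s'.reg x < s'.reg y := by
  induction hm : μ s using Nat.strong_induction_on generalizing s with
  | _ m ih =>
    by_cases h : s.reg x < s.reg y
    · obtain ⟨s₁, u, h1, h2, h3, h4⟩ := hbody s hs h
      obtain ⟨s₂, u', h5, h6, h7⟩ := ih (μ s₁) (hm ▸ h4) h3 rfl
      refine ⟨s₂, u + u' + 1, .whileStep h h1 h5, ?_, h7⟩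
      have : (μ s₁ + 1) * (t + 1) ≤ m * (t + 1) := Nat.mul_le_mul_right _ (by omega)
      linarith
    · exact ⟨s, 1, .whileDone h, by omega, hs, h⟩

/-- The weakest precondition of a program without loops. -/
def wp (B : ℕ) : Prog → (State → Prop) → State → Prop
  | .const x c, Q, s => c < B ∧ Q (s.setReg x c)
  | .arith op x y z, Q, s => op.eval (s.reg y) (s.reg z) < B ∧
      Q (s.setReg x (op.eval (s.reg y) (s.reg z)))
  | .load x y, Q, s => s.reg y < B ∧ Q (s.setReg x (s.mem (s.reg y)))
  | .store x y, Q, s => s.reg x < B ∧ s.reg y < B ∧ Q (s.setMem (s.reg x) (s.reg y))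
  | .seq p q, Q, s => wp B p (wp B q Q) s
  | .ifLt x y p q, Q, s => (s.reg x < s.reg y → wp B p Q s) ∧ (¬ s.reg x < s.reg y → wp B q Q s)
  | .whileLt _ _ _, _, _ => False

/-- The largest number of steps of a program without loops. (The value for loops is irrelevant, as
`wp` is false for them.) -/
def cost : Prog → ℕ
  | .const _ _ | .arith _ _ _ _ | .load _ _ | .store _ _ => 1
  | .seq p q => cost p + cost q
  | .ifLt _ _ p q => max (cost p) (cost q) + 1
  | .whileLt _ _ _ => 0

lemma Runs.of_wp {B : ℕ} (prog : Prog) {s : State} {Q : State → Prop} (h : wp B prog Q s) :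
    Runs B prog s (cost prog) Q := by
  induction prog generalizing s Q with
  | const x c => exact ⟨_, 1, .const s x c h.1, le_rfl, h.2⟩
  | arith op x y z => exact ⟨_, 1, .arith s op x y z h.1, le_rfl, h.2⟩
  | load x y => exact ⟨_, 1, .load s x y h.1, le_rfl, h.2⟩
  | store x y => exact ⟨_, 1, .store s x y h.1 h.2.1, le_rfl, h.2.2⟩
  | seq p q ihp ihq => exact Runs.seq ((ihp h).mono le_rfl fun s' h' => ihq h')
  | ifLt x y p q ihp ihq =>
    by_cases hc : s.reg x < s.reg y
    · obtain ⟨s', u, h1, h2, h3⟩ := ihp (h.1 hc)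
      exact ⟨s', u + 1, .ifTrue hc h1, by simp only [cost]; omega, h3⟩
    · obtain ⟨s', u, h1, h2, h3⟩ := ihq (h.2 hc)
      exact ⟨s', u + 1, .ifFalse hc h1, by simp only [cost]; omega, h3⟩
  | whileLt x y p _ => exact h.elim

@[simp] lemma reg_setReg (s : State) (x c y : ℕ) :
    (s.setReg x c).reg y = if y = x then c else s.reg y := by
  simp [State.setReg, Function.update_apply]

@[simp] lemma mem_setReg (s : State) (x c : ℕ) : (s.setReg x c).mem = s.mem := rfl

@[simp] lemma reg_setMem (s : State) (a c : ℕ) : (s.setMem a c).reg = s.reg := rfl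

@[simp] lemma mem_setMem (s : State) (a c b : ℕ) :
    (s.setMem a c).mem b = if b = a then c else s.mem b := by
  simp [State.setMem, Function.update_apply]

/-- The sequential composition of a list of programs (of which there has to be at least one). -/
def block : Prog → List Prog → Prog
  | p, [] => p
  | p, q :: l => .seq p (block q l)

/-! ### Searching for primes -/

/-- The least prime number that is at least `a`. -/
noncomputable def nextPrime (a : ℕ) : ℕ := Nat.find (Nat.exists_infinite_primes a)

lemma le_nextPrime (a : ℕ) : a ≤ nextPrime a := (Nat.find_spec (Nat.exists_infinite_primes a)).1

lemma nextPrime_prime (a : ℕ) : (nextPrime a).Prime :=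
  (Nat.find_spec (Nat.exists_infinite_primes a)).2

lemma nextPrime_le {a b : ℕ} (h : a ≤ b) (hb : b.Prime) : nextPrime a ≤ b :=
  Nat.find_min' _ ⟨h, hb⟩

lemma nextPrime_le_two_mul {a : ℕ} (ha : a ≠ 0) : nextPrime a ≤ 2 * a := by
  obtain ⟨b, hb, h1, h2⟩ := Nat.exists_prime_lt_and_le_two_mul a ha
  exact (nextPrime_le h1.le hb).trans h2

/-- Search for a prime number by trial division, starting at the value of register `22` plus `2`.
Registers `5, 6, 7` hold the constants `1, 0, 2`; register `23` holds the trial divisor. -/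
def primeProg (x : ℕ) : Prog :=
  .seq (block (.arith .add x 22 7) [.arith .add 23 7 6])
    (.whileLt 23 x (.seq (.arith .mod 24 x 23)
      (.ifLt 6 24 (.arith .add 23 23 5) (block (.arith .add x x 5) [.arith .add 23 7 6]))))

/-- The states in which registers `5, 6, 7` hold the constants `1, 0, 2`. -/
structure HasConsts (s : State) : Prop where
  one : s.reg 5 = 1
  zero : s.reg 6 = 0
  two : s.reg 7 = 2

lemma runs_primeProg {B x : ℕ} (hx : x = 2 ∨ x = 3) {s : State} (hs : HasConsts s)
    (hB : nextPrime (s.reg 22 + 2) + 1 < B) :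
    Runs B (primeProg x) s (7 * (nextPrime (s.reg 22 + 2) + 1) ^ 2) fun s' =>
      s'.reg x = nextPrime (s.reg 22 + 2) ∧ s'.mem = s.mem ∧
        ∀ j, j ≠ x → j ≠ 23 → j ≠ 24 → s'.reg j = s.reg j := by
  set a := s.reg 22 + 2 with ha
  set P := nextPrime a with hP
  have haP : a ≤ P := le_nextPrime a
  have hPp : P.Prime := nextPrime_prime a
  -- register `x` has not passed the prime `P`, and has no divisor below register `23` so far
  set I : State → Prop := fun s' => a ≤ s'.reg x ∧ s'.reg x ≤ P ∧ 2 ≤ s'.reg 23 ∧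
    s'.reg 23 ≤ s'.reg x ∧ (∀ e, 2 ≤ e → e < s'.reg 23 → ¬ e ∣ s'.reg x) ∧ s'.mem = s.mem ∧
    ∀ j, j ≠ x → j ≠ 23 → j ≠ 24 → s'.reg j = s.reg j with hI
  set μ : State → ℕ := fun s' => (P - s'.reg x) * (P + 1) + (s'.reg x - s'.reg 23) with hμ
  have hinit : Runs B (block (.arith .add x 22 7) [.arith .add 23 7 6]) s 2 I := by
    refine Runs.of_wp _ ?_
    obtain ⟨h5, h6, h7⟩ := hs
    simp only [block, wp, ArithOp.eval, hI, reg_setReg, mem_setReg]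
    refine ⟨by rw [h7]; omega, ?_⟩
    rcases hx with rfl | rfl
    all_goals
      norm_num [h5, h6, h7]
      refine ⟨by omega, by omega, haP, fun e h1 h2 => by omega, fun j h1 h2 h3 => ?_⟩
      simp [h1, h2]
  have hbody : ∀ s', I s' → s'.reg 23 < s'.reg x → Runs B (.seq (.arith .mod 24 x 23)
      (.ifLt 6 24 (.arith .add 23 23 5) (block (.arith .add x x 5) [.arith .add 23 7 6]))) s' 4
      fun s'' => I s'' ∧ μ s'' < μ s' := by
    intro s' ⟨i1, i2, i3, i4, i5, i6, i7⟩ hlt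
    refine Runs.of_wp _ ?_
    have h5 : s'.reg 5 = 1 := by rw [i7 5 (by omega) (by omega) (by omega), hs.one]
    have h6 : s'.reg 6 = 0 := by rw [i7 6 (by omega) (by omega) (by omega), hs.zero]
    have h7 : s'.reg 7 = 2 := by rw [i7 7 (by omega) (by omega) (by omega), hs.two]
    have hmod : s'.reg x % s'.reg 23 < B :=
      (Nat.mod_lt _ (by omega)).trans (by omega)
    have hframe : ∀ j, j ≠ x → j ≠ 23 → j ≠ 24 → s'.reg j = s.reg j := i7
    simp only [block, wp, ArithOp.eval, reg_setReg]
    refine ⟨hmod, fun h => ?_, fun h => ?_⟩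
    · have hnd : ¬ s'.reg 23 ∣ s'.reg x := by
        intro hd
        rw [Nat.mod_eq_zero_of_dvd hd] at h
        simp at h
      simp only [hI, hμ, reg_setReg, mem_setReg]
      rcases hx with rfl | rfl
      all_goals
        norm_num [h5]
        refine ⟨by omega, ⟨i1, i2, by omega, by omega, fun e he1 he2 => ?_, i6, ?_⟩, by omega⟩
        · rcases Nat.lt_or_ge e (s'.reg 23) with h' | h'
          · exact i5 e he1 h'
          · rwa [show e = s'.reg 23 by omega]
        · intro j h1 h2 h3
          simp [h2, h3, i7 j h1 h2 h3]
    · have hd : s'.reg 23 ∣ s'.reg x := by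
        refine Nat.dvd_of_mod_eq_zero ?_
        rcases hx with rfl | rfl
        all_goals
          norm_num [h6] at h
          exact h
      have hne : s'.reg x ≠ P := by
        intro he
        rw [he] at hd hlt
        rcases (Nat.dvd_prime hPp).mp hd with h' | h' <;> omega
      have hμdec : (P - (s'.reg x + 1)) * (P + 1) + (s'.reg x + 1 - 2) <
          (P - s'.reg x) * (P + 1) + (s'.reg x - s'.reg 23) := by
        have : P - s'.reg x = P - (s'.reg x + 1) + 1 := by omega
        rw [this, add_mul]
        omega
      simp only [hI, hμ, reg_setReg, mem_setReg]
      rcases hx with rfl | rfl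
      all_goals
        norm_num [h5, h6, h7]
        refine ⟨by omega, by omega, ⟨by omega, by omega, by omega, fun e he1 he2 => by omega, i6, ?_⟩,
          hμdec⟩
        intro j h1 h2 h3
        simp [h1, h2, h3, i7 j h1 h2 h3]
  have hloop := fun s' (h : I s') => Runs.whileLt I μ hbody h
  refine (Runs.seq (hinit.mono le_rfl fun s' h => (hloop s' h).mono
    (t' := (P * (P + 1) + P) * 5 + 1) ?_ fun s'' h'' => h'')).mono ?_ ?_
  · have h1 : μ s' ≤ P * (P + 1) + P := by
      simp only [hμ]
      have := Nat.mul_le_mul_right (P + 1) (Nat.sub_le P (s'.reg x))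
      have h2 := h.2.1
      omega
    have := Nat.mul_le_mul_right (4 + 1) h1
    omega
  · nlinarith
  · rintro s'' ⟨⟨i1, i2, i3, i4, i5, i6, i7⟩, hnot⟩
    refine ⟨?_, i6, i7⟩
    have heq : s''.reg 23 = s''.reg x := by omega
    refine le_antisymm i2 (nextPrime_le i1 ?_)
    rw [Nat.prime_def]
    refine ⟨by omega, fun e he => ?_⟩
    have hle := Nat.le_of_dvd (by omega) he
    rcases Nat.lt_or_ge e 2 with h' | h'
    · left
      have : e ≠ 0 := by rintro rfl; simp at he; omega
      omega
    · right
      by_contra hne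
      exact i5 e h' (by omega) he

end Secretary

/-! ### The first program -/

namespace Secretary

/-- Register `22` becomes the `k`-th power of register `21`. -/
def powProg : ℕ → Prog
  | 0 => .const 22 1
  | k + 1 => .seq (powProg k) (.arith .mul 22 22 21)

lemma runs_powProg {B : ℕ} (k : ℕ) {s : State} (hs : 1 ≤ s.reg 21) (hB : s.reg 21 ^ k < B) :
    Runs B (powProg k) s (k + 1) fun s' => s'.reg 22 = s.reg 21 ^ k ∧ s'.mem = s.mem ∧
      ∀ j, j ≠ 22 → s'.reg j = s.reg j := by
  induction k with
  | zero =>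
    refine Runs.of_wp (powProg 0) ?_
    simp only [powProg, wp, reg_setReg, mem_setReg]
    simp at hB ⊢
    exact ⟨hB, fun j hj h => absurd h hj⟩
  | succ k ih =>
    have h1 : s.reg 21 ^ k ≤ s.reg 21 ^ (k + 1) := Nat.pow_le_pow_right hs (by omega)
    refine Runs.seq ((ih (by omega)).mono le_rfl fun s' h' => ?_)
    obtain ⟨e1, e2, e3⟩ := h'
    refine Runs.of_wp (.arith .mul 22 22 21) ?_
    have e4 : s'.reg 21 = s.reg 21 := e3 21 (by norm_num)
    simp only [wp, ArithOp.eval, reg_setReg, mem_setReg, e1, e4, if_true]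
    rw [← pow_succ]
    refine ⟨hB, rfl, e2, fun j hj => ?_⟩
    rw [if_neg hj]
    exact e3 j hj

/-- Register `21` becomes the binary logarithm of `n`. -/
def logProg : Prog :=
  .seq (block (.arith .add 4 0 6) [.const 5 1, .const 7 2, .arith .add 20 4 6])
    (.whileLt 5 20 (block (.arith .div 20 20 7) [.arith .add 21 21 5]))

lemma runs_logProg {B n : ℕ} (hn : 2 ≤ n) (hB : n + 2 < B) :
    Runs B logProg (State.input n) (3 * Nat.log 2 n + 5) fun s' =>
      s'.reg 21 = Nat.log 2 n ∧ s'.reg 4 = n ∧ HasConsts s' ∧ s'.mem = fun _ => 0 := by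
  have hlog : Nat.log 2 n < n := Nat.log_lt_self 2 (by omega)
  set I : State → Prop := fun s => 1 ≤ s.reg 20 ∧ s.reg 20 ≤ n ∧
    s.reg 21 + Nat.log 2 (s.reg 20) = Nat.log 2 n ∧ s.reg 4 = n ∧ HasConsts s ∧
    s.mem = fun _ => 0 with hI
  have hinit : Runs B (block (.arith .add 4 0 6) [.const 5 1, .const 7 2, .arith .add 20 4 6])
      (State.input n) 4 fun s => I s ∧ s.reg 21 = 0 := by
    refine Runs.of_wp _ ?_
    simp only [block, wp, ArithOp.eval, hI, reg_setReg, mem_setReg, State.input,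
      Function.update_apply]
    norm_num
    exact ⟨by omega, by omega, by omega, by omega, by omega, ⟨by simp, by simp, by simp⟩⟩
  have hbody : ∀ s, I s → s.reg 5 < s.reg 20 →
      Runs B (block (.arith .div 20 20 7) [.arith .add 21 21 5]) s 2 fun s' =>
        I s' ∧ Nat.log 2 (s'.reg 20) < Nat.log 2 (s.reg 20) := by
    intro s ⟨i1, i2, i3, i4, ⟨h5, h6, h7⟩, i6⟩ hlt
    refine Runs.of_wp _ ?_
    have hdiv : Nat.log 2 (s.reg 20 / 2) = Nat.log 2 (s.reg 20) - 1 := Nat.log_div_base 2 _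
    have hpos : 0 < Nat.log 2 (s.reg 20) := Nat.log_pos (by norm_num) (by omega)
    simp only [block, wp, ArithOp.eval, hI, reg_setReg, mem_setReg]
    norm_num [h5, h7]
    exact ⟨by omega, by omega, ⟨by omega, by omega, by omega, i4,
      ⟨by simp [h5], by simp [h6], by simp [h7]⟩, i6⟩, by omega⟩
  refine (Runs.seq (hinit.mono le_rfl fun s hs => (Runs.whileLt I _ hbody hs.1).mono
    (t' := Nat.log 2 n * 3 + 1) ?_ fun s' h' => h')).mono (by omega) ?_
  · have := hs.1.2.2.1
    have := hs.2
    exact Nat.succ_le_succ (Nat.mul_le_mul_right _ (by omega))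
  · rintro s' ⟨⟨i1, i2, i3, i4, i5, i6⟩, hnot⟩
    rw [i5.one] at hnot
    have : s'.reg 20 = 1 := by omega
    rw [this, Nat.log_one_right] at i3
    exact ⟨i3, i4, i5, i6⟩

/-- The primes of the construction: the least one that is at least `(log n) ^ a + 2`, with the
rounded binary logarithm. -/
noncomputable def hashPrime (a n : ℕ) : ℕ := nextPrime (Nat.log 2 n ^ a + 2)

/-- The first program: it leaves `n` in register `4`, the primes `q` and `p` in registers `2` and
`3`, and the number `q * p ^ 3` of seeds in register `0`. -/
def prepProg (a₁ a₂ : ℕ) : Prog :=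
  .seq logProg (.seq (powProg a₁) (.seq (primeProg 2) (.seq (powProg a₂) (.seq (primeProg 3)
    (block (.arith .mul 0 2 3) [.arith .mul 0 0 3, .arith .mul 0 0 3])))))

/-- The states that the second program starts from. -/
structure Prepared (n q p : ℕ) (s : State) : Prop where
  count : s.reg 0 = q * p ^ 3
  prime₁ : s.reg 2 = q
  prime₂ : s.reg 3 = p
  size : s.reg 4 = n
  one : s.reg 5 = 1
  zero : s.reg 6 = 0
  mem : s.mem = fun _ => 0

lemma runs_prepProg {B a₁ a₂ n q p : ℕ} (hn : 2 ≤ n) (hq : q = hashPrime a₁ n)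
    (hp : p = hashPrime a₂ n) (hB₁ : n + 2 < B) (hB₂ : q * p ^ 3 + 1 < B) :
    Runs B (prepProg a₁ a₂) (State.input n)
      (3 * Nat.log 2 n + 10 + a₁ + a₂ + 7 * (q + 1) ^ 2 + 7 * (p + 1) ^ 2) (Prepared n q p) := by
  have hq2 : 2 ≤ q := hq ▸ (nextPrime_prime _).two_le
  have hp2 : 2 ≤ p := hp ▸ (nextPrime_prime _).two_le
  have hlog : 1 ≤ Nat.log 2 n := Nat.log_pos (by norm_num) hn
  have hqa : Nat.log 2 n ^ a₁ + 2 ≤ q := hq ▸ le_nextPrime _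
  have hpa : Nat.log 2 n ^ a₂ + 2 ≤ p := hp ▸ le_nextPrime _
  have hp1 : 1 ≤ p ^ 2 := Nat.one_le_pow _ _ (by omega)
  have b0 : p * 1 ≤ p * p ^ 2 := Nat.mul_le_mul_left _ hp1
  have b1 : 1 * p ^ 3 ≤ q * p ^ 3 := Nat.mul_le_mul_right _ (by omega)
  have b2 : q * 1 ≤ q * p ^ 3 := Nat.mul_le_mul_left _ (Nat.one_le_pow _ _ (by omega))
  have b3 : p ^ 3 = p * p ^ 2 := by ring
  have b4 : q * p * p * p = q * p ^ 3 := by ring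
  have b5 : q * p * 1 ≤ q * p * p ^ 2 := Nat.mul_le_mul_left _ hp1
  have b6 : q * p * p * 1 ≤ q * p * p * p := Nat.mul_le_mul_left _ (by omega)
  have b7 : q * p * p ^ 2 = q * p ^ 3 := by ring
  refine (Runs.seq (t' := a₁ + 1 + (7 * (q + 1) ^ 2 + (a₂ + 1 + (7 * (p + 1) ^ 2 + 3))))
    ((runs_logProg hn hB₁).mono le_rfl ?_)).mono (by omega) fun _ h => h
  rintro s₁ ⟨l1, l2, l3, l4⟩
  refine Runs.seq ((runs_powProg a₁ (by omega) (by rw [l1]; omega)).mono le_rfl ?_)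
  rintro s₂ ⟨m1, m2, m3⟩
  rw [l1] at m1
  have c2 : HasConsts s₂ := ⟨by rw [m3 5 (by omega), l3.one], by rw [m3 6 (by omega), l3.zero],
    by rw [m3 7 (by omega), l3.two]⟩
  have e1 : nextPrime (s₂.reg 22 + 2) = q := by rw [m1, hq]; rfl
  refine Runs.seq ((runs_primeProg (Or.inl rfl) c2 (by rw [e1]; omega)).mono (by rw [e1]) ?_)
  rw [e1]
  rintro s₃ ⟨k1, k2, k3⟩
  have d21 : s₃.reg 21 = Nat.log 2 n := by
    rw [k3 21 (by omega) (by omega) (by omega), m3 21 (by omega), l1]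
  refine Runs.seq ((runs_powProg a₂ (by omega) (by rw [d21]; omega)).mono le_rfl ?_)
  rintro s₄ ⟨m1', m2', m3'⟩
  rw [d21] at m1'
  have c4 : ∀ j, j ≠ 2 → j ≠ 22 → j ≠ 23 → j ≠ 24 → s₄.reg j = s₁.reg j := fun j h1 h2 h3 h4 => by
    rw [m3' j h2, k3 j h1 h3 h4, m3 j h2]
  have c4' : HasConsts s₄ := ⟨by rw [c4 5 (by omega) (by omega) (by omega) (by omega), l3.one],
    by rw [c4 6 (by omega) (by omega) (by omega) (by omega), l3.zero],
    by rw [c4 7 (by omega) (by omega) (by omega) (by omega), l3.two]⟩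
  have e2 : nextPrime (s₄.reg 22 + 2) = p := by rw [m1', hp]; rfl
  refine Runs.seq ((runs_primeProg (Or.inr rfl) c4' (by rw [e2]; omega)).mono (by rw [e2]) ?_)
  rw [e2]
  rintro s₅ ⟨k1', k2', k3'⟩
  have f2 : s₅.reg 2 = q := by
    rw [k3' 2 (by omega) (by omega) (by omega), m3' 2 (by omega), k1]
  have f4 : s₅.reg 4 = n := by
    rw [k3' 4 (by omega) (by omega) (by omega), c4 4 (by omega) (by omega) (by omega) (by omega), l2]
  have f5 : s₅.reg 5 = 1 := by rw [k3' 5 (by omega) (by omega) (by omega), c4'.one]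
  have f6 : s₅.reg 6 = 0 := by rw [k3' 6 (by omega) (by omega) (by omega), c4'.zero]
  have fm : s₅.mem = fun _ => 0 := by rw [k2', m2', k2, m2, l4]
  refine Runs.of_wp (block (.arith .mul 0 2 3) [.arith .mul 0 0 3, .arith .mul 0 0 3]) ?_
  simp only [block, wp, ArithOp.eval, reg_setReg]
  norm_num [f2, k1']
  refine ⟨by omega, by omega, by omega, ⟨?_, ?_, ?_, ?_, ?_, ?_, ?_⟩⟩
  · simpa using b4
  all_goals simp [f2, k1', f4, f5, f6, fm]

end Secretary

/-! ### The second program -/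

namespace Secretary

open Finset

/-- Decode the seeds `x, z, y, w` from the index in register `1` into registers `7, …, 10`, and set
the base addresses `n, 2 * n, 2 * n + q` of the tables in registers `13, 14, 15`. Register `11` is
the counter of the loops, and register `12` holds the powers of `z`. -/
def seedProg : Prog :=
  block (.arith .mod 7 1 2) [.arith .div 16 1 2, .arith .mod 8 16 3, .arith .div 16 16 3,
    .arith .mod 9 16 3, .arith .div 16 16 3, .arith .mod 10 16 3,
    .arith .add 13 4 6, .arith .add 14 4 4, .arith .add 15 14 2, .const 12 1, .const 11 0]

/-- Write the slot of bucket `j` to address `2 * n + j`. -/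
def slotProg : Prog :=
  .whileLt 11 2 (block (.arith .mul 16 9 12) [.arith .add 16 16 10, .arith .mod 16 16 3,
    .arith .add 17 14 11, .store 17 16, .arith .mul 12 12 8, .arith .mod 12 12 3,
    .arith .add 11 11 5])

/-- Write the bucket of item `i` to address `n + i`, and count the items in slot `c` at address
`2 * n + q + c + 1`. -/
def bucketProg : Prog :=
  .whileLt 11 4 (block (.arith .div 16 11 2) [.arith .add 16 13 16, .load 17 16,
    .arith .mul 17 17 7, .arith .mod 18 11 2, .arith .add 17 17 18, .arith .mod 17 17 2,
    .arith .add 16 13 11, .store 16 17, .arith .add 17 14 17, .load 17 17, .arith .add 17 15 17,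
    .arith .add 17 17 5, .load 18 17, .arith .add 18 18 5, .store 17 18, .arith .add 11 11 5])

/-- Replace the counts by their partial sums. -/
def prefixProg : Prog :=
  .whileLt 11 3 (block (.arith .add 16 15 11) [.load 17 16, .arith .add 16 16 5, .load 18 16,
    .arith .add 17 17 18, .store 16 17, .arith .add 11 11 5])

/-- Write the items to their places; the address `2 * n + q + c` holds the place of the next item
in slot `c`. -/
def placeProg : Prog :=
  .whileLt 11 4 (block (.arith .add 16 13 11) [.load 16 16, .arith .add 16 14 16, .load 16 16,
    .arith .add 16 15 16, .load 17 16, .store 17 11, .arith .add 17 17 5, .store 16 17,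
    .arith .add 11 11 5])

/-- The second program: a counting sort of the items by their slots. -/
def drawProg : Prog :=
  .seq seedProg (.seq slotProg (.seq (.const 11 0) (.seq bucketProg (.seq (.const 11 0)
    (.seq prefixProg (.seq (.const 11 0) placeProg))))))

/-- The contents of the registers that do not change during the loops of the second program. -/
structure Ctx (n q p x z y w : ℕ) (s : State) : Prop where
  r2 : s.reg 2 = q
  r3 : s.reg 3 = p
  r4 : s.reg 4 = n
  r5 : s.reg 5 = 1
  r7 : s.reg 7 = x
  r8 : s.reg 8 = z
  r9 : s.reg 9 = y
  r10 : s.reg 10 = w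
  r13 : s.reg 13 = n
  r14 : s.reg 14 = 2 * n
  r15 : s.reg 15 = 2 * n + q

section

variable {B n q p x z y w : ℕ}

lemma Ctx.of_reg {s s' : State} (h : Ctx n q p x z y w s)
    (hreg : ∀ j, j ≠ 11 → j ≠ 12 → j ≠ 16 → j ≠ 17 → j ≠ 18 → s'.reg j = s.reg j) :
    Ctx n q p x z y w s' := by
  constructor <;> rw [hreg _ (by decide) (by decide) (by decide) (by decide) (by decide)]
  exacts [h.r2, h.r3, h.r4, h.r5, h.r7, h.r8, h.r9, h.r10, h.r13, h.r14, h.r15]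

lemma runs_seedProg {r : ℕ} {s : State} (hs : Prepared n q p s) (hr : r < q * p ^ 3)
    (hB : 2 * n + q + p + q * p ^ 3 < B) (hq : 2 ≤ q) (hp : 2 ≤ p) :
    Runs B seedProg (s.setReg 1 r) 12 fun s' =>
      Ctx n q p (r % q) (r / q % p) (r / q / p % p) (r / q / p / p % p) s' ∧
      s'.reg 11 = 0 ∧ s'.reg 12 = 1 ∧ s'.mem = fun _ => 0 := by
  obtain ⟨-, h2, h3, h4, h5, h6, hm⟩ := hs
  have hq0 : 0 < q := by omega
  have hp0 : 0 < p := by omega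
  have m1 := Nat.mod_lt r hq0
  have m2 := Nat.mod_lt (r / q) hp0
  have m3 := Nat.mod_lt (r / q / p) hp0
  have m4 := Nat.mod_lt (r / q / p / p) hp0
  have d1 := Nat.div_le_self r q
  have d2 := Nat.div_le_self (r / q) p
  have d3 := Nat.div_le_self (r / q / p) p
  refine Runs.of_wp seedProg ?_
  simp only [seedProg, block, wp, ArithOp.eval, reg_setReg, mem_setReg]
  norm_num [h2, h3, h4, h5, h6]
  refine ⟨by omega, by omega, by omega, by omega, by omega, by omega, by omega, by omega,
    by omega, by omega, by omega, by omega, ⟨?_, ?_, ?_, ?_, ?_, ?_, ?_, ?_, ?_, ?_, ?_⟩, hm⟩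
  all_goals simp [h2, h3, h4, h5]
  all_goals omega

/-- The slot of bucket `j`, as a natural number. -/
def slotNat (p z y w j : ℕ) : ℕ := (y * z ^ j + w) % p

lemma runs_slotProg {s : State} (hs : Ctx n q p x z y w s)
    (h11 : s.reg 11 = 0) (h12 : s.reg 12 = 1) (hm : s.mem = fun _ => 0)
    (hz : z < p) (hy : y < p) (hw : w < p) (hp : 2 ≤ p)
    (hB : 2 * n + q + p + p * p < B) :
    Runs B slotProg s (q * 9 + 1) fun s' => Ctx n q p x z y w s' ∧
      (∀ j < q, s'.mem (2 * n + j) = slotNat p z y w j) ∧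
      ∀ a, a < 2 * n ∨ 2 * n + q ≤ a → s'.mem a = 0 := by
  set I : State → Prop := fun s' => Ctx n q p x z y w s' ∧ s'.reg 11 ≤ q ∧
    s'.reg 12 = z ^ s'.reg 11 % p ∧
    (∀ j < s'.reg 11, s'.mem (2 * n + j) = slotNat p z y w j) ∧
    ∀ a, a < 2 * n ∨ 2 * n + q ≤ a → s'.mem a = 0 with hI
  have hbody : ∀ s', I s' → s'.reg 11 < s'.reg 2 → Runs B (block (.arith .mul 16 9 12)
      [.arith .add 16 16 10, .arith .mod 16 16 3,
      .arith .add 17 14 11, .store 17 16, .arith .mul 12 12 8, .arith .mod 12 12 3,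
      .arith .add 11 11 5]) s' 8 fun s'' => I s'' ∧ q - s''.reg 11 < q - s'.reg 11 := by
    intro s' ⟨c, i1, i2, i3, i4⟩ hlt
    have hp0 : 0 < p := by omega
    set j := s'.reg 11 with hj
    have hjq : j < q := by rw [c.r2] at hlt; exact hlt
    have m1 : z ^ j % p < p := Nat.mod_lt _ hp0
    have m2 : y * (z ^ j % p) ≤ (p - 1) * p := Nat.mul_le_mul (by omega) m1.le
    have m3 : z ^ j % p * z ≤ p * p := Nat.mul_le_mul m1.le hz.le
    have m4 : (p - 1) * p + p = p * p := by
      conv_lhs => rw [← Nat.succ_mul]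
      congr 1
      omega
    have m5 : (y * (z ^ j % p) + w) % p < p := Nat.mod_lt _ hp0
    have m6 : z ^ j * z % p < p := Nat.mod_lt _ hp0
    have v1 : (y * (z ^ j % p) + w) % p = slotNat p z y w j := by
      unfold slotNat
      rw [Nat.add_mod, Nat.mul_mod, Nat.mod_mod, ← Nat.mul_mod, ← Nat.add_mod]
    refine Runs.of_wp (block _ _) ?_
    simp only [block, wp, ArithOp.eval, reg_setReg, reg_setMem]
    norm_num [c.r2, c.r3, c.r5, c.r8, c.r9, c.r10, c.r14, i2, ← hj]
    refine ⟨by omega, by omega, by omega, by omega, by omega, by omega, by omega, by omega, ?_,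
      by omega⟩
    refine ⟨c.of_reg fun a h1 h2 h3 h4 h5 => ?_, ?_, ?_, ?_, ?_⟩
    · simp [h1, h2, h3, h4]
    · simp; omega
    · simp [pow_succ]
    · intro a ha
      simp only [reg_setReg, if_true] at ha
      simp only [mem_setReg, mem_setMem]
      split_ifs with h
      · rw [show a = j by omega, v1]
      · exact i3 a (by omega)
    · intro a ha
      simp only [mem_setReg, mem_setMem]
      rw [if_neg (by omega)]
      exact i4 a ha
  have hs0 : I s := by
    refine ⟨hs, by omega, ?_, fun j hj => by omega, fun a _ => by rw [hm]⟩
    rw [h11, h12, pow_zero, Nat.mod_eq_of_lt (by omega)]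
  refine (Runs.whileLt I (fun s' => q - s'.reg 11) hbody hs0).mono ?_ ?_
  · rw [h11, Nat.sub_zero]
  · rintro s' ⟨⟨c, i1, i2, i3, i4⟩, hnot⟩
    rw [c.r2] at hnot
    exact ⟨c, fun j hj => i3 j (by omega), i4⟩

/-- The number of items `j < i` in slot `c`. -/
def countEq (X : ℕ → ℕ) (i c : ℕ) : ℕ := #{j ∈ range i | X j = c}

/-- The number of items `j < n` in slots below `c`. -/
def countLt (X : ℕ → ℕ) (n c : ℕ) : ℕ := #{j ∈ range n | X j < c}

lemma countEq_succ (X : ℕ → ℕ) (i c : ℕ) :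
    countEq X (i + 1) c = countEq X i c + if X i = c then 1 else 0 := by
  unfold countEq
  rw [Finset.range_add_one, Finset.filter_insert]
  split_ifs with h
  · rw [Finset.card_insert_of_notMem (by simp)]
  · rfl

lemma countLt_succ (X : ℕ → ℕ) (n c : ℕ) : countLt X n (c + 1) = countLt X n c + countEq X n c := by
  unfold countLt countEq
  rw [← Finset.card_union_of_disjoint, ← Finset.filter_or]
  · congr 1
    refine Finset.filter_congr fun j _ => ?_
    omega
  · rw [Finset.disjoint_filter]
    intro j _ h1 h2
    omega

lemma countEq_le (X : ℕ → ℕ) (i c : ℕ) : countEq X i c ≤ i :=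
  (Finset.card_filter_le _ _).trans_eq (Finset.card_range i)

lemma countLt_le (X : ℕ → ℕ) (n c : ℕ) : countLt X n c ≤ n :=
  (Finset.card_filter_le _ _).trans_eq (Finset.card_range n)

variable {h : ℕ → ℕ} {f : ℕ → ℕ}

lemma runs_bucketProg {s : State} (hs : Ctx n q p x z y w s) (h11 : s.reg 11 = 0)
    (hf : ∀ j < q, s.mem (2 * n + j) = f j)
    (hm : ∀ a, a < 2 * n ∨ 2 * n + q ≤ a → s.mem a = 0)
    (hh0 : h 0 = 0) (hh : ∀ i, h i = (h (i / q) * x + i % q) % q) (hfp : ∀ j, f j < p)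
    (hq : 2 ≤ q) (hx : x < q) (hB : 3 * n + q + p + q * q + 1 < B) :
    Runs B bucketProg s (n * 18 + 1) fun s' => Ctx n q p x z y w s' ∧
      (∀ j < q, s'.mem (2 * n + j) = f j) ∧ (∀ i < n, s'.mem (n + i) = h i) ∧
      s'.mem (2 * n + q) = 0 ∧
      ∀ c < p, s'.mem (2 * n + q + c + 1) = countEq (fun i => f (h i)) n c := by
  have hq0 : 0 < q := by omega
  have hhq : ∀ i, h i < q := fun i => by rw [hh i]; exact Nat.mod_lt _ hq0
  set I : State → Prop := fun s' => Ctx n q p x z y w s' ∧ s'.reg 11 ≤ n ∧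
    (∀ j < q, s'.mem (2 * n + j) = f j) ∧
    (∀ i < s'.reg 11, s'.mem (n + i) = h i) ∧
    (∀ i < n, s'.reg 11 ≤ i → s'.mem (n + i) = 0) ∧
    s'.mem (2 * n + q) = 0 ∧
    ∀ c < p, s'.mem (2 * n + q + c + 1) = countEq (fun i => f (h i)) (s'.reg 11) c with hI
  have hbody : ∀ s', I s' → s'.reg 11 < s'.reg 4 → Runs B (block (.arith .div 16 11 2)
      [.arith .add 16 13 16, .load 17 16,
      .arith .mul 17 17 7, .arith .mod 18 11 2, .arith .add 17 17 18, .arith .mod 17 17 2,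
      .arith .add 16 13 11, .store 16 17, .arith .add 17 14 17, .load 17 17, .arith .add 17 15 17,
      .arith .add 17 17 5, .load 18 17, .arith .add 18 18 5, .store 17 18, .arith .add 11 11 5])
      s' 17 fun s'' => I s'' ∧ n - s''.reg 11 < n - s'.reg 11 := by
    intro s' ⟨c, i1, i2, i3, i4, i5, i6⟩ hlt
    set i := s'.reg 11 with hi
    have hin : i < n := by rw [c.r4] at hlt; exact hlt
    have hdiv : i / q ≤ i := Nat.div_le_self i q
    -- for `i = 0` the program reads the cell that it is about to write, which still holds `0`
    have hload : s'.mem (n + i / q) = h (i / q) := by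
      rcases Nat.eq_zero_or_pos i with h0 | h0
      · rw [h0, Nat.zero_div, hh0]
        exact i4 0 (by omega) (by omega)
      · exact i3 _ (Nat.div_lt_self h0 hq)
    have m1 := hhq (i / q)
    have m2 : h (i / q) * x ≤ (q - 1) * q := Nat.mul_le_mul (by omega) hx.le
    have m3 : (q - 1) * q + q = q * q := by
      conv_lhs => rw [← Nat.succ_mul]
      congr 1
      omega
    have m4 : i % q < q := Nat.mod_lt _ hq0
    have m5 := hhq i
    have m6 := hfp (h i)
    have m7 : s'.mem (2 * n + h i) = f (h i) := i2 _ m5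
    have m8 := i6 _ m6
    have m9 := countEq_le (fun i => f (h i)) i (f (h i))
    refine Runs.of_wp (block _ _) ?_
    simp only [block, wp, ArithOp.eval, reg_setReg, mem_setReg, reg_setMem, mem_setMem]
    have k1 : ¬ 2 * n + h i = n + i := by omega
    have k2 : ¬ 2 * n + q + f (h i) + 1 = n + i := by omega
    norm_num [c.r2, c.r4, c.r5, c.r7, c.r13, c.r14, c.r15, ← hi, hload, ← hh i, m7, k1, k2]
    have m10 : s'.mem (2 * n + q + f (h i) + 1) + 1 < B := by rw [m8]; omega
    refine ⟨by omega, by omega, by omega, by omega, by omega, by omega, by omega, by omega,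
      by omega, by omega, by omega, m10, by omega, m10, by omega, ?_, by omega⟩
    refine ⟨c.of_reg fun a h1 h2 h3 h4 h5 => ?_, ?_, ?_, ?_, ?_, ?_, ?_⟩
    · simp [h1, h3, h4, h5]
    · simp; omega
    · intro j hj
      simp only [mem_setReg, mem_setMem]
      rw [if_neg (by omega), if_neg (by omega)]
      exact i2 j hj
    · intro a ha
      simp only [reg_setReg, if_true] at ha
      simp only [mem_setReg, mem_setMem]
      rw [if_neg (by omega)]
      split_ifs with he
      · rw [show a = i by omega]
      · exact i3 a (by omega)
    · intro a ha ha'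
      simp only [reg_setReg, if_true] at ha'
      simp only [mem_setReg, mem_setMem]
      rw [if_neg (by omega), if_neg (by omega)]
      exact i4 a ha (by omega)
    · simp only [mem_setReg, mem_setMem]
      rw [if_neg (by omega), if_neg (by omega)]
      exact i5
    · intro d hd
      simp only [mem_setReg, mem_setMem, reg_setReg, if_true]
      rw [countEq_succ, m8]
      by_cases he : f (h i) = d
      · rw [if_pos (by omega), if_pos he, he]
      · rw [if_neg (by omega), if_neg (by omega), if_neg he, i6 d hd, add_zero]
  have hs0 : I s := by
    refine ⟨hs, by omega, hf, fun j hj => by omega, fun i hi _ => hm _ (by omega),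
      hm _ (by omega), fun c _ => ?_⟩
    rw [h11, hm _ (by omega)]
    simp [countEq]
  refine (Runs.whileLt I (fun s' => n - s'.reg 11) hbody hs0).mono ?_ ?_
  · rw [h11, Nat.sub_zero]
  · rintro s' ⟨⟨c, i1, i2, i3, i4, i5, i6⟩, hnot⟩
    rw [c.r4] at hnot
    have e : s'.reg 11 = n := by omega
    rw [e] at i3 i6
    exact ⟨c, i2, i3, i5, i6⟩

lemma runs_prefixProg {X : ℕ → ℕ} {s : State} (hs : Ctx n q p x z y w s) (h11 : s.reg 11 = 0)
    (hf : ∀ j < q, s.mem (2 * n + j) = f j) (hh : ∀ i < n, s.mem (n + i) = h i)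
    (h0 : s.mem (2 * n + q) = 0)
    (hcount : ∀ c < p, s.mem (2 * n + q + c + 1) = countEq X n c)
    (hB : 2 * n + q + p + 1 < B) :
    Runs B prefixProg s (p * 8 + 1) fun s' => Ctx n q p x z y w s' ∧
      (∀ j < q, s'.mem (2 * n + j) = f j) ∧ (∀ i < n, s'.mem (n + i) = h i) ∧
      ∀ c ≤ p, s'.mem (2 * n + q + c) = countLt X n c := by
  set I : State → Prop := fun s' => Ctx n q p x z y w s' ∧ s'.reg 11 ≤ p ∧
    (∀ j < q, s'.mem (2 * n + j) = f j) ∧ (∀ i < n, s'.mem (n + i) = h i) ∧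
    (∀ c ≤ s'.reg 11, s'.mem (2 * n + q + c) = countLt X n c) ∧
    (∀ c < p, s'.reg 11 ≤ c → s'.mem (2 * n + q + c + 1) = countEq X n c) with hI
  have hbody : ∀ s', I s' → s'.reg 11 < s'.reg 3 → Runs B (block (.arith .add 16 15 11)
      [.load 17 16, .arith .add 16 16 5, .load 18 16,
      .arith .add 17 17 18, .store 16 17, .arith .add 11 11 5])
      s' 7 fun s'' => I s'' ∧ p - s''.reg 11 < p - s'.reg 11 := by
    intro s' ⟨c, i1, i2, i3, i4, i5⟩ hlt
    set d := s'.reg 11 with hd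
    have hdp : d < p := by rw [c.r3] at hlt; exact hlt
    have m1 := i4 d le_rfl
    have m2 := i5 d hdp le_rfl
    have m3 : s'.mem (2 * n + q + d) + s'.mem (2 * n + q + d + 1) = countLt X n (d + 1) := by
      rw [countLt_succ, m1, m2]
    have m4 := countLt_le X n (d + 1)
    refine Runs.of_wp (block _ _) ?_
    simp only [block, wp, ArithOp.eval, reg_setReg, mem_setReg, reg_setMem]
    norm_num [c.r3, c.r5, c.r15, ← hd, m3]
    refine ⟨by omega, by omega, by omega, by omega, by omega, by omega, ?_, by omega⟩
    refine ⟨c.of_reg fun a h1 h2 h3 h4 h5 => ?_, ?_, ?_, ?_, ?_, ?_⟩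
    · simp [h1, h3, h4, h5]
    · simp; omega
    · intro j hj
      simp only [mem_setReg, mem_setMem]
      rw [if_neg (by omega)]
      exact i2 j hj
    · intro i hi
      simp only [mem_setReg, mem_setMem]
      rw [if_neg (by omega)]
      exact i3 i hi
    · intro e he
      simp only [reg_setReg, if_true] at he
      simp only [mem_setReg, mem_setMem]
      split_ifs with h'
      · rw [show e = d + 1 by omega]
      · exact i4 e (by omega)
    · intro e he he'
      simp only [reg_setReg, if_true] at he'
      simp only [mem_setReg, mem_setMem]
      rw [if_neg (by omega)]
      exact i5 e he (by omega)
  have hs0 : I s := by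
    refine ⟨hs, by omega, hf, hh, fun c hc => ?_, fun c hc _ => hcount c hc⟩
    obtain rfl : c = 0 := by omega
    rw [add_zero, h0]
    simp [countLt]
  refine (Runs.whileLt I (fun s' => p - s'.reg 11) hbody hs0).mono ?_ ?_
  · rw [h11, Nat.sub_zero]
  · rintro s' ⟨⟨c, i1, i2, i3, i4, i5⟩, hnot⟩
    rw [c.r3] at hnot
    exact ⟨c, i2, i3, fun e he => i4 e (by omega)⟩

/-- The place of item `i` in the sorted order. -/
def place (X : ℕ → ℕ) (n i : ℕ) : ℕ := countLt X n (X i) + countEq X i (X i)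

lemma place_eq_rank (X : ℕ → ℕ) (i : Fin n) : place X n i = rank (fun j : Fin n => X j) i := by
  have h1 : rank (fun j : Fin n => X j) i =
      #{j ∈ range n | X j < X i ∨ X j = X i ∧ j < i} := by
    refine Finset.card_bij (fun j _ => (j : ℕ)) (fun j hj => ?_) (fun a _ b _ hab => Fin.ext hab)
      fun b hb => ?_
    · simp only [Finset.mem_filter, Finset.mem_univ, true_and, Finset.mem_range,
        Fin.lt_def] at hj ⊢
      exact ⟨j.2, hj⟩
    · simp only [Finset.mem_filter, Finset.mem_range] at hb
      exact ⟨⟨b, hb.1⟩, Finset.mem_filter.mpr ⟨Finset.mem_univ _, hb.2⟩, rfl⟩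
  rw [h1, Finset.filter_or, Finset.card_union_of_disjoint]
  · unfold place countLt countEq
    congr 2
    ext j
    simp only [Finset.mem_filter, Finset.mem_range]
    have := i.2
    omega
  · rw [Finset.disjoint_filter]
    intro j _ h1 h2
    omega

lemma runs_placeProg {s : State} (hs : Ctx n q p x z y w s) (h11 : s.reg 11 = 0)
    (hf : ∀ j < q, s.mem (2 * n + j) = f j) (hh : ∀ i < n, s.mem (n + i) = h i)
    (hcount : ∀ c < p, s.mem (2 * n + q + c) = countLt (fun i => f (h i)) n c)
    (hfp : ∀ j, f j < p) (hhq : ∀ i, h i < q) (hB : 3 * n + q + p + 1 < B) :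
    Runs B placeProg s (n * 11 + 1) fun s' =>
      ∀ i < n, s'.mem (place (fun i => f (h i)) n i) = i := by
  set X : ℕ → ℕ := fun i => f (h i) with hX
  have hplace : ∀ i < n, place X n i < n := fun i hi => by
    rw [place_eq_rank X ⟨i, hi⟩]
    exact rank_lt _ _
  have hinj : ∀ i < n, ∀ j < n, place X n i = place X n j → i = j := fun i hi j hj hij => by
    rw [place_eq_rank X ⟨i, hi⟩, place_eq_rank X ⟨j, hj⟩] at hij
    have := rank_injective (fun j : Fin n => X j) (Fin.ext hij)
    exact congrArg Fin.val this
  set I : State → Prop := fun s' => Ctx n q p x z y w s' ∧ s'.reg 11 ≤ n ∧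
    (∀ j < q, s'.mem (2 * n + j) = f j) ∧ (∀ i < n, s'.mem (n + i) = h i) ∧
    (∀ c < p, s'.mem (2 * n + q + c) = countLt X n c + countEq X (s'.reg 11) c) ∧
    (∀ i < s'.reg 11, s'.mem (place X n i) = i) with hI
  have hbody : ∀ s', I s' → s'.reg 11 < s'.reg 4 → Runs B (block (.arith .add 16 13 11)
      [.load 16 16, .arith .add 16 14 16, .load 16 16,
      .arith .add 16 15 16, .load 17 16, .store 17 11, .arith .add 17 17 5, .store 16 17,
      .arith .add 11 11 5])
      s' 10 fun s'' => I s'' ∧ n - s''.reg 11 < n - s'.reg 11 := by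
    intro s' ⟨c, i1, i2, i3, i4, i5⟩ hlt
    set i := s'.reg 11 with hi
    have hin : i < n := by rw [c.r4] at hlt; exact hlt
    have m1 := i3 i hin
    have m2 := i2 _ (hhq i)
    have m3 : s'.mem (2 * n + q + f (h i)) = place X n i := i4 _ (hfp (h i))
    have m4 := hplace i hin
    have m5 := hhq i
    have m6 := hfp (h i)
    refine Runs.of_wp (block _ _) ?_
    simp only [block, wp, ArithOp.eval, reg_setReg, mem_setReg, reg_setMem]
    norm_num [c.r4, c.r5, c.r13, c.r14, c.r15, ← hi, m1, m2, m3]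
    refine ⟨by omega, by omega, by omega, by omega, by omega, by omega, by omega, by omega,
      by omega, ?_, by omega⟩
    refine ⟨c.of_reg fun a h1 h2 h3 h4 h5 => ?_, ?_, ?_, ?_, ?_, ?_⟩
    · simp [h1, h3, h4]
    · simp; omega
    · intro j hj
      simp only [mem_setReg, mem_setMem]
      rw [if_neg (by omega), if_neg (by omega)]
      exact i2 j hj
    · intro j hj
      simp only [mem_setReg, mem_setMem]
      rw [if_neg (by omega), if_neg (by omega)]
      exact i3 j hj
    · intro d hd
      simp only [mem_setReg, mem_setMem, reg_setReg, if_true]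
      rw [countEq_succ]
      by_cases he : X i = d
      · have he' : f (h i) = d := he
        rw [if_pos (by omega), if_pos he, ← he]
        rfl
      · have he' : f (h i) ≠ d := he
        rw [if_neg (by omega), if_neg (by omega), if_neg he, add_zero]
        exact i4 d hd
    · intro j hj
      simp only [reg_setReg, if_true] at hj
      have hjn : j < n := by omega
      have := hplace j hjn
      simp only [mem_setReg, mem_setMem]
      rw [if_neg (by omega)]
      split_ifs with he
      · exact (hinj j hjn i hin he).symm
      · refine i5 j ?_
        rcases Nat.lt_or_ge j i with h' | h'
        · exact h'
        · exact absurd (by rw [show j = i by omega]) he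
  have hs0 : I s := by
    refine ⟨hs, by omega, hf, hh, fun c hc => ?_, fun i hi => by omega⟩
    rw [h11, hcount c hc]
    simp [countEq]
  refine (Runs.whileLt I (fun s' => n - s'.reg 11) hbody hs0).mono ?_ ?_
  · rw [h11, Nat.sub_zero]
  · rintro s' ⟨⟨c, i1, i2, i3, i4, i5⟩, hnot⟩
    rw [c.r4] at hnot
    exact fun i hi => i5 i (by omega)

/-- The bucket of item `i`, as it is computed by the second program. -/
def itemHashNat (q x i : ℕ) : ℕ := Nat.ofDigits x (Nat.digits q i) % q

lemma itemHashNat_rec {q : ℕ} (hq : 2 ≤ q) (x i : ℕ) :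
    itemHashNat q x i = (itemHashNat q x (i / q) * x + i % q) % q := by
  unfold itemHashNat
  rw [ofDigits_digits_rec hq, Nat.cast_id, add_comm, mul_comm x]
  exact (((Nat.mod_modEq _ q).mul_right x).add_right (i % q)).symm

/-- The second program sorts the items by their slots. -/
theorem runs_drawProg {r : ℕ} {s : State} (hs : Prepared n q p s) (hr : r < q * p ^ 3)
    (hq : 2 ≤ q) (hp : 2 ≤ p) (hB : 3 * n + q + p + p * p + q * q + q * p ^ 3 + 1 < B) :
    Runs B drawProg (s.setReg 1 r) (29 * n + 9 * q + 8 * p + 19) fun s' => ∀ i < n,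
      s'.mem (place (fun i => slotNat p (r / q % p) (r / q / p % p) (r / q / p / p % p)
        (itemHashNat q (r % q) i)) n i) = i := by
  have hq0 : 0 < q := by omega
  have hp0 : 0 < p := by omega
  refine (Runs.seq (t' := q * 9 + 1 + (1 + (n * 18 + 1 + (1 + (p * 8 + 1 + (1 + (n * 11 + 1)))))))
    ((runs_seedProg hs hr (by omega) hq hp).mono le_rfl ?_)).mono (by omega) fun _ h => h
  rintro s₁ ⟨c₁, a₁, b₁, m₁⟩
  refine Runs.seq ((runs_slotProg c₁ a₁ b₁ m₁ (Nat.mod_lt _ hp0) (Nat.mod_lt _ hp0)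
    (Nat.mod_lt _ hp0) hp (by omega)).mono le_rfl ?_)
  rintro s₂ ⟨c₂, f₂, m₂⟩
  have hreset : ∀ {s' : State} {Q : State → Prop}, Q (s'.setReg 11 0) →
      Runs B (.const 11 0) s' 1 Q := fun hQ => Runs.of_wp (.const 11 0) ⟨by omega, hQ⟩
  have hctx : ∀ {s' : State}, Ctx n q p (r % q) (r / q % p) (r / q / p % p) (r / q / p / p % p) s' →
      Ctx n q p (r % q) (r / q % p) (r / q / p % p) (r / q / p / p % p) (s'.setReg 11 0) :=
    fun c => c.of_reg fun j h1 _ _ _ _ => by simp [h1]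
  refine Runs.seq (hreset ?_)
  refine Runs.seq ((runs_bucketProg (hctx c₂) (by simp) f₂ m₂ (h := itemHashNat q (r % q))
    (by simp [itemHashNat]) (itemHashNat_rec hq _) (fun j => Nat.mod_lt _ hp0) hq
    (Nat.mod_lt _ hq0) (by omega)).mono le_rfl ?_)
  rintro s₃ ⟨c₃, f₃, h₃, z₃, m₃⟩
  refine Runs.seq (hreset ?_)
  refine Runs.seq ((runs_prefixProg (hctx c₃) (by simp) f₃ h₃ z₃ m₃ (by omega)).mono le_rfl ?_)
  rintro s₄ ⟨c₄, f₄, h₄, m₄⟩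
  refine Runs.seq (hreset ?_)
  exact runs_placeProg (hctx c₄) (by simp) f₄ h₄ (fun c hc => m₄ c hc.le)
    (fun j => Nat.mod_lt _ hp0) (fun j => Nat.mod_lt _ hq0) (by omega)

end

end Secretary

/-! ### Uniform distributions on multisets of permutations -/

namespace Secretary

open Finset

section Uniform

variable {n N : ℕ} [NeZero N]

/-- The uniform distribution on the multiset of the permutations `π r`. -/
noncomputable def uniformOn (π : Fin N → Equiv.Perm (Fin n)) : PMF (Equiv.Perm (Fin n)) :=
  (PMF.uniformOfFintype (Fin N)).map π

open Classical in
lemma uniformOn_apply (π : Fin N → Equiv.Perm (Fin n)) (σ : Equiv.Perm (Fin n)) :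
    uniformOn π σ = (#{r | π r = σ} : ENNReal) / (N : ENNReal) := by
  unfold uniformOn
  rw [PMF.map_apply, tsum_fintype]
  refine (Finset.sum_congr rfl fun r _ => (?_ : _ = if π r = σ then (N : ENNReal)⁻¹ else 0)).trans ?_
  · rw [PMF.uniformOfFintype_apply, Fintype.card_fin]
    by_cases h : π r = σ
    · rw [if_pos h, if_pos h.symm]
    · rw [if_neg h, if_neg (Ne.symm h)]
  · rw [← Finset.sum_filter, Finset.sum_const, nsmul_eq_mul, div_eq_mul_inv]

open Classical in
lemma uniformOn_toReal (π : Fin N → Equiv.Perm (Fin n)) (σ : Equiv.Perm (Fin n)) :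
    (uniformOn π σ).toReal = (#{r | π r = σ} : ℝ) / N := by
  rw [uniformOn_apply, ENNReal.toReal_div]
  simp

lemma sum_uniformOn (π : Fin N → Equiv.Perm (Fin n)) :
    ∑ σ, (uniformOn π σ).toReal = 1 := by
  rw [← ENNReal.toReal_sum fun σ _ => PMF.apply_ne_top _ _]
  have := (uniformOn π).tsum_coe
  rw [tsum_fintype] at this
  rw [this, ENNReal.toReal_one]

lemma entropy_nonneg (D : PMF (Equiv.Perm (Fin n))) : 0 ≤ entropy D := by
  unfold entropy
  rw [← Finset.sum_neg_distrib]
  refine Finset.sum_nonneg fun σ _ => ?_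
  have h1 : (D σ).toReal ≤ 1 := ENNReal.toReal_le_of_le_ofReal zero_le_one (by
    simpa using D.coe_le_one σ)
  have h0 : 0 ≤ (D σ).toReal := ENNReal.toReal_nonneg
  have := Real.logb_nonpos (b := 2) (by norm_num) h0 h1
  nlinarith

/-- Every permutation in the support has probability at least `1 / N`. -/
lemma entropy_uniformOn_le (π : Fin N → Equiv.Perm (Fin n)) :
    entropy (uniformOn π) ≤ Real.logb 2 N := by
  classical
  have hN : (0 : ℝ) < N := by exact_mod_cast Nat.pos_of_ne_zero (NeZero.ne N)
  unfold entropy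
  rw [neg_le]
  calc -Real.logb 2 N = ∑ σ, (uniformOn π σ).toReal * -Real.logb 2 N := by
        rw [← Finset.sum_mul, sum_uniformOn, one_mul]
    _ ≤ _ := by
        refine Finset.sum_le_sum fun σ _ => ?_
        rw [uniformOn_toReal]
        rcases Nat.eq_zero_or_pos #{r | π r = σ} with h | h
        · simp [h]
        · refine mul_le_mul_of_nonneg_left ?_ (by positivity)
          rw [← Real.logb_inv]
          refine Real.logb_le_logb_of_le (by norm_num) (by positivity) ?_
          rw [inv_eq_one_div]
          have : (1 : ℝ) ≤ #{r | π r = σ} := by exact_mod_cast h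
          gcongr

open Classical in
lemma successProb_uniformOn (hn : 0 < n) (m : ℕ) (π : Fin N → Equiv.Perm (Fin n)) (v : Fin n → ℝ) :
    successProb hn m (uniformOn π) v =
      (∑ r, if PicksBest hn m v (π r) then (1 : ℝ) else 0) / N := by
  unfold successProb
  have h1 : ∀ σ : Equiv.Perm (Fin n), (if PicksBest hn m v σ then (uniformOn π σ).toReal else 0) =
      (∑ r, if π r = σ then (if PicksBest hn m v (π r) then (1 : ℝ) else 0) else 0) / N := by
    intro σ
    rw [uniformOn_toReal, Finset.card_filter]
    split_ifs with h
    · push_cast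
      congr 1
      refine Finset.sum_congr rfl fun r _ => ?_
      split_ifs with h1 h2
      · rfl
      · exact absurd (h1 ▸ h) h2
      · rfl
    · rw [Finset.sum_eq_zero, zero_div]
      intro r _
      split_ifs with h1 h2
      · exact absurd (h1 ▸ h2) h
      · rfl
      · rfl
  simp_rw [h1]
  rw [← Finset.sum_div, Finset.sum_comm]
  congr 1
  refine Finset.sum_congr rfl fun r _ => ?_
  rw [Finset.sum_ite_eq, if_pos (Finset.mem_univ _)]

end Uniform

/-! ### The family of distributions -/

/-- The arrival order that the second program computes from the index `r`. -/
noncomputable def drawPerm (n q p r : ℕ) : Equiv.Perm (Fin n) :=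
  sortPerm fun i => slotNat p (r / q % p) (r / q / p % p) (r / q / p / p % p)
    (itemHashNat q (r % q) i)

lemma slot_natCast {p : ℕ} (z y w j : ℕ) :
    slot (z : ZMod p) (y : ZMod p) (w : ZMod p) j = slotNat p z y w j := by
  unfold slot slotNat
  rw [← ZMod.val_natCast]
  push_cast
  rfl

lemma itemHash_natCast {q : ℕ} (x i : ℕ) : itemHash (x : ZMod q) i = itemHashNat q x i := by
  unfold itemHash itemHashNat
  rw [← ZMod.val_natCast, Nat.coe_ofDigits]

lemma drawPerm_eq (n q p r : ℕ) :
    drawPerm n q p r = seedPerm n (r : ZMod q) ((r / q : ℕ) : ZMod p) ((r / q / p : ℕ) : ZMod p)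
      ((r / q / p / p : ℕ) : ZMod p) := by
  unfold drawPerm seedPerm
  congr 1
  funext i
  rw [← slot_natCast, ← itemHash_natCast]
  simp only [ZMod.natCast_mod]

lemma sum_range_mul_eq {a b : ℕ} [NeZero a] (F : ZMod a → ℕ → ℝ) :
    ∑ r ∈ range (a * b), F r (r / a) = ∑ x : ZMod a, ∑ j ∈ range b, F x j := by
  have ha : 0 < a := Nat.pos_of_ne_zero (NeZero.ne a)
  rw [← Finset.sum_product']
  refine Finset.sum_bij' (fun r _ => ((r : ZMod a), r / a)) (fun y _ => y.1.val + a * y.2) ?_ ?_ ?_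
    ?_ ?_
  · intro r hr
    simp only [Finset.mem_product, Finset.mem_univ, true_and, Finset.mem_range] at hr ⊢
    exact Nat.div_lt_of_lt_mul hr
  · rintro ⟨x, j⟩ hy
    simp only [Finset.mem_product, Finset.mem_univ, true_and, Finset.mem_range] at hy ⊢
    have := ZMod.val_lt x
    calc x.val + a * j < a * (j + 1) := by rw [mul_add]; omega
      _ ≤ a * b := Nat.mul_le_mul_left _ hy
  · intro r _
    simp only [ZMod.val_natCast]
    exact Nat.mod_add_div r a
  · rintro ⟨x, j⟩ _
    have := ZMod.val_lt x
    refine Prod.ext ?_ ?_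
    · push_cast
      simp
    · simp only
      rw [Nat.add_mul_div_left _ _ ha, Nat.div_eq_of_lt this, zero_add]
  · intro r _
    rfl

/-- A sum over all indices is a sum over all seeds. -/
lemma sum_seeds {q p : ℕ} [NeZero q] [NeZero p] (F : ZMod q → ZMod p → ZMod p → ZMod p → ℝ) :
    ∑ r : Fin (q * p ^ 3), F ((r : ℕ) : ZMod q) ((r / q : ℕ) : ZMod p) ((r / q / p : ℕ) : ZMod p)
      ((r / q / p / p : ℕ) : ZMod p) = ∑ x, ∑ z, ∑ y, ∑ w, F x z y w := by
  rw [Fin.sum_univ_eq_sum_range (fun r => F (r : ZMod q) ((r / q : ℕ) : ZMod p)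
    ((r / q / p : ℕ) : ZMod p) ((r / q / p / p : ℕ) : ZMod p)),
    sum_range_mul_eq (fun x j => F x (j : ZMod p) ((j / p : ℕ) : ZMod p) ((j / p / p : ℕ) : ZMod p))]
  refine Finset.sum_congr rfl fun x _ => ?_
  rw [show p ^ 3 = p * (p * (p * 1)) by ring,
    sum_range_mul_eq (fun z j => F x z (j : ZMod p) ((j / p : ℕ) : ZMod p))]
  refine Finset.sum_congr rfl fun z _ => ?_
  rw [sum_range_mul_eq (fun y j => F x z y (j : ZMod p))]
  refine Finset.sum_congr rfl fun y _ => ?_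
  rw [sum_range_mul_eq (fun w _ => F x z y w)]
  simp

instance (a n : ℕ) : Fact (hashPrime a n).Prime := ⟨nextPrime_prime _⟩

instance (a b n : ℕ) : NeZero (hashPrime a n * hashPrime b n ^ 3) :=
  ⟨mul_ne_zero (nextPrime_prime _).ne_zero (pow_ne_zero _ (nextPrime_prime _).ne_zero)⟩

/-- The distributions of the theorem; `a₁` and `a₂` are the orders of magnitude of the two primes,
as exponents of `log n`. -/
noncomputable def seedDist (a₁ a₂ n : ℕ) : PMF (Equiv.Perm (Fin n)) :=
  uniformOn fun r : Fin (hashPrime a₁ n * hashPrime a₂ n ^ 3) =>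
    drawPerm n (hashPrime a₁ n) (hashPrime a₂ n) r

open Classical in
lemma successProb_seedDist (a₁ a₂ : ℕ) {n : ℕ} (hn : 0 < n) (m : ℕ) (v : Fin n → ℝ) :
    successProb hn m (seedDist a₁ a₂ n) v =
      (∑ x : ZMod (hashPrime a₁ n), ∑ z : ZMod (hashPrime a₂ n), ∑ y : ZMod (hashPrime a₂ n),
        ∑ w : ZMod (hashPrime a₂ n), if PicksBest hn m v (seedPerm n x z y w) then (1 : ℝ) else 0) /
      (hashPrime a₁ n * hashPrime a₂ n ^ 3) := by
  unfold seedDist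
  rw [successProb_uniformOn]
  simp_rw [drawPerm_eq]
  rw [sum_seeds (fun x z y w => if PicksBest hn m v (seedPerm n x z y w) then (1 : ℝ) else 0)]
  push_cast
  rfl

/-! ### Running times and word lengths -/

lemma exists_log_pow_le (k : ℕ) : ∃ K : ℕ, ∀ n : ℕ, n ≠ 0 → Nat.log 2 n ^ k ≤ K * n := by
  obtain ⟨K, hK⟩ := (tendsto_pow_const_div_const_pow_of_one_lt k
    (show (1 : ℝ) < 2 by norm_num)).bddAbove_range
  refine ⟨⌈K⌉₊, fun n hn => ?_⟩
  have h1 : (Nat.log 2 n : ℝ) ^ k / 2 ^ Nat.log 2 n ≤ K := hK ⟨_, rfl⟩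
  rw [div_le_iff₀ (by positivity)] at h1
  have h2 : (2 : ℝ) ^ Nat.log 2 n ≤ n := by exact_mod_cast Nat.pow_log_le_self 2 hn
  have h3 : (Nat.log 2 n : ℝ) ^ k ≤ ⌈K⌉₊ * n := by
    have h4 : K ≤ ⌈K⌉₊ := Nat.le_ceil K
    calc _ ≤ K * 2 ^ Nat.log 2 n := h1
      _ ≤ ⌈K⌉₊ * 2 ^ Nat.log 2 n := by gcongr
      _ ≤ _ := by gcongr
  exact_mod_cast h3

lemma hashPrime_le {n : ℕ} (a : ℕ) (hn : 2 ≤ n) : hashPrime a n + 1 ≤ 7 * Nat.log 2 n ^ a := by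
  have h1 : hashPrime a n ≤ 2 * (Nat.log 2 n ^ a + 2) := nextPrime_le_two_mul (by omega)
  have h2 : 1 ≤ Nat.log 2 n ^ a := Nat.one_le_pow _ _ (Nat.log_pos (by norm_num) hn)
  omega

/-- The primes are powers of `log n` up to constants, so the squares that bound the time of the trial
divisions are `O(n)`, and all numbers that occur are bounded by a power of `n`. -/
theorem computableInLinearTime_seedDist (a₁ a₂ : ℕ) :
    ComputableInLinearTime (seedDist a₁ a₂) := by
  classical
  obtain ⟨K₁, hK₁⟩ := exists_log_pow_le (a₁ * 2)
  obtain ⟨K₂, hK₂⟩ := exists_log_pow_le (a₂ * 2)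
  -- both primes, and the squares of their successors, are at most `κ * n`
  set κ := 49 * (K₁ + K₂) with hκ
  set K := 4 + 2 * κ + κ ^ 4 with hK
  refine ⟨prepProg a₁ a₂, drawProg, K + 4, 60 + a₁ + a₂ + 31 * κ, fun n hn => ?_⟩
  set q := hashPrime a₁ n with hq
  set p := hashPrime a₂ n with hp
  have hq2 : 2 ≤ q := (nextPrime_prime _).two_le
  have hp2 : 2 ≤ p := (nextPrime_prime _).two_le
  have hqs : (q + 1) ^ 2 ≤ κ * n := by
    calc (q + 1) ^ 2 ≤ (7 * Nat.log 2 n ^ a₁) ^ 2 :=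
          Nat.pow_le_pow_left (hashPrime_le a₁ (by omega)) 2
      _ = 49 * Nat.log 2 n ^ (a₁ * 2) := by rw [mul_pow, ← pow_mul]; norm_num
      _ ≤ 49 * (K₁ * n) := Nat.mul_le_mul_left _ (hK₁ n (by omega))
      _ ≤ κ * n := by rw [hκ]; nlinarith
  have hps : (p + 1) ^ 2 ≤ κ * n := by
    calc (p + 1) ^ 2 ≤ (7 * Nat.log 2 n ^ a₂) ^ 2 :=
          Nat.pow_le_pow_left (hashPrime_le a₂ (by omega)) 2
      _ = 49 * Nat.log 2 n ^ (a₂ * 2) := by rw [mul_pow, ← pow_mul]; norm_num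
      _ ≤ 49 * (K₂ * n) := Nat.mul_le_mul_left _ (hK₂ n (by omega))
      _ ≤ κ * n := by rw [hκ]; nlinarith
  have hqn : q ≤ κ * n := by nlinarith
  have hpn : p ≤ κ * n := by nlinarith
  have hlog : Nat.log 2 n < n := Nat.log_lt_self 2 (by omega)
  have hB : 3 * n + q + p + p * p + q * q + q * p ^ 3 + 2 < n ^ (K + 4) := by
    have h1 : q + q * q ≤ κ * n := by nlinarith
    have h2 : p + p * p ≤ κ * n := by nlinarith
    have h3 : q * p ^ 3 ≤ κ ^ 4 * n ^ 4 := by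
      calc q * p ^ 3 ≤ (κ * n) * (κ * n) ^ 3 := Nat.mul_le_mul hqn (Nat.pow_le_pow_left hpn 3)
        _ = κ ^ 4 * n ^ 4 := by ring
    have h4 : n ≤ n ^ 4 := Nat.le_self_pow (by norm_num) n
    have h5 : 2 * (κ * n) ≤ 2 * (κ * n ^ 4) := by gcongr
    have h6 : K < n ^ K := Nat.lt_pow_self (by omega)
    calc 3 * n + q + p + p * p + q * q + q * p ^ 3 + 2
        ≤ 4 * n ^ 4 + 2 * (κ * n ^ 4) + κ ^ 4 * n ^ 4 := by
          have : 2 ≤ n := by omega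
          omega
      _ = K * n ^ 4 := by rw [hK]; ring
      _ < n ^ K * n ^ 4 := Nat.mul_lt_mul_of_pos_right h6 (by positivity)
      _ = n ^ (K + 4) := (pow_add n K 4).symm
  obtain ⟨s, t, hexec, ht, hs⟩ := runs_prepProg (B := n ^ (K + 4)) (a₁ := a₁) (a₂ := a₂)
    (by omega : 2 ≤ n) hq hp (by omega) (by omega)
  refine ⟨s, t, q * p ^ 3, fun r => drawPerm n q p r, hexec, ht.trans ?_, hs.count,
    Nat.pos_of_ne_zero (NeZero.ne _), fun r => ?_, fun σ => ?_⟩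
  · have : (10 + a₁ + a₂) * 1 ≤ (10 + a₁ + a₂) * n := Nat.mul_le_mul_left _ (by omega)
    nlinarith
  · obtain ⟨s', t', h1, h2, h3⟩ := runs_drawProg (B := n ^ (K + 4)) hs r.2 hq2 hp2 (by omega)
    refine ⟨s', t', h1, h2.trans ?_, fun i => ?_⟩
    · nlinarith
    · set X : ℕ → ℕ := fun i => slotNat p (r / q % p) (r / q / p % p) (r / q / p / p % p)
        (itemHashNat q (r % q) i) with hX
      have h4 := h3 (drawPerm n q p r i) (Fin.is_lt _)
      rw [place_eq_rank] at h4
      have h5 : rank (fun j : Fin n => X j) (drawPerm n q p r i) = i :=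
        rank_sortPerm (fun j : Fin n => X j) i
      rw [h5] at h4
      exact h4
  · unfold seedDist
    rw [uniformOn_apply]

end Secretary

/-! ### Asymptotics -/

namespace Secretary

open Finset Filter Asymptotics

/-- The error term of `le_sum_picksBest` for `δ = 1 / E`, where `L = log n`, `E = L ^ A` and
`F = 2 ^ A`, and `G` is the power of `2 ^ A` that is next to `E`. The abstract quantities `ml`, `t`,
`R₁` and `R₂` stand for `meanLoss` and for the powers in the error term. -/
lemma error_le {A L E F G k p q n N ml t R₁ R₂ M : ℝ} (hA : 1 ≤ A) (hL : 1 ≤ L) (hE : 1 ≤ E)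
    (hEG : E ≤ G) (hGF : G ≤ F * E) (hF : 1 ≤ F) (hq₁ : E ^ 3 * L ^ 3 ≤ q)
    (hq₂ : q ≤ 7 * (E ^ 3 * L ^ 3)) (hp : E ^ 14 * L ^ 4 ≤ p) (hn : E ^ 3 ≤ n) (hN0 : 0 ≤ N)
    (hN : N ≤ 2 * L) (hk0 : 0 ≤ k) (hk : k + 1 ≤ 3 * A * L) (hM0 : 0 ≤ M) (hM : M ≤ 2 * A * L)
    (hml : ml = 2 * G / p + (2 * G)⁻¹) (ht : t ≤ 1 / G) (hR₁ : R₁ ≤ 1 / G) (hR₂ : R₂ ≤ G ^ 10) :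
    4 * (1 / E) + 4 / p + 4 * ml + t + R₁ + q / p * M * R₂ + (k + 1) ^ 2 * N / q +
      2 * (1 / n + N / q + q / p) / (1 / E) ^ 2 ≤
      (4 + 4 + 4 * (2 * F + 1) + 1 + 1 + 14 * A * F ^ 10 + 18 * A ^ 2 + 20) / E := by
  have hE0 : 0 < E := by linarith
  have hL0 : 0 < L := by linarith
  have hG0 : 0 < G := by linarith
  have hF0 : 0 < F := by linarith
  have hA0 : 0 < A := by linarith
  have hp0 : 0 < p := lt_of_lt_of_le (by positivity) hp
  have hq0 : 0 < q := lt_of_lt_of_le (by positivity) hq₁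
  have hn0 : 0 < n := lt_of_lt_of_le (by positivity) hn
  have hL4 : 1 ≤ L ^ 4 := one_le_pow₀ hL
  have hpE : ∀ j ≤ 14, E ^ j ≤ p := by
    intro j hj
    have h1 : E ^ j ≤ E ^ 14 := pow_le_pow_right₀ hE hj
    have h2 : E ^ 14 * 1 ≤ E ^ 14 * L ^ 4 := by gcongr
    linarith
  have hGE : 1 / G ≤ 1 / E := by gcongr
  have i1 : 4 / p ≤ 4 / E := by
    have := hpE 1 (by norm_num)
    rw [pow_one] at this
    gcongr
  have i2 : ml ≤ (2 * F + 1) / E := by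
    have h1 : 2 * G / p ≤ 2 * F / E := by
      rw [div_le_div_iff₀ hp0 hE0]
      have := hpE 2 (by norm_num)
      nlinarith
    have h2 : (2 * G)⁻¹ ≤ 1 / E := by
      rw [inv_eq_one_div]
      gcongr
      linarith
    rw [hml, add_div]
    linarith
  have i3 : q / p * M * R₂ ≤ 14 * A * F ^ 10 / E := by
    have h1 : q / p ≤ 7 * (E ^ 3 * L ^ 3) / (E ^ 14 * L ^ 4) := by gcongr
    have h2 : R₂ ≤ (F * E) ^ 10 := hR₂.trans (by gcongr)
    calc q / p * M * R₂ ≤ 7 * (E ^ 3 * L ^ 3) / (E ^ 14 * L ^ 4) * (2 * A * L) * (F * E) ^ 10 := by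
          have h3 : q / p * M ≤ 7 * (E ^ 3 * L ^ 3) / (E ^ 14 * L ^ 4) * (2 * A * L) := by
            gcongr
          calc _ ≤ q / p * M * (F * E) ^ 10 := by
                have : 0 ≤ q / p * M := by positivity
                gcongr
            _ ≤ _ := by gcongr
      _ = 14 * A * F ^ 10 / E := by field_simp; ring
  have i4 : N / q ≤ 2 / E ^ 3 := by
    rw [div_le_div_iff₀ hq0 (by positivity)]
    have h1 : L * 1 ≤ L * L ^ 2 := by
      have : 1 ≤ L ^ 2 := one_le_pow₀ hL
      gcongr
    have h2 : 0 < E ^ 3 := by positivity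
    have h3 : N * E ^ 3 ≤ 2 * L * E ^ 3 := by gcongr
    nlinarith
  have i5 : q / p ≤ 7 / E ^ 3 := by
    calc q / p ≤ 7 * (E ^ 3 * L ^ 3) / (E ^ 14 * L ^ 4) := by gcongr
      _ = 7 / (E ^ 11 * L) := by field_simp
      _ ≤ 7 / E ^ 3 := by
        have h1 : E ^ 3 ≤ E ^ 11 := pow_le_pow_right₀ hE (by norm_num)
        have h2 : 0 < E ^ 11 := by positivity
        gcongr
        nlinarith
  have i6 : 1 / n ≤ 1 / E ^ 3 := by gcongr
  have i7 : (k + 1) ^ 2 * N / q ≤ 18 * A ^ 2 / E := by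
    calc (k + 1) ^ 2 * N / q ≤ (3 * A * L) ^ 2 * (2 * L) / (E ^ 3 * L ^ 3) := by gcongr
      _ = 18 * A ^ 2 / E ^ 3 := by field_simp; ring
      _ ≤ _ := by
        have : E ≤ E ^ 3 := le_self_pow₀ hE (by norm_num)
        gcongr
  have i8 : 2 * (1 / n + N / q + q / p) / (1 / E) ^ 2 ≤ 20 / E := by
    calc 2 * (1 / n + N / q + q / p) / (1 / E) ^ 2
        ≤ 2 * (1 / E ^ 3 + 2 / E ^ 3 + 7 / E ^ 3) / (1 / E) ^ 2 := by gcongr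
      _ = 20 / E := by field_simp; norm_num
  have hsum : (4 + 4 + 4 * (2 * F + 1) + 1 + 1 + 14 * A * F ^ 10 + 18 * A ^ 2 + 20) / E =
      4 * (1 / E) + 4 / E + 4 * ((2 * F + 1) / E) + 1 / E + 1 / E + 14 * A * F ^ 10 / E +
        18 * A ^ 2 / E + 20 / E := by ring
  rw [hsum]
  linarith

/-- The constant in the bound for the failure probability. -/
noncomputable def errorConst (A : ℕ) : ℝ :=
  4 + 4 + 4 * (2 * 2 ^ A + 1) + 1 + 1 + 14 * A * (2 ^ A) ^ 10 + 18 * A ^ 2 + 20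

/-- With `l` the number of binary digits of `log n`, the bound of `le_sum_picksBest` is applied with
`k = 2 * A * l`, `M + 1 = A * l + 1` layers, `R = 8 * A * l` and `δ = (log n) ^ (-A)`. -/
theorem le_successProb_seedDist {A : ℕ} (hA : 1 ≤ A) {n : ℕ} (hn : 0 < n)
    (h8 : 8 ≤ Nat.log 2 n) (hE : (Nat.log 2 n ^ A) ^ 3 ≤ n) (hk : 2 * A * Nat.log 2 n < n)
    {v : Fin n → ℝ} (hv : Function.Injective v) :
    1 / Real.exp 1 - errorConst A / (Nat.log 2 n : ℝ) ^ A ≤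
      successProb hn ⌊(n : ℝ) / Real.exp 1⌋₊ (seedDist (3 * A + 3) (14 * A + 4) n) v := by
  set Λ := Nat.log 2 n with hΛ
  set l := Nat.log 2 Λ + 1 with hl
  have hΛl : Λ < 2 ^ l := Nat.lt_pow_succ_log_self (by norm_num) Λ
  have hlΛ : 2 ^ l ≤ 2 * Λ := by
    have := Nat.pow_log_le_self 2 (show Λ ≠ 0 by omega)
    rw [hl, pow_succ]
    omega
  have hn2 : 2 ≤ n := by
    have := Nat.log_le_self 2 n
    omega
  have hll : l ≤ Λ := Nat.log_lt_self 2 (by omega)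
  set q := hashPrime (3 * A + 3) n with hq
  set p := hashPrime (14 * A + 4) n with hp
  have hqlow : Λ ^ (3 * A + 3) + 2 ≤ q := le_nextPrime _
  have hqup : q + 1 ≤ 7 * Λ ^ (3 * A + 3) := hashPrime_le _ hn2
  have hplow : Λ ^ (14 * A + 4) + 2 ≤ p := le_nextPrime _
  have hnN : n ≤ 2 ^ (Λ + 1) := (Nat.lt_pow_succ_log_self (by norm_num) n).le
  have hkn : 2 * (A * l) < n := by
    have : 2 * (A * l) ≤ 2 * A * Λ := by
      rw [mul_assoc]
      gcongr
    omega
  have hp8 : 8 ≤ p := by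
    have : Λ ^ 1 ≤ Λ ^ (14 * A + 4) := Nat.pow_le_pow_right (by omega) (by omega)
    rw [pow_one] at this
    omega
  set L : ℝ := (Λ : ℝ) with hL
  have hL8 : (8 : ℝ) ≤ L := by rw [hL]; exact_mod_cast h8
  set E : ℝ := L ^ A with hEdef
  have hE8 : 8 ≤ E := hL8.trans (le_self_pow₀ (by linarith) (by omega))
  have hEn : E ^ 3 ≤ n := by rw [hEdef, hL]; exact_mod_cast hE
  have hδ : 1 / E ≤ 1 / 8 := by gcongr
  set G : ℝ := ((2 : ℝ) ^ l) ^ A with hG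
  have hG' : (2 : ℝ) ^ (A * l) = G := by rw [hG, ← pow_mul, mul_comm]
  have hG0 : 0 < G := by positivity
  have hbase := le_sum_picksBest (n := n) (p := p) (q := q) (N := Λ + 1) (k := 2 * (A * l))
    (M := A * l) (R := 8 * (A * l)) (δ := 1 / E) hn hnN hkn hp8 (by positivity) hδ hv
  rw [successProb_seedDist]
  change _ ≤ _ / ((q : ℝ) * (p : ℝ) ^ 3)
  have hq0 : (0 : ℝ) < q := by exact_mod_cast (by omega : 0 < q)
  have hp0 : (0 : ℝ) < p := by exact_mod_cast (by omega : 0 < p)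
  rw [le_div_iff₀ (by positivity)]
  refine le_trans ?_ hbase
  rw [mul_comm]
  refine mul_le_mul_of_nonneg_left ?_ (by positivity)
  refine sub_le_sub_left ?_ _
  unfold errorConst
  refine error_le (L := L) (G := G) (by exact_mod_cast hA) (by linarith) (by linarith) ?_ ?_ ?_ ?_
    ?_ ?_ hEn (by positivity) ?_ (by positivity) ?_ (by positivity) ?_ ?_ ?_ ?_ ?_
  · rw [hEdef, hG]
    gcongr
    rw [hL]
    exact_mod_cast hΛl.le
  · rw [hEdef, hG, ← mul_pow]
    gcongr
    rw [hL]
    exact_mod_cast hlΛ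
  · exact one_le_pow₀ (by norm_num)
  · have : (Λ : ℝ) ^ (3 * A + 3) ≤ q := by exact_mod_cast (by omega : Λ ^ (3 * A + 3) ≤ q)
    rw [hEdef, ← pow_mul, ← pow_add, mul_comm A]
    exact this
  · have : (q : ℝ) ≤ 7 * (Λ : ℝ) ^ (3 * A + 3) := by
      exact_mod_cast (by omega : q ≤ 7 * Λ ^ (3 * A + 3))
    rw [hEdef, ← pow_mul, ← pow_add, mul_comm A]
    exact this
  · have : (Λ : ℝ) ^ (14 * A + 4) ≤ p := by exact_mod_cast (by omega : Λ ^ (14 * A + 4) ≤ p)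
    rw [hEdef, ← pow_mul, ← pow_add, mul_comm A]
    exact this
  · push_cast
    linarith
  · have h1 : (l : ℝ) ≤ L := by rw [hL]; exact_mod_cast hll
    have h2 : (1 : ℝ) ≤ A := by exact_mod_cast hA
    have h3 : (A : ℝ) * l ≤ A * L := by gcongr
    push_cast
    nlinarith
  · have h1 : (l : ℝ) ≤ L := by rw [hL]; exact_mod_cast hll
    have h2 : (1 : ℝ) ≤ A := by exact_mod_cast hA
    have h3 : (A : ℝ) * l ≤ A * L := by gcongr
    push_cast
    nlinarith
  · unfold meanLoss
    rw [pow_succ, hG', mul_comm G 2]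
  · rw [pow_mul, ← hG', ← one_div_pow]
    gcongr
    norm_num
  · calc (2 / 3 : ℝ) ^ (8 * (A * l)) * 2 ^ (2 * (A * l)) = ((2 / 3) ^ 8 * 2 ^ 2) ^ (A * l) := by
          rw [pow_mul _ 8, pow_mul _ 2, ← mul_pow]
      _ ≤ (1 / 2) ^ (A * l) := by gcongr; norm_num
      _ = 1 / G := by rw [← hG', one_div_pow]
  · rw [← hG', ← pow_mul]
    apply le_of_eq
    congr 1
    ring

lemma logb_le_log_add_one {n : ℕ} (hn : n ≠ 0) : Real.logb 2 n ≤ Nat.log 2 n + 1 := by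
  have hn' : (0 : ℝ) < n := by exact_mod_cast Nat.pos_of_ne_zero hn
  rw [Real.logb_le_iff_le_rpow (by norm_num) hn']
  have := (Nat.lt_pow_succ_log_self (show 1 < 2 by norm_num) n).le
  have h : (n : ℝ) ≤ 2 ^ (Nat.log 2 n + 1) := by exact_mod_cast this
  rw [← Real.rpow_natCast] at h
  push_cast at h
  exact h

lemma log_le_logb {n : ℕ} (hn : n ≠ 0) : (Nat.log 2 n : ℝ) ≤ Real.logb 2 n := by
  have hn' : (0 : ℝ) < n := by exact_mod_cast Nat.pos_of_ne_zero hn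
  rw [Real.le_logb_iff_rpow_le (by norm_num) hn', Real.rpow_natCast]
  exact_mod_cast Nat.pow_log_le_self 2 hn

lemma tendsto_logb_nat : Tendsto (fun n : ℕ => Real.logb 2 (n : ℝ)) atTop atTop :=
  (Real.tendsto_logb_atTop (by norm_num)).comp tendsto_natCast_atTop_atTop

lemma tendsto_logb_logb_nat :
    Tendsto (fun n : ℕ => Real.logb 2 (Real.logb 2 (n : ℝ))) atTop atTop :=
  (Real.tendsto_logb_atTop (by norm_num)).comp tendsto_logb_nat

/-- The number of seeds is bounded by a power of `log n`. -/
theorem entropy_seedDist_isBigO (a₁ a₂ : ℕ) :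
    (fun n : ℕ => entropy (seedDist a₁ a₂ n)) =O[atTop]
      (fun n : ℕ => Real.logb 2 (Real.logb 2 (n : ℝ))) := by
  set m := a₁ + a₂ * 3 with hm
  refine IsBigO.of_bound (Real.logb 2 (7 ^ 4) + m) ?_
  filter_upwards [tendsto_logb_logb_nat.eventually_ge_atTop 1, eventually_ge_atTop 2] with n h1 hn
  have hent := entropy_uniformOn_le fun r : Fin (hashPrime a₁ n * hashPrime a₂ n ^ 3) =>
    drawPerm n (hashPrime a₁ n) (hashPrime a₂ n) r
  rw [Real.norm_of_nonneg (entropy_nonneg _), Real.norm_of_nonneg (by linarith)]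
  refine hent.trans ?_
  have hlog : 1 ≤ Nat.log 2 n := Nat.log_pos (by norm_num) hn
  have hcount : hashPrime a₁ n * hashPrime a₂ n ^ 3 ≤ 7 ^ 4 * Nat.log 2 n ^ m := by
    calc _ ≤ (7 * Nat.log 2 n ^ a₁) * (7 * Nat.log 2 n ^ a₂) ^ 3 := by
          have e1 := hashPrime_le a₁ hn
          have e2 := hashPrime_le a₂ hn
          exact Nat.mul_le_mul (by omega) (Nat.pow_le_pow_left (by omega) 3)
      _ = _ := by rw [hm, mul_pow, ← pow_mul, pow_add]; ring
  have hL : (1 : ℝ) ≤ Nat.log 2 n := by exact_mod_cast hlog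
  have hpos : (0 : ℝ) < (hashPrime a₁ n * hashPrime a₂ n ^ 3 : ℕ) := by
    exact_mod_cast Nat.pos_of_ne_zero (NeZero.ne _)
  have hcount' : ((hashPrime a₁ n * hashPrime a₂ n ^ 3 : ℕ) : ℝ) ≤ 7 ^ 4 * (Nat.log 2 n : ℝ) ^ m := by
    exact_mod_cast hcount
  have h2 := Real.logb_le_logb_of_le (b := 2) (by norm_num) hpos hcount'
  rw [Real.logb_mul (by norm_num) (by positivity), Real.logb_pow 2 (Nat.log 2 n : ℝ) m] at h2
  have h3 : Real.logb 2 (Nat.log 2 n) ≤ Real.logb 2 (Real.logb 2 n) :=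
    Real.logb_le_logb_of_le (by norm_num) (by linarith) (log_le_logb (by omega))
  have h4 : 0 ≤ Real.logb 2 (7 ^ 4) := Real.logb_nonneg (by norm_num) (by norm_num)
  have h5 : (m : ℝ) * Real.logb 2 (Nat.log 2 n) ≤ m * Real.logb 2 (Real.logb 2 n) := by gcongr
  nlinarith

/-- The bound for the failure probability is of smaller order than the allowed one. -/
lemma error_isLittleO {C : ℝ} {A : ℕ} (hA : C / 2 ≤ A) (K : ℝ) :
    (fun n : ℕ => K / (Nat.log 2 n : ℝ) ^ A) =o[atTop] (fun n : ℕ =>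
      (Real.logb 2 (Real.logb 2 (n : ℝ))) ^ 2 / (Real.logb 2 (n : ℝ)) ^ (C / 2)) := by
  have h1 : (fun n : ℕ => K / (Nat.log 2 n : ℝ) ^ A) =O[atTop]
      (fun n : ℕ => 1 * ((Real.logb 2 (n : ℝ)) ^ (C / 2))⁻¹) := by
    refine IsBigO.of_bound (|K| * 2 ^ A) ?_
    filter_upwards [tendsto_logb_nat.eventually_ge_atTop 2, eventually_ge_atTop 1] with n h2 hn
    set l := Real.logb 2 (n : ℝ) with hl
    have h3 := logb_le_log_add_one (n := n) (by omega)
    have h4 : l / 2 ≤ Nat.log 2 n := by linarith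
    have h5 : l ^ (C / 2) ≤ l ^ A := by
      rw [← Real.rpow_natCast]
      exact Real.rpow_le_rpow_of_exponent_le (by linarith) hA
    have h6 : 0 < l ^ (C / 2) := Real.rpow_pos_of_pos (by linarith) _
    rw [one_mul, norm_div, Real.norm_eq_abs, norm_inv, Real.norm_of_nonneg h6.le,
      Real.norm_of_nonneg (by positivity)]
    calc |K| / (Nat.log 2 n : ℝ) ^ A ≤ |K| / (l / 2) ^ A := by
          gcongr
      _ = |K| * 2 ^ A * (l ^ A)⁻¹ := by rw [div_pow]; field_simp
      _ ≤ |K| * 2 ^ A * (l ^ (C / 2))⁻¹ := by gcongr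
  refine h1.trans_isLittleO ?_
  simp only [div_eq_mul_inv]
  refine IsLittleO.mul_isBigO ?_ (isBigO_refl _ _)
  rw [isLittleO_const_left]
  right
  refine tendsto_norm_atTop_atTop.comp ?_
  exact (tendsto_pow_atTop (by norm_num)).comp tendsto_logb_logb_nat

lemma successProb_nonneg {n : ℕ} (hn : 0 < n) (m : ℕ) (D : PMF (Equiv.Perm (Fin n)))
    (v : Fin n → ℝ) : 0 ≤ successProb hn m D v := by
  unfold successProb
  refine Finset.sum_nonneg fun π _ => ?_
  split_ifs
  · exact ENNReal.toReal_nonneg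
  · exact le_rfl

end Secretary

theorem mainTheorem6 (C : ℝ) (hC : 0 < C) :
    ∃ D : ∀ n : ℕ, PMF (Equiv.Perm (Fin n)),
      Secretary.ComputableInLinearTime D ∧
      (fun n : ℕ => Secretary.entropy (D n)) =O[Filter.atTop]
        (fun n : ℕ => Real.logb 2 (Real.logb 2 (n : ℝ))) ∧
      ∃ g : ℕ → ℝ,
        g =o[Filter.atTop] (fun n : ℕ =>
          (Real.logb 2 (Real.logb 2 (n : ℝ))) ^ 2 / (Real.logb 2 (n : ℝ)) ^ (C / 2)) ∧
        ∀ (n : ℕ) (hn : 3 ≤ n) (v : Fin n → ℝ), Function.Injective v →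
          1 / Real.exp 1
              - ((C / Real.logb 2 (Real.exp 1 / (Real.exp 1 - 1)))
                    * Real.logb 2 (Real.logb 2 (n : ℝ))) ^ 2
                  / (Real.logb 2 (n : ℝ)) ^ (C / 2)
              - g n
            ≤ Secretary.successProb (by omega : 0 < n) ⌊(n : ℝ) / Real.exp 1⌋₊ (D n) v := by
  classical
  set A : ℕ := ⌈C⌉₊ + 1 with hA
  have hCA : C / 2 ≤ A := by
    have := Nat.le_ceil C
    rw [hA]
    push_cast
    linarith
  obtain ⟨K₁, hK₁⟩ := Secretary.exists_log_pow_le (A * 3 + 1)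
  obtain ⟨K₂, hK₂⟩ := Secretary.exists_log_pow_le 2
  -- if `log n` is larger than `T`, then `(log n) ^ (3 * A) ≤ n` and `2 * A * log n < n`
  set T := 8 + K₁ + 2 * A * K₂ with hT
  refine ⟨Secretary.seedDist (3 * A + 3) (14 * A + 4),
    Secretary.computableInLinearTime_seedDist _ _, Secretary.entropy_seedDist_isBigO _ _,
    -- for small `n` the error term `1` makes the bound trivial
    fun n => if T < Nat.log 2 n then Secretary.errorConst A / (Nat.log 2 n : ℝ) ^ A else 1, ?_, ?_⟩
  · refine (Secretary.error_isLittleO hCA (Secretary.errorConst A)).congr' ?_ Filter.EventuallyEq.rfl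
    filter_upwards [Filter.eventually_ge_atTop (2 ^ (T + 1))] with n hn
    rw [if_pos]
    have : n ≠ 0 := by
      have : 0 < 2 ^ (T + 1) := by positivity
      omega
    exact (Nat.le_log_iff_pow_le (by norm_num) this).mpr hn
  · intro n hn v hv
    have hlog : 0 ≤ Real.logb 2 (n : ℝ) :=
      Real.logb_nonneg (by norm_num) (by exact_mod_cast (by omega : 1 ≤ n))
    have hterm : 0 ≤ ((C / Real.logb 2 (Real.exp 1 / (Real.exp 1 - 1)))
                    * Real.logb 2 (Real.logb 2 (n : ℝ))) ^ 2
                  / (Real.logb 2 (n : ℝ)) ^ (C / 2) :=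
      div_nonneg (sq_nonneg _) (Real.rpow_nonneg hlog _)
    beta_reduce
    by_cases hTn : T < Nat.log 2 n
    · have h1 : (Nat.log 2 n ^ A) ^ 3 ≤ n := by
        have h := hK₁ n (by omega)
        rw [pow_succ, pow_mul] at h
        have h3 : K₁ * n ≤ Nat.log 2 n * n := Nat.mul_le_mul_right _ (by omega)
        have h4 : Nat.log 2 n * (Nat.log 2 n ^ A) ^ 3 ≤ Nat.log 2 n * n := by
          rw [mul_comm]
          exact h.trans h3
        exact Nat.le_of_mul_le_mul_left h4 (by omega)
      have h2 : 2 * A * Nat.log 2 n < n := by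
        have h := hK₂ n (by omega)
        have h3 : Nat.log 2 n * (2 * A * Nat.log 2 n) < Nat.log 2 n * n := by
          calc Nat.log 2 n * (2 * A * Nat.log 2 n) = 2 * A * Nat.log 2 n ^ 2 := by ring
            _ ≤ 2 * A * (K₂ * n) := Nat.mul_le_mul_left _ h
            _ = 2 * A * K₂ * n := by ring
            _ < Nat.log 2 n * n := Nat.mul_lt_mul_of_pos_right (by omega) (by omega)
        exact Nat.lt_of_mul_lt_mul_left h3
      have := Secretary.le_successProb_seedDist (by omega : 1 ≤ A) (by omega : 0 < n) (by omega) h1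
        h2 hv
      rw [if_pos hTn]
      linarith
    · rw [if_neg hTn]
      have h1 := Secretary.inv_exp_le_half
      have h2 := Secretary.successProb_nonneg (by omega : 0 < n) ⌊(n : ℝ) / Real.exp 1⌋₊
        (Secretary.seedDist (3 * A + 3) (14 * A + 4) n) v
      linarith
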